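/- Let $\mathbb H_{\mathbb C}$ be the algebra of complex $2\times2$ matrices $Z=(z_{ij})$, $N(Z)=\det Z$, $\mathbb H_{\mathbb C}^\times=\{Z: N(Z)\neq0\}$, and $\mathcal{Z}=\mathbb C[z_{11},z_{12},z_{21},z_{22},N(Z)^{-1}]$, $\mathcal{Z}^+=\mathbb C[z_{11},z_{12},z_{21},z_{22}]$. Let $\square=4(\partial_{11}\partial_{22}-\partial_{12}\partial_{21})$, $\widetilde{\deg} f=f+\sum_{i,j} z_{ij}\,\partial_{ij}f$, $\mathcal H^+=\{\phi\in \mathcal{Z}^+:\square\phi=0\}$, and let $\mathcal H^-$ be the space of holomorphic functions $\phi$ on $\mathbb H_{\mathbb C}^\times$ with $\square\phi=0$ and $N(Z)^{-1}\phi(Z^{-1})\in\mathcal H^+$. The Lie algebra $\mathfrak{gl}(2,\mathbb H_{\mathbb C})\simeq\mathfrak{gl}(4,\mathbb C)$ acts on $\mathcal{Z}$ by $\varpi_2$ and on $\mathcal H^{\pm}$ by $\pi^0_l$, which are obtained by differentiating the actions of $h\in GL(2,\mathbb H_{\mathbb C})$ $$(\varpi_2(h)f)(Z)=\frac{f\big((aZ+b)(cZ+d)^{-1}\big)}{N(cZ+d)^2\,N(a'-Zc')},\qquad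 (\pi^0_l(h)\phi)(Z)=\frac{\phi\big((aZ+b)(cZ+d)^{-1}\big)}{N(cZ+d)},$$ where $h^{-1}=\begin{pmatrix}a&b\\c&d\end{pmatrix}$ and $h=\begin{pmatrix}a'&b'\\c'&d'\end{pmatrix}$. For $l\in\frac12\mathbb Z_{\ge0}$ and $m,n\in\{-l,-l+1,\dots,l\}$ put $$t^l_{n\,\underline m}(Z)=\frac1{2\pi i}\oint (sz_{11}+z_{21})^{l-m}(sz_{12}+z_{22})^{l+m}s^{-l+n}\frac{ds}s,$$ where the loop goes once counterclockwise around $0$. Let $I_2^-$ (respectively $I_2^+$) be the span of all $t^l_{n\,\underline m}(Z)N(Z)^k$ with $k\in\mathbb Z$, $k\le-2$ (respectively $k\ge-(2l+1)$), and let $\mathcal{Z}_2^-=\{f\in \mathcal{Z}: N(Z)^{-3}f(Z^{-1})\in \mathcal{Z}^+\}$. For $R>0$ let $U(2)_R=\{RU:U\in U(2)\}$, $dV=\frac14dz_{11}\wedge dz_{12}\wedge dz_{21}\wedge dz_{22}$, and orient $U(2)_R$ so that $\int_{U(2)_R}N(Z)^{-2}\,dV=-2\pi^3i$. Let $\mathbb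 D_R^+=\{Z:ZZ^*<R^2\}$, $\mathbb D_R^-=\{Z:ZZ^*>R^2\}$, and $$\Big\langle f(Z),\frac1{N(Z-W)}\Big\rangle_Z=\frac i{2\pi^3}\int_{Z\in U(2)_R}\frac{f(Z)\,dV}{N(Z-W)}.$$ Then the sums $I_2^-\oplus \mathcal{Z}^+$ and $\mathcal{Z}_2^-\oplus I_2^+$ are direct and $\varpi_2$-invariant, and as representations of $\mathfrak{gl}(2,\mathbb H_{\mathbb C})$ $$\big(\varpi_2,\ \mathcal{Z}/(I_2^-\oplus \mathcal{Z}^+)\big)\simeq(\pi^0_l,\mathcal H^+)\qquad\text{and}\qquad\big(\varpi_2,\ \mathcal{Z}/(\mathcal{Z}_2^-\oplus I_2^+)\big)\simeq(\pi^0_l,\mathcal H^-),$$ in both cases the isomorphism sends $\phi\in\mathcal H^{\pm}$ to the class of $\widetilde{\deg}\phi(Z)/N(Z)$. The inverse of the first isomorphism sends the class of $f\in \mathcal{Z}$ to the polynomial whose value at every $W\in\mathbb D^+_R$ is $\big\langle f(Z),\frac1{N(Z-W)}\big\rangle_Z$; the inverse of the second sends the class of $f$ to the element of $\mathcal H^-$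 whose value at every $W\in\mathbb D^-_R$ is $-\big\langle f(Z),\frac1{N(Z-W)}\big\rangle_Z$ (for every $R>0$ in both cases). -/

import Mathlib

open scoped Matrix

attribute [local instance 100] LieRing.ofAssociativeRing

noncomputable section

open scoped ComplexOrder

namespace TwoLoop

/-! ### Complexified quaternions and functions on their invertible elements -/

/-- The algebra of complexified quaternions, realized as `2 × 2` complex matrices. -/
abbrev HC : Type := Matrix (Fin 2) (Fin 2) ℂ

/-- The norm `N(Z) = z₁₁ z₂₂ - z₁₂ z₂₁`. -/
def N (Z : HC) : ℂ := Z 0 0 * Z 1 1 - Z 0 1 * Z 1 0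

/-- The group of invertible complexified quaternions. -/
abbrev HCx : Type := GL (Fin 2) ℂ

/-- Functions on `{Z ; N(Z) ≠ 0}`. -/
abbrev Fn : Type := HCx → ℂ

/-- Extension by zero to all of `HC`. It is only used at invertible points
and in neighbourhoods of these. -/
def ext (f : Fn) : HC → ℂ := Function.extend (fun Z : HCx => (Z : HC)) f 0

/-- The coordinate functions `z_{ij}`. -/
def coord (ij : Fin 2 × Fin 2) : Fn := fun Z => (Z : HC) ij.1 ij.2

/-- The function `N(Z)⁻¹`. -/
def invN : Fn := fun Z => (N (Z : HC))⁻¹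

/-- `ℂ[z₁₁, z₁₂, z₂₁, z₂₂, N(Z)⁻¹]`, the polynomial functions on `{Z ; N(Z) ≠ 0}`. -/
def ZhAlg : Subalgebra ℂ Fn := Algebra.adjoin ℂ (Set.range coord ∪ {invN})

/-- `ℂ[z₁₁, z₁₂, z₂₁, z₂₂]`, the polynomial functions on `HC`, restricted to `{Z ; N(Z) ≠ 0}`. -/
def polyFn : Subalgebra ℂ Fn := Algebra.adjoin ℂ (Set.range coord)

/-- The vector space `Zh = ℂ[z₁₁, z₁₂, z₂₁, z₂₂, N(Z)⁻¹]`. -/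
def Zh : Submodule ℂ Fn := Subalgebra.toSubmodule ZhAlg

/-- The inclusion of `Zh` into the space of functions. -/
def incl : Zh →ₗ[ℂ] Fn := Zh.subtype

/-- The polynomial functions on `HC` as a subspace of `Zh`. -/
def ZhPlus : Submodule ℂ Zh := (Subalgebra.toSubmodule polyFn).comap incl

/-- The map `f(Z) ↦ f(Z⁻¹) / N(Z)^k`. -/
def inversion (k : ℕ) : Fn →ₗ[ℂ] Fn where
  toFun f := fun Z => f Z⁻¹ / N (Z : HC) ^ k
  map_add' f g := by
    funext Z
    simp [add_div]
  map_smul' c f := by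
    funext Z
    simp [mul_div_assoc]

/-- `Zh_m⁻`: the elements `f` of `Zh` for which `f(Z⁻¹) / N(Z)^(m+1)` is a polynomial on `HC`. -/
def ZhMinus (m : ℕ) : Submodule ℂ Zh :=
  (Subalgebra.toSubmodule polyFn).comap ((inversion (m + 1)).comp incl)

/-! ### Differential operators -/

/-- The partial derivative `∂/∂z_{ij}`. -/
def pd (i j : Fin 2) (f : Fn) : Fn := fun Z =>
  deriv (fun t : ℂ => ext f ((Z : HC) + t • Matrix.single i j (1 : ℂ))) 0

/-- `□ = 4 (∂²/∂z₁₁∂z₂₂ - ∂²/∂z₁₂∂z₂₁)`. -/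
def box (f : Fn) : Fn := fun Z => 4 * (pd 0 0 (pd 1 1 f) Z - pd 0 1 (pd 1 0 f) Z)

/-- The degree operator plus the identity: `f ↦ f + ∑ z_{ij} ∂f/∂z_{ij}`. -/
def degt (f : Fn) : Fn := fun Z => f Z + ∑ i, ∑ j, (Z : HC) i j * pd i j f Z

theorem ext_coe (f : Fn) (Z : HCx) : ext f (Z : HC) = f Z :=
  Function.Injective.extend_apply (fun _ _ h => Units.ext h) f 0 Z

theorem N_eq_det (Z : HC) : N Z = Z.det := (Matrix.det_fin_two Z).symm

theorem N_ne_zero (Z : HCx) : N (Z : HC) ≠ 0 := by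
  rw [N_eq_det]
  exact ((Matrix.isUnit_iff_isUnit_det _).1 Z.isUnit).ne_zero

/-- Near an invertible point, all points of a coordinate line are invertible. -/
theorem eventually_unit (i j : Fin 2) (Z : HCx) :
    ∀ᶠ t : ℂ in nhds 0, ∃ Y : HCx, (Y : HC) = (Z : HC) + t • Matrix.single i j (1 : ℂ) := by
  have hc : Continuous fun t : ℂ => ((Z : HC) + t • Matrix.single i j (1 : ℂ)).det := by
    fun_prop
  have h0 : ((Z : HC) + (0 : ℂ) • Matrix.single i j (1 : ℂ)).det ≠ 0 := by
    simpa [← N_eq_det] using N_ne_zero Z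
  filter_upwards [hc.continuousAt.eventually_ne h0] with t ht
  obtain ⟨Y, hY⟩ := (Matrix.isUnit_iff_isUnit_det _).2 (isUnit_iff_ne_zero.2 ht)
  exact ⟨Y, hY⟩

/-- Elements of `Zh` have partial derivatives, which are again in `Zh`. -/
theorem exists_hasDerivAt (i j : Fin 2) {f : Fn} (hf : f ∈ Zh) : ∃ g ∈ Zh, ∀ Z : HCx,
    HasDerivAt (fun t : ℂ => ext f ((Z : HC) + t • Matrix.single i j (1 : ℂ))) (g Z) 0 := by
  have hcoord : ∀ kl : Fin 2 × Fin 2, coord kl ∈ ZhAlg := fun kl =>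
    Algebra.subset_adjoin (Or.inl ⟨kl, rfl⟩)
  have hinv : invN ∈ ZhAlg := Algebra.subset_adjoin (Or.inr rfl)
  have hline : ∀ (Z : HCx) (k l : Fin 2), HasDerivAt
      (fun t : ℂ => ((Z : HC) + t • Matrix.single i j (1 : ℂ)) k l)
      (Matrix.single i j (1 : ℂ) k l) 0 := by
    intro Z k l
    have h := ((hasDerivAt_id (0 : ℂ)).mul_const (Matrix.single i j (1 : ℂ) k l)).const_add
      ((Z : HC) k l)
    simp only [one_mul] at h
    exact h
  replace hf : f ∈ ZhAlg := hf
  change ∃ g ∈ ZhAlg, ∀ Z : HCx, HasDerivAt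
    (fun t : ℂ => ext f ((Z : HC) + t • Matrix.single i j (1 : ℂ))) (g Z) 0
  induction hf using Algebra.adjoin_induction with
  | mem f hf =>
    rcases hf with ⟨kl, rfl⟩ | rfl
    · refine ⟨algebraMap ℂ Fn (Matrix.single i j (1 : ℂ) kl.1 kl.2), ZhAlg.algebraMap_mem _, ?_⟩
      intro Z
      refine (hline Z kl.1 kl.2).congr_of_eventuallyEq ?_
      filter_upwards [eventually_unit i j Z] with t ⟨Y, hY⟩
      rw [← hY, ext_coe]
      rfl
    · let E := Matrix.single i j (1 : ℂ)
      refine ⟨-(E 0 0 • coord (1, 1) + E 1 1 • coord (0, 0) - (E 0 1 • coord (1, 0)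
        + E 1 0 • coord (0, 1))) * (invN * invN), ?_, ?_⟩
      · have hs : ∀ (c : ℂ) kl, c • coord kl ∈ ZhAlg := fun c kl => ZhAlg.smul_mem (hcoord kl) c
        exact ZhAlg.mul_mem (ZhAlg.neg_mem (ZhAlg.sub_mem (ZhAlg.add_mem (hs _ _) (hs _ _))
          (ZhAlg.add_mem (hs _ _) (hs _ _)))) (ZhAlg.mul_mem hinv hinv)
      · intro Z
        have hN : HasDerivAt (fun t : ℂ => (N ((Z : HC) + t • E))⁻¹) _ 0 :=
          ((((hline Z 0 0).mul (hline Z 1 1)).sub ((hline Z 0 1).mul (hline Z 1 0)))).inv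
            (by simpa [N] using N_ne_zero Z)
        have hev : (fun t : ℂ => ext invN ((Z : HC) + t • E))
            =ᶠ[nhds 0] fun t : ℂ => (N ((Z : HC) + t • E))⁻¹ := by
          filter_upwards [eventually_unit i j Z] with t ⟨Y, hY⟩
          change ext invN ((Z : HC) + t • Matrix.single i j (1 : ℂ))
            = (N ((Z : HC) + t • Matrix.single i j (1 : ℂ)))⁻¹
          rw [← hY, ext_coe]
          rfl
        refine (hN.congr_of_eventuallyEq hev).congr_deriv ?_
        have h : (Z : HC) 0 0 * (Z : HC) 1 1 - (Z : HC) 0 1 * (Z : HC) 1 0 ≠ 0 := N_ne_zero Z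
        simp only [zero_smul, add_zero, Pi.mul_apply, Pi.neg_apply, Pi.sub_apply, Pi.add_apply,
          Pi.smul_apply, smul_eq_mul, coord, invN, N, E]
        field_simp
  | algebraMap c =>
    refine ⟨0, ZhAlg.zero_mem, fun Z => ?_⟩
    refine (hasDerivAt_const (0 : ℂ) c).congr_of_eventuallyEq ?_
    filter_upwards [eventually_unit i j Z] with t ⟨Y, hY⟩
    rw [← hY, ext_coe]
    rfl
  | add f g _ _ hf hg =>
    obtain ⟨f', hf', hf⟩ := hf
    obtain ⟨g', hg', hg⟩ := hg
    refine ⟨f' + g', ZhAlg.add_mem hf' hg', fun Z => ?_⟩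
    refine ((hf Z).add (hg Z)).congr_of_eventuallyEq ?_
    filter_upwards [eventually_unit i j Z] with t ⟨Y, hY⟩
    simp only [← hY, ext_coe, Pi.add_apply]
  | mul f g hfm hgm hf hg =>
    obtain ⟨f', hf', hf⟩ := hf
    obtain ⟨g', hg', hg⟩ := hg
    refine ⟨f' * g + f * g', ZhAlg.add_mem (ZhAlg.mul_mem hf' hgm) (ZhAlg.mul_mem hfm hg'), fun Z => ?_⟩
    have h := (hf Z).mul (hg Z)
    simp only [zero_smul, add_zero, ext_coe] at h
    refine h.congr_of_eventuallyEq ?_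
    filter_upwards [eventually_unit i j Z] with t ⟨Y, hY⟩
    simp only [← hY, ext_coe, Pi.mul_apply]

theorem pd_mem (i j : Fin 2) {f : Fn} (hf : f ∈ Zh) : pd i j f ∈ Zh := by
  obtain ⟨g, hg, h⟩ := exists_hasDerivAt i j hf
  have : pd i j f = g := funext fun Z => (h Z).deriv
  rwa [this]

theorem pd_hasDerivAt (i j : Fin 2) {f : Fn} (hf : f ∈ Zh) (Z : HCx) :
    HasDerivAt (fun t : ℂ => ext f ((Z : HC) + t • Matrix.single i j (1 : ℂ)))
      (pd i j f Z) 0 := by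
  obtain ⟨g, _, h⟩ := exists_hasDerivAt i j hf
  exact (h Z).differentiableAt.hasDerivAt

theorem pd_add (i j : Fin 2) {f g : Fn} (hf : f ∈ Zh) (hg : g ∈ Zh) :
    pd i j (f + g) = pd i j f + pd i j g := by
  funext Z
  refine HasDerivAt.deriv ?_
  refine ((pd_hasDerivAt i j hf Z).add (pd_hasDerivAt i j hg Z)).congr_of_eventuallyEq ?_
  filter_upwards [eventually_unit i j Z] with t ⟨Y, hY⟩
  simp only [← hY, ext_coe, Pi.add_apply]

theorem pd_smul (i j : Fin 2) (c : ℂ) {f : Fn} (hf : f ∈ Zh) :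
    pd i j (c • f) = c • pd i j f := by
  funext Z
  refine HasDerivAt.deriv ?_
  refine ((pd_hasDerivAt i j hf Z).const_mul c).congr_of_eventuallyEq ?_
  filter_upwards [eventually_unit i j Z] with t ⟨Y, hY⟩
  simp only [← hY, ext_coe, Pi.smul_apply, smul_eq_mul]

/-! ### Harmonic functions -/

/-- The elements of `Zh` annihilated by `□`. -/
def harmonic : Submodule ℂ Fn where
  carrier := {f | f ∈ Zh ∧ box f = 0}
  add_mem' := by
    rintro f g ⟨hf, hf'⟩ ⟨hg, hg'⟩
    have hb : box (f + g) = box f + box g := by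
      funext Z
      simp only [box, pd_add _ _ hf hg, pd_add _ _ (pd_mem _ _ hf) (pd_mem _ _ hg), Pi.add_apply]
      ring
    exact ⟨Zh.add_mem hf hg, by rw [hb, hf', hg', add_zero]⟩
  zero_mem' := by
    have h : ∀ i j, pd i j 0 = 0 := fun i j => by
      have := pd_smul i j 0 Zh.zero_mem
      rwa [zero_smul, zero_smul] at this
    refine ⟨Zh.zero_mem, ?_⟩
    funext Z
    simp [box, h]
  smul_mem' := by
    rintro c f ⟨hf, hf'⟩
    have hb : box (c • f) = c • box f := by
      funext Z
      simp only [box, pd_smul _ _ c hf, pd_smul _ _ c (pd_mem _ _ hf), Pi.smul_apply,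
        smul_eq_mul]
      ring
    exact ⟨Zh.smul_mem c hf, by rw [hb, hf', smul_zero]⟩

/-- `H⁺`: the harmonic polynomials on `HC` (restricted to `{Z ; N(Z) ≠ 0}`). -/
def HPlus : Submodule ℂ Fn := Subalgebra.toSubmodule polyFn ⊓ harmonic

/-- `H⁻`: the harmonic functions `φ` regular at infinity, i.e. such that
`N(Z)⁻¹ φ(Z⁻¹)` is in `H⁺`. (Such a `φ` is automatically in `Zh`.) -/
def HMinus : Submodule ℂ Fn := harmonic ⊓ HPlus.comap (inversion 1)

/-! ### Matrix coefficients and the subspaces they span -/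

/-- The matrix coefficient `t^l_{n m}`, where `p = l - m`, `q = l + m`, `r = l - n`
(so `2 l = p + q` and `0 ≤ r ≤ p + q`):
`(2πi)⁻¹ ∮ (s z₁₁ + z₂₁)^(l-m) (s z₁₂ + z₂₂)^(l+m) s^(-l+n) ds/s`. -/
def tcoef (p q r : ℕ) (Z : HC) : ℂ :=
  (2 * Real.pi * Complex.I)⁻¹ * ∮ s in C(0, 1),
    (s * Z 0 0 + Z 1 0) ^ p * (s * Z 0 1 + Z 1 1) ^ q * s ^ (-(r : ℤ)) / s

/-- The span of the functions `t^l_{n m}(Z) N(Z)^k` for which `P (2 l) k` holds. -/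
def tSpan (P : ℕ → ℤ → Prop) : Submodule ℂ Zh :=
  Submodule.span ℂ {f : Zh | ∃ (p q r : ℕ) (k : ℤ), r ≤ p + q ∧ P (p + q) k ∧
    ∀ Z : HCx, incl f Z = tcoef p q r (Z : HC) * N (Z : HC) ^ k}

/-- `I₂⁻`: the span of the `t^l_{n m}(Z) N(Z)^k` with `k ≤ -2`. -/
def IMinus : Submodule ℂ Zh := tSpan fun _ k => k ≤ -2

/-- `I₂⁺`: the span of the `t^l_{n m}(Z) N(Z)^k` with `k ≥ -(2 l + 1)`. -/
def IPlus : Submodule ℂ Zh := tSpan fun l2 k => -((l2 : ℤ) + 1) ≤ k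

/-! ### Actions of `GL(2, HC)` and of its Lie algebra -/

/-- The group `GL(2, HC) ≃ GL(4, ℂ)`; the elements are `2 × 2` block matrices
with blocks in `HC`. -/
abbrev GL2HC : Type := GL (Fin 2 ⊕ Fin 2) ℂ

/-- The Lie algebra `gl(2, HC) ≃ gl(4, ℂ)`, with the commutator bracket. -/
abbrev gl2HC : Type := Matrix (Fin 2 ⊕ Fin 2) (Fin 2 ⊕ Fin 2) ℂ

/-- The conformal action `Z ↦ (a Z + b)(c Z + d)⁻¹` of the matrix with blocks `a, b, c, d`. -/
def mobius (g : GL2HC) (Z : HC) : HC :=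
  ((g : gl2HC).toBlocks₁₁ * Z + (g : gl2HC).toBlocks₁₂) *
    ((g : gl2HC).toBlocks₂₁ * Z + (g : gl2HC).toBlocks₂₂)⁻¹

/-- The factor `N(c Z + d)` of the matrix with blocks `a, b, c, d`. -/
def autR (g : GL2HC) (Z : HC) : ℂ :=
  N ((g : gl2HC).toBlocks₂₁ * Z + (g : gl2HC).toBlocks₂₂)

/-- The factor `N(a - Z c)` of the matrix with blocks `a, b, c, d`. -/
def autL (g : GL2HC) (Z : HC) : ℂ :=
  N ((g : gl2HC).toBlocks₁₁ - Z * (g : gl2HC).toBlocks₂₁)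

/-- The action `ϖ_m(h) : f(Z) ↦ f((aZ+b)(cZ+d)⁻¹) / (N(cZ+d)^m N(a'-Zc'))`, where
`a, b, c, d` are the blocks of `h⁻¹` and `a', b', c', d'` those of `h`.
The result may have singularities. -/
def varpi (m : ℕ) (h : GL2HC) (f : Fn) : Fn := fun Z =>
  ext f (mobius h⁻¹ (Z : HC)) / (autR h⁻¹ (Z : HC) ^ m * autL h (Z : HC))

/-- The action `π⁰_l(h) : φ(Z) ↦ φ((aZ+b)(cZ+d)⁻¹) / N(cZ+d)`, where
`a, b, c, d` are the blocks of `h⁻¹`. The result may have singularities. -/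
def piL (h : GL2HC) (f : Fn) : Fn := fun Z =>
  ext f (mobius h⁻¹ (Z : HC)) / autR h⁻¹ (Z : HC)

/-- The matrix exponential as an element of the group `GL(2, HC)`. -/
def expGL (X : gl2HC) : GL2HC := (Matrix.isUnit_exp X).unit

/-- `ρ` is the representation of `gl(2, HC)` on a space `V` of functions (embedded by `ι`)
that is obtained by differentiating the action `T` of `GL(2, HC)`:
`(ρ(X) v)(Z) = d/dt (T(exp(t X)) v)(Z)` at `t = 0`. -/
def IsDifferentiated (T : GL2HC → Fn → Fn) {V : Type} [AddCommGroup V] [Module ℂ V]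
    (ι : V →ₗ[ℂ] Fn) (ρ : gl2HC →ₗ⁅ℂ⁆ Module.End ℂ V) : Prop :=
  ∀ (X : gl2HC) (v : V) (Z : HCx),
    HasDerivAt (fun t : ℂ => T (expGL (t • X)) (ι v) Z) (ι (ρ X v) Z) 0

/-- `σ` is the representation on `V ⧸ S` induced by the representation `ρ` on `V`
(in particular `S` is invariant). -/
def IsQuotientRep {V : Type} [AddCommGroup V] [Module ℂ V] (S : Submodule ℂ V)
    (ρ : gl2HC →ₗ⁅ℂ⁆ Module.End ℂ V) (σ : gl2HC →ₗ⁅ℂ⁆ Module.End ℂ (V ⧸ S)) : Prop :=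
  ∀ (X : gl2HC) (v : V), σ X (S.mkQ v) = S.mkQ (ρ X v)

/-! ### Integration over `U(2)_R` -/

/-- The domain `D⁺_R = {Z ; Z Z* < R²}`. -/
def DPlus (R : ℝ) : Set HC := {Z | (((R : ℂ) ^ 2) • (1 : HC) - Z * Zᴴ).PosDef}

/-- The domain `D⁻_R = {Z ; Z Z* > R²}`. -/
def DMinus (R : ℝ) : Set HC := {Z | (Z * Zᴴ - ((R : ℂ) ^ 2) • (1 : HC)).PosDef}

/-- A parametrization of `U(2)_R`, bijective up to null sets on the box
`0 ≤ x₀, x₁, x₂ ≤ 2π`, `0 ≤ x₃ ≤ π/2`. -/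
def chart (R : ℝ) (x : Fin 4 → ℝ) : HC :=
  !![R * Complex.exp (x 0 * Complex.I) * Real.cos (x 3),
     R * Complex.exp (x 1 * Complex.I) * Real.sin (x 3);
     -(R * Complex.exp (x 2 * Complex.I) * Real.sin (x 3)),
     R * Complex.exp ((x 1 + x 2 - x 0) * Complex.I) * Real.cos (x 3)]

/-- The matrix entries in the order `z₁₁, z₁₂, z₂₁, z₂₂`. -/
def entry (k : Fin 4) (Z : HC) : ℂ := ![Z 0 0, Z 0 1, Z 1 0, Z 1 1] k

/-- The Jacobian determinant `∂(z₁₁, z₁₂, z₂₁, z₂₂) / ∂(x₀, x₁, x₂, x₃)` of the parametrization. -/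
def chartJac (R : ℝ) (x : Fin 4 → ℝ) : ℂ :=
  Matrix.det (Matrix.of fun k l : Fin 4 =>
    deriv (fun s : ℝ => entry k (chart R (Function.update x l s))) (x l))

/-- The integral over `U(2)_R` of the form `F(Z) dV`, where
`dV = ¼ dz₁₁ ∧ dz₁₂ ∧ dz₂₁ ∧ dz₂₂`, pulled back to the parameters. -/
def intU2 (R : ℝ) (F : HC → ℂ) : ℂ :=
  ∫ x₀ in (0 : ℝ)..(2 * Real.pi), ∫ x₁ in (0 : ℝ)..(2 * Real.pi),
    ∫ x₂ in (0 : ℝ)..(2 * Real.pi), ∫ x₃ in (0 : ℝ)..(Real.pi / 2),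
      F (chart R ![x₀, x₁, x₂, x₃]) * (chartJac R ![x₀, x₁, x₂, x₃] / 4)

/-- `⟨f(Z), 1/N(Z-W)⟩_Z = i/(2π³) ∫_{Z ∈ U(2)_R} f(Z) dV / N(Z-W)`. -/
def pairKernel (R : ℝ) (f : Zh) (W : HC) : ℂ :=
  Complex.I / (2 * (Real.pi : ℂ) ^ 3) * intU2 R fun Z => ext (incl f) Z / N (Z - W)

/-- The value of a polynomial in `z₁₁, z₁₂, z₂₁, z₂₂` at a point of `HC`. -/
def polyEval (P : MvPolynomial (Fin 2 × Fin 2) ℂ) (Z : HC) : ℂ :=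
  MvPolynomial.eval (fun ij => Z ij.1 ij.2) P

end TwoLoop

end

/-!
The proof works in the commutative ring `ZhAlg = ℂ[z₁₁, z₁₂, z₂₁, z₂₂, N⁻¹]`, where `∂_{ij}`, the
Euler operator `E` and the vector fields of the Lie algebra are derivations, so that identities
between them need to be checked only on the coordinates (`derivation_ext`).

The functions `t^l_{n m} N^k` with `k ∈ ℤ` form a basis of this ring (`tauBasis`). The coefficient
recurrences of the generating function `(s z₁₁ + z₂₁)^p (s z₁₂ + z₂₂)^q` show that they span. Their
linear independence follows from the reproducing property of the kernel (`kernelL_tau`): for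
`W ∈ D⁺_R` the pairing of `t^l_{n m} N^k` with `1 / N(Z - W)` is `t^l_{n m}(W) / (2l + 1)` if
`k = -1` and `0` otherwise. To prove the latter, one expands `1 / N(1 - Z⁻¹ W)` into the
characters of the symmetric powers of `Z⁻¹ W`, writes `t^l_{n m}` as a combination of powers
`tr(Z♯ Y)^(2l)` of linear forms with `N(Y) = 0`, where `Z♯` denotes the adjugate, and computes the
means over `U(2)_R` of products of such powers by polarizing the mean of `tr(Z♯ W)^n`, a Catalan
number times a power of `N(W)`.

In terms of this basis the polynomials are the span of the functions with `k ≥ 0`, and the harmonic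
polynomials the span of those with `k = 0`, because `□ (φ N^k) = 4k (k + 1 + d) φ N^(k-1)` if `φ`
is harmonic and homogeneous of degree `d`. Therefore `I₂⁻ ⊕ Zh⁺` is the span of the functions with
`k ≠ -1`. Since `N⁻¹ (1 + E) φ = (d + 1) N⁻¹ φ`, the map `φ ↦ N⁻¹ (1 + E) φ` induces a bijection of
`H⁺` with the quotient, and the reproducing property says that the pairing with the kernel is its
inverse (`exists_harmA`). The Lie algebra acts by the operators `rep α β` of first order, which come
from differentiating the group actions (`hasDerivAt_piL`, `hasDerivAt_varpi`). Invariance of `I₂⁻`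
(`rep_mem_tauSpanP_le`) and the intertwining property (`rep_degN_sub_mem`) follow from the
fact that `(d + 1) tr(Z♯ B) φ - N ∂_B φ` is again harmonic, which governs the products of `φ` with
linear forms; for the quadratic vector fields one uses `ZCZ = tr(CZ) Z - N(Z) C♯`.

The second isomorphism is deduced from the first one by the inversion `Z ↦ Z⁻¹`. The maps
`φ ↦ N⁻¹ φ(Z⁻¹)` and `f ↦ N⁻³ f(Z⁻¹)` interchange the two halves of the statement up to the
automorphism `swapBlocks` of the Lie algebra (`rep_invJ`), they carry `φ ↦ N⁻¹ (1 + E) φ` into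
its negative (`degN_invJ`), whence the sign in the second inverse, and they carry the pairing over
`U(2)_{1/R}` into that over `U(2)_R` (`pairKernel_invJ`).
-/

noncomputable section

open scoped ComplexOrder

namespace TwoLoop

/-! ### Differential calculus on the ring `ℂ[z₁₁, z₁₂, z₂₁, z₂₂, N⁻¹]` -/

/-- The coordinate function `z_{ij}` as an element of the ring `ZhAlg`. -/
def zc (i j : Fin 2) : ZhAlg := ⟨coord (i, j), Algebra.subset_adjoin (Or.inl ⟨(i, j), rfl⟩)⟩

theorem zc_apply (i j : Fin 2) (Z : HCx) : (zc i j : Fn) Z = (Z : HC) i j := rfl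

/-- The norm `N` as a unit of the ring `ZhAlg`. -/
def nu : ZhAlgˣ where
  val := zc 0 0 * zc 1 1 - zc 0 1 * zc 1 0
  inv := ⟨invN, Algebra.subset_adjoin (Or.inr rfl)⟩
  val_inv := Subtype.ext (funext fun Z => mul_inv_cancel₀ (N_ne_zero Z))
  inv_val := Subtype.ext (funext fun Z => inv_mul_cancel₀ (N_ne_zero Z))

theorem nu_val : (nu : ZhAlg) = zc 0 0 * zc 1 1 - zc 0 1 * zc 1 0 := rfl

/-- Evaluation of the elements of `ZhAlg` at an invertible point. -/
def evalAt (Z : HCx) : ZhAlg →ₐ[ℂ] ℂ := (Pi.evalAlgHom ℂ (fun _ : HCx => ℂ) Z).comp ZhAlg.val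

theorem evalAt_apply (Z : HCx) (f : ZhAlg) : evalAt Z f = (f : Fn) Z := rfl

theorem nu_zpow_apply (k : ℤ) (Z : HCx) :
    (((nu ^ k : ZhAlgˣ) : ZhAlg) : Fn) Z = N (Z : HC) ^ k := by
  have h : Units.map (evalAt Z : ZhAlg →* ℂ) (nu ^ k) = (Units.map (evalAt Z : ZhAlg →* ℂ) nu) ^ k :=
    map_zpow _ _ _
  have h2 := congrArg (fun u : ℂˣ => (u : ℂ)) h
  rw [Units.val_zpow_eq_zpow_val] at h2
  exact h2

@[ext] theorem ZhAlg_ext {f g : ZhAlg} (h : ∀ Z : HCx, (f : Fn) Z = (g : Fn) Z) : f = g :=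
  Subtype.ext (funext h)

theorem add_apply (f g : ZhAlg) (Z : HCx) : ((f + g : ZhAlg) : Fn) Z = (f : Fn) Z + (g : Fn) Z := rfl
theorem neg_apply (f : ZhAlg) (Z : HCx) : ((-f : ZhAlg) : Fn) Z = -(f : Fn) Z := rfl
theorem mul_apply (f g : ZhAlg) (Z : HCx) : ((f * g : ZhAlg) : Fn) Z = (f : Fn) Z * (g : Fn) Z := rfl
theorem pow_apply (f : ZhAlg) (n : ℕ) (Z : HCx) : ((f ^ n : ZhAlg) : Fn) Z = (f : Fn) Z ^ n := rfl
theorem one_apply (Z : HCx) : ((1 : ZhAlg) : Fn) Z = 1 := rfl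
theorem smul_apply (c : ℂ) (f : ZhAlg) (Z : HCx) :
    ((c • f : ZhAlg) : Fn) Z = c * (f : Fn) Z := rfl

theorem ZhAlg_induction {p : ZhAlg → Prop} (hz : ∀ i j, p (zc i j))
    (hn : p ((nu⁻¹ : ZhAlgˣ) : ZhAlg)) (hc : ∀ c : ℂ, p (algebraMap ℂ ZhAlg c))
    (hadd : ∀ f g, p f → p g → p (f + g)) (hmul : ∀ f g, p f → p g → p (f * g)) (f : ZhAlg) :
    p f := by
  obtain ⟨f, hf⟩ := f
  induction hf using Algebra.adjoin_induction with
  | mem f hf =>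
    rcases hf with ⟨⟨i, j⟩, rfl⟩ | rfl
    · exact hz i j
    · exact hn
  | algebraMap c => exact hc c
  | add f g hf hg h1 h2 => exact hadd _ _ h1 h2
  | mul f g hf hg h1 h2 => exact hmul _ _ h1 h2

/-- A derivation of `ZhAlg` is determined by the images of the coordinates, since its value
at `N⁻¹` is determined by that at `N`. -/
theorem derivation_ext {D₁ D₂ : Derivation ℂ ZhAlg ZhAlg}
    (h : ∀ i j, D₁ (zc i j) = D₂ (zc i j)) : D₁ = D₂ := by
  ext1 f
  induction f using ZhAlg_induction with
  | hz i j => exact h i j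
  | hn =>
    have hN : D₁ (nu : ZhAlg) = D₂ (nu : ZhAlg) := by simp [nu_val, h]
    rw [D₁.leibniz_of_mul_eq_one (Units.inv_mul nu), D₂.leibniz_of_mul_eq_one (Units.inv_mul nu), hN]
  | hc c => simp
  | hadd f g h1 h2 => simp [h1, h2]
  | hmul f g h1 h2 => simp [h1, h2]

/-- Invertibility is an open condition, so a curve of matrices through an invertible one stays invertible
near parameter `0`. -/
theorem eventually_isUnit_of_continuousAt {γ : ℂ → HC} {Z : HCx} (h0 : γ 0 = Z)
    (hγ : ∀ k l, ContinuousAt (fun t => γ t k l) 0) : ∀ᶠ t : ℂ in nhds 0, ∃ Y : HCx, (Y : HC) = γ t := by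
  have hc : ContinuousAt (fun t : ℂ => N (γ t)) 0 :=
    ((hγ 0 0).mul (hγ 1 1)).sub ((hγ 0 1).mul (hγ 1 0))
  have : N (γ 0) ≠ 0 := by rw [h0]; exact N_ne_zero Z
  filter_upwards [hc.eventually_ne this] with t ht
  rw [N_eq_det] at ht
  obtain ⟨Y, hY⟩ := (Matrix.isUnit_iff_isUnit_det _).2 (isUnit_iff_ne_zero.2 ht)
  exact ⟨Y, hY⟩

theorem pd_mul (i j : Fin 2) {f g : Fn} (hf : f ∈ Zh) (hg : g ∈ Zh) :
    pd i j (f * g) = f * pd i j g + g * pd i j f := by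
  funext Z
  refine HasDerivAt.deriv ?_
  have h := (pd_hasDerivAt i j hf Z).mul (pd_hasDerivAt i j hg Z)
  simp only [zero_smul, add_zero, ext_coe] at h
  refine (h.congr_of_eventuallyEq ?_).congr_deriv ?_
  · filter_upwards [eventually_unit i j Z] with t ⟨Y, hY⟩
    simp only [← hY, ext_coe, Pi.mul_apply]
  · simp only [Pi.add_apply, Pi.mul_apply]
    ring

/-- The partial derivative `∂/∂z_{ij}` as a derivation of `ZhAlg`. -/
def pdD (i j : Fin 2) : Derivation ℂ ZhAlg ZhAlg :=
  Derivation.mk'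
    { toFun := fun f => ⟨pd i j f, pd_mem i j f.2⟩
      map_add' := fun f g => Subtype.ext (pd_add i j f.2 g.2)
      map_smul' := fun c f => Subtype.ext (pd_smul i j c f.2) }
    fun f g => Subtype.ext (pd_mul i j f.2 g.2)

theorem pdD_coe (i j : Fin 2) (f : ZhAlg) : (pdD i j f : Fn) = pd i j f := rfl

theorem pdD_zc (i j k l : Fin 2) : pdD i j (zc k l) = if i = k ∧ j = l then 1 else 0 := by
  ext Z
  rw [pdD_coe]
  have h := pd_hasDerivAt i j (f := coord (k, l)) (zc k l).2 Z
  refine h.unique ?_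
  have h2 := ((hasDerivAt_id (0 : ℂ)).mul_const (Matrix.single i j (1 : ℂ) k l)).const_add
      ((Z : HC) k l)
  simp only [one_mul] at h2
  refine (h2.congr_of_eventuallyEq ?_).congr_deriv ?_
  · filter_upwards [eventually_unit i j Z] with t ⟨Y, hY⟩
    rw [← hY, ext_coe]
    simp only [coord, hY]
    rfl
  · by_cases h : i = k ∧ j = l <;> simp [h]

theorem pdD_comm (i j k l : Fin 2) (f : ZhAlg) : pdD i j (pdD k l f) = pdD k l (pdD i j f) := by
  have h : ⁅pdD i j, pdD k l⁆ = (0 : Derivation ℂ ZhAlg ZhAlg) := by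
    refine derivation_ext fun a b => ?_
    rw [Derivation.commutator_apply, pdD_zc, pdD_zc]
    split_ifs <;> simp
  have h2 := congrArg (fun D : Derivation ℂ ZhAlg ZhAlg => D f) h
  simp only [Derivation.commutator_apply] at h2
  exact sub_eq_zero.1 h2

/-- The chain rule along a curve through an invertible point. -/
theorem hasDerivAt_ext_curve {γ : ℂ → HC} {ξ : HC} {Z : HCx} (h0 : γ 0 = Z)
    (hγ : ∀ k l, HasDerivAt (fun t => γ t k l) (ξ k l) 0) (f : ZhAlg) :
    HasDerivAt (fun t => ext f (γ t)) (∑ k, ∑ l, ξ k l * (pdD k l f : Fn) Z) 0 := by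
  have hev := eventually_isUnit_of_continuousAt h0 fun k l => (hγ k l).continuousAt
  induction f using ZhAlg_induction with
  | hz i j =>
    refine ((hγ i j).congr_of_eventuallyEq ?_).congr_deriv ?_
    · filter_upwards [hev] with t ⟨Y, hY⟩
      rw [← hY, ext_coe]
      rfl
    · simp only [pdD_zc]
      fin_cases i <;> fin_cases j <;> simp [Fin.sum_univ_two, one_apply]
  | hn =>
    have hN := (((hγ 0 0).mul (hγ 1 1)).sub ((hγ 0 1).mul (hγ 1 0))).inv
      (by simp only [Pi.sub_apply, Pi.mul_apply, h0]; exact N_ne_zero Z)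
    refine (hN.congr_of_eventuallyEq ?_).congr_deriv ?_
    · filter_upwards [hev] with t ⟨Y, hY⟩
      rw [← hY, ext_coe]
      simp only [Pi.inv_apply, Pi.sub_apply, Pi.mul_apply, ← hY]
      rfl
    · simp only [Derivation.leibniz_of_mul_eq_one _ (Units.inv_mul nu), nu_val, map_sub,
        Derivation.leibniz, pdD_zc, smul_eq_mul]
      have hn : (((nu⁻¹ : ZhAlgˣ) : ZhAlg) : Fn) Z = (N (Z : HC))⁻¹ := rfl
      simp [Fin.sum_univ_two, h0, mul_apply, neg_apply, pow_apply, hn, zc_apply, N]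
      field_simp
      ring
  | hc c =>
    refine ((hasDerivAt_const (0 : ℂ) c).congr_of_eventuallyEq ?_).congr_deriv (by simp)
    filter_upwards [hev] with t ⟨Y, hY⟩
    rw [← hY, ext_coe]
    rfl
  | hadd f g h1 h2 =>
    refine ((h1.add h2).congr_of_eventuallyEq ?_).congr_deriv ?_
    · filter_upwards [hev] with t ⟨Y, hY⟩
      simp only [← hY, ext_coe, Pi.add_apply]
      rfl
    · simp only [map_add, add_apply, Fin.sum_univ_two]
      ring
  | hmul f g h1 h2 =>
    refine ((h1.mul h2).congr_of_eventuallyEq ?_).congr_deriv ?_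
    · filter_upwards [hev] with t ⟨Y, hY⟩
      simp only [← hY, ext_coe, Pi.mul_apply]
      rfl
    · simp only [Derivation.leibniz, smul_eq_mul, add_apply, mul_apply, Fin.sum_univ_two, h0,
        ext_coe]
      ring

theorem derivation_nu_zpow (D : Derivation ℂ ZhAlg ZhAlg) (k : ℤ) :
    D ((nu ^ k : ZhAlgˣ) : ZhAlg) = (k : ℂ) • (((nu ^ (k - 1) : ZhAlgˣ) : ZhAlg) * D (nu : ZhAlg)) := by
  have key : ∀ k : ℤ, D ((nu ^ (k + 1) : ZhAlgˣ) : ZhAlg)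
      = ((nu ^ k : ZhAlgˣ) : ZhAlg) * D (nu : ZhAlg) + (nu : ZhAlg) * D ((nu ^ k : ZhAlgˣ) : ZhAlg) := by
    intro k
    rw [zpow_add_one, Units.val_mul, Derivation.leibniz, smul_eq_mul, smul_eq_mul]
  have hmul : ∀ k : ℤ, (nu : ZhAlg) * ((nu ^ (k - 1) : ZhAlgˣ) : ZhAlg) = ((nu ^ k : ZhAlgˣ) : ZhAlg) := by
    intro k
    rw [← Units.val_mul, ← zpow_one_add, add_sub_cancel]
  induction k using Int.induction_on with
  | zero => simp
  | succ n ih =>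
    rw [key, ih, mul_smul_comm, ← mul_assoc, hmul, add_sub_cancel_right]
    push_cast
    rw [add_smul, one_smul, add_comm]
  | pred n ih =>
    have h := key (-(n : ℤ) - 1)
    rw [sub_add_cancel, ih] at h
    have h3 : (nu : ZhAlg) * D ((nu ^ (-(n : ℤ) - 1) : ZhAlgˣ) : ZhAlg) =
      (nu : ZhAlg) * (((-(n : ℤ) - 1 : ℤ) : ℂ) • (((nu ^ (-(n : ℤ) - 1 - 1) : ZhAlgˣ) : ZhAlg) * D (nu : ZhAlg))) := by
      rw [mul_smul_comm, ← mul_assoc, hmul]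
      push_cast at h ⊢
      rw [sub_smul, one_smul, h]
      ring
    exact nu.isUnit.mul_left_cancel h3

theorem nu_mul_zpow (k : ℤ) :
    (nu : ZhAlg) * ((nu ^ k : ZhAlgˣ) : ZhAlg) = ((nu ^ (k + 1) : ZhAlgˣ) : ZhAlg) := by
  rw [← Units.val_mul, ← zpow_one_add, add_comm]

/-! ### Matrix coefficients -/

section tauC

open Polynomial

variable {S : Type*} [CommRing S]

/-- The coefficient of `s^r` in `(s a + c)^p (s b + d)^q`: the matrix coefficient `t^l_{n m}`
of the matrix with rows `(a, b)` and `(c, d)`, over an arbitrary commutative ring. -/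
def tauC (a b c d : S) (p q r : ℕ) : S :=
  ((C a * X + C c) ^ p * (C b * X + C d) ^ q).coeff r

theorem map_tauC {T : Type*} [CommRing T] (f : S →+* T) (a b c d : S) (p q r : ℕ) :
    f (tauC a b c d p q r) = tauC (f a) (f b) (f c) (f d) p q r := by
  simp [tauC, ← Polynomial.coeff_map]

theorem natDegree_tauC_le (a b c d : S) (p q : ℕ) :
    ((C a * X + C c) ^ p * (C b * X + C d) ^ q).natDegree ≤ p + q := by
  have h (a c : S) (p : ℕ) : ((C a * X + C c) ^ p).natDegree ≤ p := by
    have := (natDegree_pow_le_of_le p (natDegree_linear_le (a := a) (b := c)))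
    simpa using this
  exact natDegree_mul_le_of_le (h a c p) (h b d q)

theorem tauC_eq_zero (a b c d : S) {p q r : ℕ} (h : p + q < r) : tauC a b c d p q r = 0 :=
  coeff_eq_zero_of_natDegree_lt ((natDegree_tauC_le a b c d p q).trans_lt h)

theorem sum_tauC (a b c d s : S) (p q : ℕ) :
    (a * s + c) ^ p * (b * s + d) ^ q = ∑ r ∈ Finset.range (p + q + 1), s ^ r * tauC a b c d p q r := by
  have h := eval_eq_sum_range' (Nat.lt_succ_of_le (natDegree_tauC_le a b c d p q)) s
  simp only [eval_mul, eval_pow, eval_add, eval_C, eval_X] at h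
  rw [h]
  exact Finset.sum_congr rfl fun r _ => mul_comm _ _

/-- The Clebsch–Gordan decomposition of `a t^l_{n m}`, obtained by differentiating
`(s a + c)^(p+1) (s b + d)^q` with respect to `s`. -/
theorem mul_tauC_left (a b c d : S) (p q r : ℕ) :
    ((p + q + 1 : ℕ) : S) * (a * tauC a b c d p q r) = ((r + 1 : ℕ) : S) * tauC a b c d (p + 1) q (r + 1)
      + (q : S) * ((a * d - b * c) * tauC a b c d p (q - 1) r) := by
  have h : C ((p + q + 1 : ℕ) : S) * (C a * ((C a * X + C c) ^ p * (C b * X + C d) ^ q)) =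
      derivative ((C a * X + C c) ^ (p + 1) * (C b * X + C d) ^ q)
      + C (q : S) * (C (a * d - b * c) * ((C a * X + C c) ^ p * (C b * X + C d) ^ (q - 1))) := by
    rcases q with _ | q
    · simp [derivative_pow]
      ring
    · simp [derivative_pow]
      ring
  have h2 := congrArg (fun P => coeff P r) h
  simp only [coeff_C_mul, coeff_add, coeff_derivative] at h2
  rw [tauC, h2, tauC, tauC]
  push_cast
  ring

theorem mul_tauC_right (a b c d : S) (p q r : ℕ) :
    ((p + q + 1 : ℕ) : S) * (b * tauC a b c d p q r) = ((r + 1 : ℕ) : S) * tauC a b c d p (q + 1) (r + 1)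
      - (p : S) * ((a * d - b * c) * tauC a b c d (p - 1) q r) := by
  have h : C ((p + q + 1 : ℕ) : S) * (C b * ((C a * X + C c) ^ p * (C b * X + C d) ^ q)) =
      derivative ((C a * X + C c) ^ p * (C b * X + C d) ^ (q + 1))
      - C (p : S) * (C (a * d - b * c) * ((C a * X + C c) ^ (p - 1) * (C b * X + C d) ^ q)) := by
    rcases p with _ | p
    · simp [derivative_pow]
      ring
    · simp [derivative_pow]
      ring
  have h2 := congrArg (fun P => coeff P r) h
  simp only [coeff_C_mul, coeff_sub, coeff_derivative] at h2
  rw [tauC, h2, tauC, tauC]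
  push_cast
  ring

theorem mul_tauC_left' (a b c d : S) (p q r : ℕ) :
    c * tauC a b c d p q r = tauC a b c d (p + 1) q r
      - if r = 0 then 0 else a * tauC a b c d p q (r - 1) := by
  have h : C c * ((C a * X + C c) ^ p * (C b * X + C d) ^ q) =
      (C a * X + C c) ^ (p + 1) * (C b * X + C d) ^ q
      - C a * ((C a * X + C c) ^ p * (C b * X + C d) ^ q) * X := by ring
  have h2 := congrArg (fun P => coeff P r) h
  simp only [coeff_C_mul, coeff_sub] at h2
  rw [tauC, h2]
  rcases r with _ | r <;> simp [tauC, coeff_mul_X]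

theorem mul_tauC_right' (a b c d : S) (p q r : ℕ) :
    d * tauC a b c d p q r = tauC a b c d p (q + 1) r
      - if r = 0 then 0 else b * tauC a b c d p q (r - 1) := by
  have h : C d * ((C a * X + C c) ^ p * (C b * X + C d) ^ q) =
      (C a * X + C c) ^ p * (C b * X + C d) ^ (q + 1)
      - C b * ((C a * X + C c) ^ p * (C b * X + C d) ^ q) * X := by ring
  have h2 := congrArg (fun P => coeff P r) h
  simp only [coeff_C_mul, coeff_sub] at h2
  rw [tauC, h2]
  rcases r with _ | r <;> simp [tauC, coeff_mul_X]

/-- The value at a matrix of rank one. -/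
theorem tauC_rank_one (x y z : S) (p q r : ℕ) :
    tauC (x * y) (x * z) y z p q r = ((p + q).choose r : S) * (x ^ r * y ^ p * z ^ q) := by
  have h : (C (x * y) * X + C y) ^ p * (C (x * z) * X + C z) ^ q
      = C (y ^ p * z ^ q) * (C x * X + 1) ^ (p + q) := by
    have h1 : (C (x * y) * X + C y) = C y * (C x * X + 1) := by simp; ring
    have h2 : (C (x * z) * X + C z) = C z * (C x * X + 1) := by simp; ring
    rw [h1, h2, mul_pow, mul_pow, pow_add]
    simp
    ring
  have h3 : (C x * X + 1 : S[X]) ^ (p + q) = ((X + 1) ^ (p + q)).comp (C x * X) := by simp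
  rw [tauC, h, coeff_C_mul, h3, comp_C_mul_X_coeff, coeff_X_add_one_pow]
  ring

end tauC

/-- The Laurent coefficients of a polynomial are given by Cauchy's formula. -/
theorem tcoef_eq_tauC (p q r : ℕ) (Z : HC) :
    tcoef p q r Z = tauC (Z 0 0) (Z 0 1) (Z 1 0) (Z 1 1) p q r := by
  have hpi : (2 * Real.pi * Complex.I : ℂ) ≠ 0 := by
    simp [Real.pi_ne_zero]
  have h1 : (∮ s in C(0, 1), (s * Z 0 0 + Z 1 0) ^ p * (s * Z 0 1 + Z 1 1) ^ q * s ^ (-(r : ℤ)) / s)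
      = ∮ s in C(0, 1), ∑ j ∈ Finset.range (p + q + 1),
        tauC (Z 0 0) (Z 0 1) (Z 1 0) (Z 1 1) p q j * (s - 0) ^ ((j : ℤ) - r - 1) := by
    refine circleIntegral.integral_congr zero_le_one fun s hs => ?_
    have hs0 : s ≠ 0 := by
      rintro rfl
      simp at hs
    have h2 := sum_tauC (Z 0 0) (Z 0 1) (Z 1 0) (Z 1 1) s p q
    rw [mul_comm s, mul_comm s, h2, Finset.sum_mul, Finset.sum_div]
    refine Finset.sum_congr rfl fun j _ => ?_
    rw [sub_zero, zpow_sub_one₀ hs0, sub_eq_add_neg, zpow_add₀ hs0, zpow_natCast]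
    ring
  rw [tcoef, h1, circleIntegral.integral_fun_sum]
  · have h3 : ∀ j : ℕ, (∮ s in C(0, 1), tauC (Z 0 0) (Z 0 1) (Z 1 0) (Z 1 1) p q j
        * (s - 0 : ℂ) ^ ((j : ℤ) - r - 1))
        = if j = r then tauC (Z 0 0) (Z 0 1) (Z 1 0) (Z 1 1) p q j * (2 * Real.pi * Complex.I) else 0 := by
      intro j
      rw [circleIntegral.integral_const_mul]
      split_ifs with hj
      · subst hj
        have := circleIntegral.integral_sub_center_inv (0 : ℂ) (one_ne_zero (α := ℝ))
        simp only [sub_self, zero_sub, zpow_neg_one]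
        rw [this]
      · rw [circleIntegral.integral_sub_zpow_of_ne (by omega), mul_zero]
    simp only [h3]
    rw [Finset.sum_ite_eq']
    split_ifs with hr
    · field_simp
    · rw [mul_zero, tauC_eq_zero]
      simpa [Finset.mem_range] using hr
  · intro j _
    refine ContinuousOn.circleIntegrable zero_le_one ?_
    refine continuousOn_const.mul (ContinuousOn.zpow₀ (by fun_prop) _ fun s hs => Or.inl ?_)
    rintro h
    rw [sub_zero] at h
    subst h
    simp at hs

/-- The matrix coefficient as an element of `ZhAlg`. -/
def tau (p q r : ℕ) : ZhAlg := tauC (zc 0 0) (zc 0 1) (zc 1 0) (zc 1 1) p q r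

theorem tau_apply (p q r : ℕ) (Z : HCx) : (tau p q r : Fn) Z = tcoef p q r (Z : HC) := by
  rw [tcoef_eq_tauC]
  exact map_tauC (evalAt Z).toRingHom _ _ _ _ _ _ _

theorem tau_eq_zero {p q r : ℕ} (h : p + q < r) : tau p q r = 0 := tauC_eq_zero _ _ _ _ h

/-- The span of the products `t^l_{n m} N^k` with `k ∈ K`. -/
def tauSpan (K : Set ℤ) : Submodule ℂ ZhAlg :=
  Submodule.span ℂ {f | ∃ (p q r : ℕ) (k : ℤ), r ≤ p + q ∧ k ∈ K ∧
    f = tau p q r * ((nu ^ k : ZhAlgˣ) : ZhAlg)}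

theorem tau_mem_tauSpan {K : Set ℤ} {k : ℤ} (hk : k ∈ K) (p q r : ℕ) :
    tau p q r * ((nu ^ k : ZhAlgˣ) : ZhAlg) ∈ tauSpan K := by
  by_cases h : r ≤ p + q
  · exact Submodule.subset_span ⟨p, q, r, k, h, hk, rfl⟩
  · rw [tau_eq_zero (by omega), zero_mul]
    exact zero_mem _

theorem natCast_mul_eq_smul {S : Type*} [CommRing S] [Algebra ℂ S] (n : ℕ) (f : S) :
    (n : S) * f = (n : ℂ) • f := by
  rw [Algebra.smul_def, map_natCast]

theorem mem_of_natCast_mul_mem {U : Submodule ℂ ZhAlg} {n : ℕ} {f : ZhAlg}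
    (h : ((n + 1 : ℕ) : ZhAlg) * f ∈ U) : f ∈ U := by
  rw [natCast_mul_eq_smul] at h
  have h2 := U.smul_mem (((n + 1 : ℕ) : ℂ)⁻¹) h
  rwa [inv_smul_smul₀ (by positivity)] at h2

/-- Stability of the span under a coordinate: the product of a coordinate with `t^l N^k` is a combination of
`t^{l+1/2} N^k` and `t^{l-1/2} N^(k+1)`, which is why `K` has to be closed under `k ↦ k + 1`. -/
theorem zc_mul_mem_tauSpan {K : Set ℤ} (hK : ∀ k ∈ K, k + 1 ∈ K) (i j : Fin 2) {f : ZhAlg}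
    (hf : f ∈ tauSpan K) : zc i j * f ∈ tauSpan K := by
  have h00 : ∀ (p q r : ℕ), ∀ k ∈ K, zc 0 0 * tau p q r * ((nu ^ k : ZhAlgˣ) : ZhAlg) ∈ tauSpan K := by
    intro p q r k hk
    refine mem_of_natCast_mul_mem (n := p + q) ?_
    have h := mul_tauC_left (zc 0 0) (zc 0 1) (zc 1 0) (zc 1 1) p q r
    have e : ((p + q + 1 : ℕ) : ZhAlg) * (zc 0 0 * tau p q r * ((nu ^ k : ZhAlgˣ) : ZhAlg)) =
        ((r + 1 : ℕ) : ZhAlg) * (tau (p + 1) q (r + 1) * ((nu ^ k : ZhAlgˣ) : ZhAlg))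
        + (q : ZhAlg) * (tau p (q - 1) r * ((nu ^ (k + 1) : ZhAlgˣ) : ZhAlg)) := by
      rw [← nu_mul_zpow, nu_val]
      simp only [tau]
      linear_combination ((nu ^ k : ZhAlgˣ) : ZhAlg) * h
    rw [e, natCast_mul_eq_smul, natCast_mul_eq_smul]
    exact add_mem (Submodule.smul_mem _ _ (tau_mem_tauSpan hk _ _ _))
      (Submodule.smul_mem _ _ (tau_mem_tauSpan (hK k hk) _ _ _))
  have h01 : ∀ (p q r : ℕ), ∀ k ∈ K, zc 0 1 * tau p q r * ((nu ^ k : ZhAlgˣ) : ZhAlg) ∈ tauSpan K := by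
    intro p q r k hk
    refine mem_of_natCast_mul_mem (n := p + q) ?_
    have h := mul_tauC_right (zc 0 0) (zc 0 1) (zc 1 0) (zc 1 1) p q r
    have e : ((p + q + 1 : ℕ) : ZhAlg) * (zc 0 1 * tau p q r * ((nu ^ k : ZhAlgˣ) : ZhAlg)) =
        ((r + 1 : ℕ) : ZhAlg) * (tau p (q + 1) (r + 1) * ((nu ^ k : ZhAlgˣ) : ZhAlg))
        - (p : ZhAlg) * (tau (p - 1) q r * ((nu ^ (k + 1) : ZhAlgˣ) : ZhAlg)) := by
      rw [← nu_mul_zpow, nu_val]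
      simp only [tau]
      linear_combination ((nu ^ k : ZhAlgˣ) : ZhAlg) * h
    rw [e, natCast_mul_eq_smul, natCast_mul_eq_smul]
    exact sub_mem (Submodule.smul_mem _ _ (tau_mem_tauSpan hk _ _ _))
      (Submodule.smul_mem _ _ (tau_mem_tauSpan (hK k hk) _ _ _))
  have h10 : ∀ (p q r : ℕ), ∀ k ∈ K, zc 1 0 * tau p q r * ((nu ^ k : ZhAlgˣ) : ZhAlg) ∈ tauSpan K := by
    intro p q r k hk
    rw [tau, mul_tauC_left', sub_mul]
    refine sub_mem (tau_mem_tauSpan hk _ _ _) ?_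
    split_ifs
    · simp
    · exact h00 _ _ _ k hk
  have h11 : ∀ (p q r : ℕ), ∀ k ∈ K, zc 1 1 * tau p q r * ((nu ^ k : ZhAlgˣ) : ZhAlg) ∈ tauSpan K := by
    intro p q r k hk
    rw [tau, mul_tauC_right', sub_mul]
    refine sub_mem (tau_mem_tauSpan hk _ _ _) ?_
    split_ifs
    · simp
    · exact h01 _ _ _ k hk
  induction hf using Submodule.span_induction with
  | mem f hf =>
    obtain ⟨p, q, r, k, -, hk, rfl⟩ := hf
    rw [← mul_assoc]
    fin_cases i <;> fin_cases j
    · exact h00 p q r k hk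
    · exact h01 p q r k hk
    · exact h10 p q r k hk
    · exact h11 p q r k hk
  | zero => simp
  | add f g _ _ h1 h2 => rw [mul_add]; exact add_mem h1 h2
  | smul c f _ h => rw [mul_smul_comm]; exact Submodule.smul_mem _ _ h

/-- The polynomials, as a subalgebra of `ZhAlg`. -/
def polyA : Subalgebra ℂ ZhAlg := Algebra.adjoin ℂ (Set.range fun ij : Fin 2 × Fin 2 => zc ij.1 ij.2)

theorem zc_mem_polyA (i j : Fin 2) : zc i j ∈ polyA := Algebra.subset_adjoin ⟨(i, j), rfl⟩

theorem map_polyA : polyA.map ZhAlg.val = polyFn := by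
  rw [polyA, AlgHom.map_adjoin, polyFn, ← Set.range_comp]
  rfl

theorem coe_mem_polyFn {f : ZhAlg} : (f : Fn) ∈ polyFn ↔ f ∈ polyA := by
  rw [← map_polyA]
  constructor
  · rintro ⟨g, hg, h⟩
    rwa [← Subtype.ext h]
  · exact fun h => ⟨f, h, rfl⟩

theorem nu_mem_polyA : (nu : ZhAlg) ∈ polyA :=
  sub_mem (mul_mem (zc_mem_polyA _ _) (zc_mem_polyA _ _))
    (mul_mem (zc_mem_polyA _ _) (zc_mem_polyA _ _))

theorem tau_mem_polyA (p q r : ℕ) : tau p q r ∈ polyA := by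
  have h := map_tauC (S := polyA) polyA.val.toRingHom ⟨zc 0 0, zc_mem_polyA _ _⟩
    ⟨zc 0 1, zc_mem_polyA _ _⟩ ⟨zc 1 0, zc_mem_polyA _ _⟩ ⟨zc 1 1, zc_mem_polyA _ _⟩ p q r
  have h2 : tau p q r = _ := h.symm
  rw [h2]
  exact Subtype.coe_prop _

theorem nu_zpow_mem_polyA {k : ℤ} (hk : 0 ≤ k) : ((nu ^ k : ZhAlgˣ) : ZhAlg) ∈ polyA := by
  lift k to ℕ using hk
  rw [zpow_natCast, Units.val_pow_eq_pow_val]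
  exact pow_mem nu_mem_polyA _

/-- The polynomials are the span of the `t^l_{n m} N^k` with `k ≥ 0`. -/
theorem tauSpan_nonneg : tauSpan {k | 0 ≤ k} = Subalgebra.toSubmodule polyA := by
  apply le_antisymm
  · refine Submodule.span_le.2 ?_
    rintro f ⟨p, q, r, k, -, hk, rfl⟩
    exact polyA.mul_mem (tau_mem_polyA p q r) (nu_zpow_mem_polyA hk)
  · intro f hf
    have hK : ∀ k ∈ {k : ℤ | 0 ≤ k}, k + 1 ∈ {k : ℤ | 0 ≤ k} := by
      intro k (hk : 0 ≤ k)
      change 0 ≤ k + 1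
      omega
    have key : ∀ g ∈ tauSpan {k | 0 ≤ k}, f * g ∈ tauSpan {k | 0 ≤ k} := by
      replace hf : f ∈ polyA := hf
      induction hf using Algebra.adjoin_induction with
      | mem f hf =>
        obtain ⟨ij, rfl⟩ := hf
        exact fun g hg => zc_mul_mem_tauSpan hK _ _ hg
      | algebraMap c =>
        intro g hg
        rw [← Algebra.smul_def]
        exact Submodule.smul_mem _ _ hg
      | add f1 f2 _ _ h1 h2 => exact fun g hg => by rw [add_mul]; exact add_mem (h1 g hg) (h2 g hg)
      | mul f1 f2 _ _ h1 h2 => exact fun g hg => by rw [mul_assoc]; exact h1 _ (h2 g hg)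
    have h1 := key _ (tau_mem_tauSpan (K := {k | 0 ≤ k}) (le_refl (0 : ℤ)) 0 0 0)
    simpa [tau, tauC] using h1

theorem nu_inv_mul_mem_tauSpan {K : Set ℤ} (hK : ∀ k ∈ K, k - 1 ∈ K) {f : ZhAlg}
    (hf : f ∈ tauSpan K) : ((nu⁻¹ : ZhAlgˣ) : ZhAlg) * f ∈ tauSpan K := by
  induction hf using Submodule.span_induction with
  | mem f hf =>
    obtain ⟨p, q, r, k, hr, hk, rfl⟩ := hf
    rw [mul_left_comm, ← Units.val_mul, ← zpow_neg_one, ← zpow_add, neg_add_eq_sub]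
    exact tau_mem_tauSpan (hK k hk) _ _ _
  | zero => simp
  | add f g _ _ h1 h2 => rw [mul_add]; exact add_mem h1 h2
  | smul c f _ h => rw [mul_smul_comm]; exact Submodule.smul_mem _ _ h

/-- All elements of `ZhAlg` are linear combinations of the `t^l_{n m} N^k`. -/
theorem tauSpan_univ : tauSpan Set.univ = ⊤ := by
  rw [eq_top_iff]
  intro f _
  have key : ∀ g ∈ tauSpan Set.univ, f * g ∈ tauSpan Set.univ := by
    induction f using ZhAlg_induction with
    | hz i j => exact fun g hg => zc_mul_mem_tauSpan (fun _ _ => Set.mem_univ _) _ _ hg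
    | hn => exact fun g hg => nu_inv_mul_mem_tauSpan (fun _ _ => Set.mem_univ _) hg
    | hc c =>
      intro g hg
      rw [← Algebra.smul_def]
      exact Submodule.smul_mem _ _ hg
    | hadd f1 f2 h1 h2 =>
      exact fun g hg => by rw [add_mul]; exact add_mem (h1 trivial g hg) (h2 trivial g hg)
    | hmul f1 f2 h1 h2 => exact fun g hg => by rw [mul_assoc]; exact h1 trivial _ (h2 trivial g hg)
  have h1 := key _ (tau_mem_tauSpan (K := Set.univ) (k := 0) trivial 0 0 0)
  simpa [tau, tauC] using h1

/-! ### Powers of isotropic linear forms -/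

/-- The linear form `tr(Z♯ W)` in `Z`, where `Z♯` is the adjugate of `Z`. It is the polarization
of the quadratic form `N`. -/
def trw (W : HC) : ZhAlg :=
  W 0 0 • zc 1 1 - W 1 0 • zc 0 1 - W 0 1 • zc 1 0 + W 1 1 • zc 0 0

/-- The bilinear form `tr(Z♯ W)`. -/
def trB (Z W : HC) : ℂ := W 0 0 * Z 1 1 - W 1 0 * Z 0 1 - W 0 1 * Z 1 0 + W 1 1 * Z 0 0

/-- The coefficients of a polynomial that takes its values in a subspace belong
to this subspace. -/
theorem mem_of_sum_pow_smul_mem {V : Type*} [AddCommGroup V] [Module ℂ V] (U : Submodule ℂ V)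
    (n : ℕ) (v : ℕ → V) (h : ∀ x : ℂ, ∑ i ∈ Finset.range n, x ^ i • v i ∈ U) {i : ℕ}
    (hi : i < n) : v i ∈ U := by
  rw [← Submodule.Quotient.mk_eq_zero, ← Module.forall_dual_apply_eq_zero_iff ℂ]
  intro φ
  set P : Polynomial ℂ := ∑ i ∈ Finset.range n,
    Polynomial.C (φ (Submodule.Quotient.mk (p := U) (v i))) * Polynomial.X ^ i with hP
  have h0 : P = 0 := by
    refine Polynomial.funext fun x => ?_
    have hx := (Submodule.Quotient.mk_eq_zero U).2 (h x)
    have hx2 := congrArg φ hx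
    rw [← Submodule.mkQ_apply, map_sum, map_sum, map_zero] at hx2
    simp only [hP, Polynomial.eval_finsetSum, Polynomial.eval_mul, Polynomial.eval_C,
      Polynomial.eval_pow, Polynomial.eval_X, Polynomial.eval_zero]
    rw [← hx2]
    refine Finset.sum_congr rfl fun j _ => ?_
    rw [map_smul, map_smul, smul_eq_mul, mul_comm]
    rfl
  have h1 := congrArg (fun P => Polynomial.coeff P i) h0
  simpa [hP, Polynomial.finsetSum_coeff, Polynomial.coeff_C_mul, Polynomial.coeff_X_pow, hi] using h1

/-- The matrix coefficients of degree `d` are combinations of the powers `tr(Z♯ Y)^d`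
with `N(Y) = 0`. -/
theorem tauC_mem_span {S : Type*} [CommRing S] [Algebra ℂ S] (a b c d : S) (p q r : ℕ) :
    tauC a b c d p q r ∈ Submodule.span ℂ {f : S | ∃ Y : HC, N Y = 0 ∧
      f = (Y 0 0 • d - Y 1 0 • b - Y 0 1 • c + Y 1 1 • a) ^ (p + q)} := by
  set U := Submodule.span ℂ {f : S | ∃ Y : HC, N Y = 0 ∧
      f = (Y 0 0 • d - Y 1 0 • b - Y 0 1 • c + Y 1 1 • a) ^ (p + q)}
  by_cases hr : p + q < r
  · rw [tauC_eq_zero _ _ _ _ hr]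
    exact zero_mem _
  refine mem_of_sum_pow_smul_mem U (p + q + 1) (fun r => tauC a b c d p q r) (fun s => ?_) (by omega)
  have e1 : ∀ p q, ∑ r ∈ Finset.range (p + q + 1), s ^ r • tauC a b c d p q r
      = (s • a + c) ^ p * (s • b + d) ^ q := by
    intro p q
    have h := sum_tauC a b c d (algebraMap ℂ S s) p q
    simp only [Algebra.smul_def, map_pow]
    rw [mul_comm (algebraMap ℂ S s), mul_comm (algebraMap ℂ S s), h]
  rw [e1]
  have h2 := mem_of_sum_pow_smul_mem U (p + q + 1)
    (fun j => ((p + q).choose j : ℂ) • ((s • a + c) ^ j * (s • b + d) ^ (p + q - j)))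
    (fun x => ?_) (i := p) (by omega)
  · simp only [add_tsub_cancel_left] at h2
    have h3 := U.smul_mem (((p + q).choose p : ℂ)⁻¹) h2
    rwa [inv_smul_smul₀] at h3
    exact_mod_cast (Nat.choose_pos (by omega)).ne'
  · refine Submodule.subset_span ⟨!![1, -x; -s, x * s], by simp [N, mul_comm], ?_⟩
    have : (!![1, -x; -s, x * s] : HC) 0 0 • d - (!![1, -x; -s, x * s] : HC) 1 0 • b
        - (!![1, -x; -s, x * s] : HC) 0 1 • c + (!![1, -x; -s, x * s] : HC) 1 1 • a
        = x • (s • a + c) + (s • b + d) := by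
      simp only [Matrix.of_apply, Matrix.cons_val', Matrix.cons_val_zero, Matrix.cons_val_one,
        Matrix.cons_val_fin_one]
      module
    rw [this, add_pow]
    refine Finset.sum_congr rfl fun j _ => ?_
    rw [smul_pow, smul_mul_assoc, mul_comm _ (((p + q).choose j : ℕ) : S), natCast_mul_eq_smul,
      smul_comm]

theorem tau_mem_span_trw (p q r : ℕ) :
    tau p q r ∈ Submodule.span ℂ {f : ZhAlg | ∃ Y : HC, N Y = 0 ∧ f = trw Y ^ (p + q)} :=
  tauC_mem_span _ _ _ _ p q r

section

/-! ### The invariant mean on `U(2)_R` -/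

open MeasureTheory Complex

theorem chart_zero_zero (R : ℝ) (x : Fin 4 → ℝ) :
    chart R x 0 0 = R * exp (x 0 * I) * Real.cos (x 3) := rfl
theorem chart_zero_one (R : ℝ) (x : Fin 4 → ℝ) :
    chart R x 0 1 = R * exp (x 1 * I) * Real.sin (x 3) := rfl
theorem chart_one_zero (R : ℝ) (x : Fin 4 → ℝ) :
    chart R x 1 0 = -(R * exp (x 2 * I) * Real.sin (x 3)) := rfl
theorem chart_one_one (R : ℝ) (x : Fin 4 → ℝ) :
    chart R x 1 1 = R * exp ((x 1 + x 2 - x 0) * I) * Real.cos (x 3) := rfl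

theorem exp_sub_add_mul_I (a b c : ℂ) :
    exp ((a + b - c) * I) = exp (a * I) * exp (b * I) * (exp (c * I))⁻¹ := by
  rw [← Complex.exp_neg, ← Complex.exp_add, ← Complex.exp_add]
  ring_nf

theorem N_chart (R : ℝ) (x : Fin 4 → ℝ) :
    N (chart R x) = R ^ 2 * (exp (x 1 * I) * exp (x 2 * I)) := by
  have h : (Real.sin (x 3) : ℂ) ^ 2 + (Real.cos (x 3) : ℂ) ^ 2 = 1 := by
    exact_mod_cast Real.sin_sq_add_cos_sq (x 3)
  have h0 := Complex.exp_ne_zero (x 0 * I)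
  rw [N, chart_zero_zero, chart_zero_one, chart_one_zero, chart_one_one, exp_sub_add_mul_I]
  field_simp
  linear_combination (R : ℂ) ^ 2 * h

theorem hasDerivAt_exp_line (a b : ℂ) (s : ℝ) :
    HasDerivAt (fun s : ℝ => exp ((a * s + b) * I)) (exp ((a * s + b) * I) * (a * I)) s := by
  have h : HasDerivAt (fun s : ℝ => (a * (s : ℂ) + b) * I) (a * I) s := by
    have := (((hasDerivAt_id (s : ℂ)).comp_ofReal.const_mul a).add_const b).mul_const I
    simpa using this
  exact h.cexp

theorem deriv_cexp_line {g : ℝ → ℂ} {a b c : ℂ} (hg : ∀ s : ℝ, g s = c * exp ((a * s + b) * I))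
    (s : ℝ) : deriv g s = g s * (a * I) := by
  have h : g = fun s : ℝ => c * exp ((a * s + b) * I) := funext hg
  rw [h, ((hasDerivAt_exp_line a b s).const_mul c).deriv]
  ring

theorem deriv_mul_cos (c : ℂ) (s : ℝ) :
    deriv (fun s : ℝ => c * (Real.cos s : ℂ)) s = -(c * Real.sin s) := by
  have := (Real.hasDerivAt_cos s).ofReal_comp.const_mul c
  rw [this.deriv]
  push_cast
  ring

theorem deriv_mul_sin (c : ℂ) (s : ℝ) :
    deriv (fun s : ℝ => c * (Real.sin s : ℂ)) s = c * Real.cos s := by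
  rw [((Real.hasDerivAt_sin s).ofReal_comp.const_mul c).deriv]

/-- The complex Jacobian of the angular parametrization of `U(2)_R`. The factor `N ^ 2` cancels the density
`N ^ (-2)` of the invariant measure. -/
theorem chartJac_eq (R : ℝ) (x : Fin 4 → ℝ) :
    chartJac R x = -2 * I * N (chart R x) ^ 2 * (Real.sin (x 3) * Real.cos (x 3)) := by
  have key : (Matrix.of fun k l : Fin 4 =>
      deriv (fun s : ℝ => entry k (chart R (Function.update x l s))) (x l)) =
      !![chart R x 0 0 * I, 0, 0, -(R * exp (x 0 * I) * Real.sin (x 3));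
         0, chart R x 0 1 * I, 0, R * exp (x 1 * I) * Real.cos (x 3);
         0, 0, chart R x 1 0 * I, -(R * exp (x 2 * I) * Real.cos (x 3));
         chart R x 1 1 * (-1 * I), chart R x 1 1 * I, chart R x 1 1 * I,
          -(R * exp ((x 1 + x 2 - x 0) * I) * Real.sin (x 3))] := by
    have e0 : ∀ s, Function.update x 0 s = ![s, x 1, x 2, x 3] := by
      intro s; ext i; fin_cases i <;> simp
    have e1 : ∀ s, Function.update x 1 s = ![x 0, s, x 2, x 3] := by
      intro s; ext i; fin_cases i <;> simp
    have e2 : ∀ s, Function.update x 2 s = ![x 0, x 1, s, x 3] := by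
      intro s; ext i; fin_cases i <;> simp
    have e3 : ∀ s, Function.update x 3 s = ![x 0, x 1, x 2, s] := by
      intro s; ext i; fin_cases i <;> simp
    have c0 : ∀ k, deriv (fun s : ℝ => entry k (chart R ![s, x 1, x 2, x 3])) (x 0)
        = ![chart R x 0 0 * I, 0, 0, chart R x 1 1 * (-1 * I)] k := by
      intro k
      fin_cases k
      · refine (deriv_cexp_line (a := 1) (b := 0) (c := R * Real.cos (x 3)) (fun s => ?_) _).trans ?_
        · simp [entry, chart]; ring
        · simp [entry, chart]
      · simp [entry, chart]
      · simp [entry, chart]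
      · refine (deriv_cexp_line (a := -1) (b := x 1 + x 2) (c := R * Real.cos (x 3)) (fun s => ?_) _).trans ?_
        · simp [entry, chart]; ring_nf
        · simp [entry, chart]
    have c1 : ∀ k, deriv (fun s : ℝ => entry k (chart R ![x 0, s, x 2, x 3])) (x 1)
        = ![0, chart R x 0 1 * I, 0, chart R x 1 1 * I] k := by
      intro k
      fin_cases k
      · simp [entry, chart]
      · refine (deriv_cexp_line (a := 1) (b := 0) (c := R * Real.sin (x 3)) (fun s => ?_) _).trans ?_
        · simp [entry, chart]; ring
        · simp [entry, chart]
      · simp [entry, chart]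
      · refine (deriv_cexp_line (a := 1) (b := x 2 - x 0) (c := R * Real.cos (x 3)) (fun s => ?_) _).trans ?_
        · simp [entry, chart]; ring_nf
        · simp [entry, chart]
    have c2 : ∀ k, deriv (fun s : ℝ => entry k (chart R ![x 0, x 1, s, x 3])) (x 2)
        = ![0, 0, chart R x 1 0 * I, chart R x 1 1 * I] k := by
      intro k
      fin_cases k
      · simp [entry, chart]
      · simp [entry, chart]
      · refine (deriv_cexp_line (a := 1) (b := 0) (c := -(R * Real.sin (x 3))) (fun s => ?_) _).trans ?_
        · simp [entry, chart]; ring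
        · simp [entry, chart]
      · refine (deriv_cexp_line (a := 1) (b := x 1 - x 0) (c := R * Real.cos (x 3)) (fun s => ?_) _).trans ?_
        · simp [entry, chart]; ring_nf
        · simp [entry, chart]
    have c3 : ∀ k, deriv (fun s : ℝ => entry k (chart R ![x 0, x 1, x 2, s])) (x 3)
        = ![-(R * exp (x 0 * I) * Real.sin (x 3)), R * exp (x 1 * I) * Real.cos (x 3),
          -(R * exp (x 2 * I) * Real.cos (x 3)),
          -(R * exp ((x 1 + x 2 - x 0) * I) * Real.sin (x 3))] k := by
      intro k
      fin_cases k
      · exact deriv_mul_cos (R * exp (x 0 * I)) (x 3)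
      · exact deriv_mul_sin (R * exp (x 1 * I)) (x 3)
      · refine Eq.trans ?_ ((deriv_mul_sin (-(R * exp (x 2 * I))) (x 3)).trans (by simp))
        congr 1
        funext s
        simp [entry, chart]
      · exact deriv_mul_cos (R * exp ((x 1 + x 2 - x 0) * I)) (x 3)
    ext k l
    rw [Matrix.of_apply]
    fin_cases l
    · simp only [Fin.zero_eta, e0, c0]
      fin_cases k <;> rfl
    · simp only [Fin.mk_one, e1, c1]
      fin_cases k <;> rfl
    · simp only [Fin.reduceFinMk, e2, c2]
      fin_cases k <;> rfl
    · simp only [Fin.reduceFinMk, e3, c3]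
      fin_cases k <;> rfl
  rw [chartJac, key, N_chart, chart_zero_zero, chart_zero_one, chart_one_zero, chart_one_one,
    exp_sub_add_mul_I]
  have h : (Real.sin (x 3) : ℂ) ^ 2 + (Real.cos (x 3) : ℂ) ^ 2 = 1 := by
    exact_mod_cast Real.sin_sq_add_cos_sq (x 3)
  have h0 := Complex.exp_ne_zero (x 0 * I)
  push_cast at h
  rw [Matrix.det_succ_row_zero]
  simp only [Fin.sum_univ_four, Matrix.det_fin_three, Matrix.submatrix_apply]
  simp [Fin.succAbove]
  generalize Complex.sin (x 3) = s at *
  generalize Complex.cos (x 3) = c at *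
  generalize exp (x 0 * I) = a at *
  generalize exp (x 1 * I) = b at *
  generalize exp (x 2 * I) = d at *
  field_simp
  linear_combination (2 * (R : ℂ) ^ 4 * s * c * b ^ 2 * d ^ 2 * (s ^ 2 + c ^ 2)) * I_sq
   - (2 * (R : ℂ) ^ 4 * s * c * b ^ 2 * d ^ 2) * h

/-- The range of the parameters of `chart`. -/
def paramBox : Set (ℝ × ℝ × ℝ × ℝ) :=
  Set.Ioc 0 (2 * Real.pi) ×ˢ Set.Ioc 0 (2 * Real.pi) ×ˢ Set.Ioc 0 (2 * Real.pi)
    ×ˢ Set.Ioc 0 (Real.pi / 2)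

/-- A quadruple of parameters as a vector. -/
def vec4 (y : ℝ × ℝ × ℝ × ℝ) : Fin 4 → ℝ := ![y.1, y.2.1, y.2.2.1, y.2.2.2]

theorem continuous_vec4 : Continuous vec4 := by
  refine continuous_pi fun i => ?_
  fin_cases i <;> simp only [vec4] <;> fun_prop

theorem integrableOn_paramBox {G : ℝ × ℝ × ℝ × ℝ → ℂ} (hG : Continuous G) :
    IntegrableOn G paramBox := by
  have hK : IsCompact (Set.Icc (0 : ℝ) (2 * Real.pi) ×ˢ Set.Icc (0 : ℝ) (2 * Real.pi)
      ×ˢ Set.Icc (0 : ℝ) (2 * Real.pi) ×ˢ Set.Icc (0 : ℝ) (Real.pi / 2)) :=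
    isCompact_Icc.prod (isCompact_Icc.prod (isCompact_Icc.prod isCompact_Icc))
  refine (hG.continuousOn.integrableOn_compact hK).mono_set ?_
  exact Set.prod_mono Set.Ioc_subset_Icc_self (Set.prod_mono Set.Ioc_subset_Icc_self
    (Set.prod_mono Set.Ioc_subset_Icc_self Set.Ioc_subset_Icc_self))

theorem iterated_integral_eq {G : (Fin 4 → ℝ) → ℂ} (hG : Continuous G) :
    (∫ x₀ in (0 : ℝ)..(2 * Real.pi), ∫ x₁ in (0 : ℝ)..(2 * Real.pi),
      ∫ x₂ in (0 : ℝ)..(2 * Real.pi), ∫ x₃ in (0 : ℝ)..(Real.pi / 2), G ![x₀, x₁, x₂, x₃])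
      = ∫ y in paramBox, G (vec4 y) := by
  have hG4 : Continuous fun y => G (vec4 y) := hG.comp continuous_vec4
  have h2 : (0 : ℝ) ≤ 2 * Real.pi := by positivity
  have h3 : (0 : ℝ) ≤ Real.pi / 2 := by positivity
  have hi := integrableOn_paramBox hG4
  rw [paramBox] at hi ⊢
  rw [Measure.volume_eq_prod] at hi ⊢
  rw [setIntegral_prod _ hi, intervalIntegral.integral_of_le h2]
  refine setIntegral_congr_fun measurableSet_Ioc fun x₀ _ => ?_
  have hK3 : IsCompact (Set.Icc (0 : ℝ) (2 * Real.pi) ×ˢ Set.Icc (0 : ℝ) (2 * Real.pi)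
      ×ˢ Set.Icc (0 : ℝ) (Real.pi / 2)) := isCompact_Icc.prod (isCompact_Icc.prod isCompact_Icc)
  have hc3 : Continuous fun y : ℝ × ℝ × ℝ => G (vec4 (x₀, y)) :=
    hG4.comp (by fun_prop : Continuous fun y : ℝ × ℝ × ℝ => (x₀, y))
  have hi3 : IntegrableOn (fun y : ℝ × ℝ × ℝ => G (vec4 (x₀, y)))
      (Set.Ioc (0 : ℝ) (2 * Real.pi) ×ˢ Set.Ioc (0 : ℝ) (2 * Real.pi)
        ×ˢ Set.Ioc (0 : ℝ) (Real.pi / 2)) :=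
    (hc3.continuousOn.integrableOn_compact hK3).mono_set
      (Set.prod_mono Set.Ioc_subset_Icc_self
        (Set.prod_mono Set.Ioc_subset_Icc_self Set.Ioc_subset_Icc_self))
  rw [Measure.volume_eq_prod] at hi3 ⊢
  rw [setIntegral_prod _ hi3, intervalIntegral.integral_of_le h2]
  refine setIntegral_congr_fun measurableSet_Ioc fun x₁ _ => ?_
  have hc2 : Continuous fun y : ℝ × ℝ => G (vec4 (x₀, x₁, y)) :=
    hG4.comp (by fun_prop : Continuous fun y : ℝ × ℝ => (x₀, x₁, y))
  have hi2 : IntegrableOn (fun y : ℝ × ℝ => G (vec4 (x₀, x₁, y)))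
      (Set.Ioc (0 : ℝ) (2 * Real.pi) ×ˢ Set.Ioc (0 : ℝ) (Real.pi / 2)) :=
    (hc2.continuousOn.integrableOn_compact (isCompact_Icc.prod isCompact_Icc)).mono_set
      (Set.prod_mono Set.Ioc_subset_Icc_self Set.Ioc_subset_Icc_self)
  rw [Measure.volume_eq_prod] at hi2 ⊢
  rw [setIntegral_prod _ hi2, intervalIntegral.integral_of_le h2]
  refine setIntegral_congr_fun measurableSet_Ioc fun x₂ _ => ?_
  rw [intervalIntegral.integral_of_le h3]
  rfl

/-- The density `sin x₃ cos x₃` of the invariant measure in the coordinates of `chart`. -/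
def density (y : ℝ × ℝ × ℝ × ℝ) : ℂ := Real.sin y.2.2.2 * Real.cos y.2.2.2

theorem continuous_density : Continuous density := by
  unfold density
  fun_prop

/-- The mean of a function over `U(2)_R` with respect to the invariant probability measure. -/
def mean (R : ℝ) (F : HC → ℂ) : ℂ :=
  (4 * (Real.pi : ℂ) ^ 3)⁻¹ * ∫ y in paramBox, F (chart R (vec4 y)) * density y

theorem continuous_chart_apply (R : ℝ) (i j : Fin 2) : Continuous fun x => chart R x i j := by
  fin_cases i <;> fin_cases j
  · simp only [Fin.zero_eta, chart_zero_zero]; fun_prop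
  · simp only [Fin.zero_eta, Fin.mk_one, chart_zero_one]; fun_prop
  · simp only [Fin.zero_eta, Fin.mk_one, chart_one_zero]; fun_prop
  · simp only [Fin.mk_one, chart_one_one]; fun_prop

theorem N_chart_ne_zero {R : ℝ} (hR : 0 < R) (x : Fin 4 → ℝ) : N (chart R x) ≠ 0 := by
  rw [N_chart]
  have : (R : ℂ) ≠ 0 := by exact_mod_cast hR.ne'
  simp [this, Complex.exp_ne_zero]

/-- The form `i/(2π³) dV` is `N(Z)²` times the invariant probability measure. -/
theorem intU2_eq_mean (R : ℝ) {F : HC → ℂ} (hF : Continuous fun x => F (chart R x)) :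
    I / (2 * (Real.pi : ℂ) ^ 3) * intU2 R F = mean R fun Z => F Z * N Z ^ 2 := by
  have hc : Continuous fun x => N (chart R x) := by
    have := continuous_chart_apply R
    unfold N
    fun_prop
  have h := iterated_integral_eq (G := fun x => F (chart R x) * (chartJac R x / 4)) (by
    simp only [chartJac_eq]
    exact hF.mul (by fun_prop))
  rw [intU2, h, mean, ← integral_const_mul, ← integral_const_mul]
  refine integral_congr_ae (Filter.Eventually.of_forall fun y => ?_)
  have hpi : (Real.pi : ℂ) ≠ 0 := by exact_mod_cast Real.pi_ne_zero
  have hd : density y = Real.sin (vec4 y 3) * Real.cos (vec4 y 3) := rfl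
  simp only [chartJac_eq, hd]
  field_simp
  linear_combination (-F (chart R (vec4 y)) * N (chart R (vec4 y)) ^ 2
    * Real.sin (vec4 y 3) * Real.cos (vec4 y 3)) * I_sq

theorem mean_add (R : ℝ) {F G : HC → ℂ} (hF : Continuous fun x => F (chart R x))
    (hG : Continuous fun x => G (chart R x)) :
    mean R (fun Z => F Z + G Z) = mean R F + mean R G := by
  have hd := continuous_density
  have hv := continuous_vec4
  rw [mean, mean, mean, ← mul_add, ← integral_add]
  · simp only [add_mul]
  · exact integrableOn_paramBox ((hF.comp hv).mul hd)
  · exact integrableOn_paramBox ((hG.comp hv).mul hd)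

theorem mean_const_mul (R : ℝ) (c : ℂ) (F : HC → ℂ) :
    mean R (fun Z => c * F Z) = c * mean R F := by
  rw [mean, mean, mul_left_comm, ← integral_const_mul c]
  simp only [mul_assoc]

/-- The points of `U(2)_R` as invertible matrices. -/
def chartU {R : ℝ} (hR : 0 < R) (x : Fin 4 → ℝ) : HCx :=
  ((Matrix.isUnit_iff_isUnit_det _).2
    (isUnit_iff_ne_zero.2 (by rw [← N_eq_det]; exact N_chart_ne_zero hR x)) : IsUnit (chart R x)).unit

theorem chartU_coe {R : ℝ} (hR : 0 < R) (x : Fin 4 → ℝ) : (chartU hR x : HC) = chart R x := rfl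

theorem ext_chart {R : ℝ} (hR : 0 < R) (f : Fn) (x : Fin 4 → ℝ) :
    ext f (chart R x) = f (chartU hR x) := ext_coe f (chartU hR x)

theorem continuous_ext_chart {R : ℝ} (hR : 0 < R) (f : ZhAlg) :
    Continuous fun x => ext f (chart R x) := by
  simp only [ext_chart hR]
  induction f using ZhAlg_induction with
  | hz i j => exact continuous_chart_apply R i j
  | hn =>
    have hc : Continuous fun x => N (chart R x) := by
      have := continuous_chart_apply R
      unfold N
      fun_prop
    exact hc.inv₀ fun x => N_chart_ne_zero hR x
  | hc c => exact continuous_const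
  | hadd f g h1 h2 => exact h1.add h2
  | hmul f g h1 h2 => exact h1.mul h2

/-- The invariant mean over `U(2)_R` as a linear functional on `ZhAlg`. -/
def meanL {R : ℝ} (hR : 0 < R) : ZhAlg →ₗ[ℂ] ℂ where
  toFun f := mean R (ext f)
  map_add' f g := by
    rw [← mean_add R (continuous_ext_chart hR f) (continuous_ext_chart hR g)]
    unfold mean
    simp only [ext_chart hR, add_apply]
  map_smul' c f := by
    rw [RingHom.id_apply, smul_eq_mul, ← mean_const_mul]
    unfold mean
    simp only [ext_chart hR, smul_apply]

theorem meanL_apply {R : ℝ} (hR : 0 < R) (f : ZhAlg) : meanL hR f = mean R (ext f) := rfl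

/-! ### Moments -/

theorem integral_exp_zpow (m : ℤ) :
    (∫ x in (0 : ℝ)..(2 * Real.pi), exp (x * I) ^ m) = if m = 0 then 2 * (Real.pi : ℂ) else 0 := by
  split_ifs with h
  · simp [h]
  · have h1 : ∀ x : ℝ, exp (x * I) ^ m = exp ((m * I) * x) := by
      intro x
      rw [← Complex.exp_int_mul]
      ring_nf
    simp only [h1]
    have hm : (m * I : ℂ) ≠ 0 := mul_ne_zero (by exact_mod_cast h) I_ne_zero
    rw [integral_exp_mul_complex hm]
    have h2 : exp (m * I * ((2 * Real.pi : ℝ) : ℂ)) = 1 := by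
      rw [Complex.exp_eq_one_iff]
      exact ⟨m, by push_cast; ring⟩
    rw [h2]
    simp

theorem integral_cos_sin_odd (a b : ℕ) :
    (∫ x in (0 : ℝ)..(Real.pi / 2), Real.cos x ^ (2 * a + 1) * Real.sin x ^ (2 * b + 1))
      = (a.factorial * b.factorial : ℝ) / (2 * (a + b + 1).factorial) := by
  induction a generalizing b with
  | zero =>
    have h : ∀ x ∈ Set.uIcc 0 (Real.pi / 2), HasDerivAt (fun x => Real.sin x ^ (2 * b + 2) / (2 * b + 2))
        (Real.cos x ^ (2 * 0 + 1) * Real.sin x ^ (2 * b + 1)) x := by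
      intro x _
      have := ((Real.hasDerivAt_sin x).pow (2 * b + 2)).div_const (2 * (b : ℝ) + 2)
      refine this.congr_deriv ?_
      push_cast
      have : (2 * (b : ℝ) + 2) ≠ 0 := by positivity
      field_simp
    rw [intervalIntegral.integral_eq_sub_of_hasDerivAt h (by
      apply Continuous.intervalIntegrable; fun_prop)]
    simp [Nat.factorial_succ]
    field_simp
  | succ a ih =>
    have h : ∀ x : ℝ, Real.cos x ^ (2 * (a + 1) + 1) * Real.sin x ^ (2 * b + 1)
        = Real.cos x ^ (2 * a + 1) * Real.sin x ^ (2 * b + 1)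
          - Real.cos x ^ (2 * a + 1) * Real.sin x ^ (2 * (b + 1) + 1) := by
      intro x
      linear_combination (Real.cos x ^ (2 * a + 1) * Real.sin x ^ (2 * b + 1)) * Real.sin_sq_add_cos_sq x
    simp only [h]
    rw [intervalIntegral.integral_sub (by apply Continuous.intervalIntegrable; fun_prop)
      (by apply Continuous.intervalIntegrable; fun_prop), ih, ih]
    have e1 : a + (b + 1) + 1 = (a + b + 1) + 1 := by ring
    have e2 : a + 1 + b + 1 = (a + b + 1) + 1 := by ring
    rw [e1, e2, Nat.factorial_succ (a + b + 1), Nat.factorial_succ a, Nat.factorial_succ b]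
    have : ((a + b + 1).factorial : ℝ) ≠ 0 := by positivity
    push_cast
    field_simp
    ring

/-- The moments of the invariant mean. They do not depend on the radius. -/
theorem meanL_monomial {R : ℝ} (hR : 0 < R) (a b c e : ℕ) (k : ℤ) :
    meanL hR (zc 0 0 ^ a * zc 0 1 ^ b * zc 1 0 ^ c * zc 1 1 ^ e * ((nu ^ k : ZhAlgˣ) : ZhAlg)) =
      if a = e ∧ b = c ∧ k = -(a + b : ℤ) then
        (-1) ^ b * (a.factorial * b.factorial : ℂ) / (a + b + 1).factorial else 0 := by
  have hR0 : (R : ℂ) ≠ 0 := by exact_mod_cast hR.ne'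
  have hpi : (Real.pi : ℂ) ≠ 0 := by exact_mod_cast Real.pi_ne_zero
  set f := zc 0 0 ^ a * zc 0 1 ^ b * zc 1 0 ^ c * zc 1 1 ^ e * ((nu ^ k : ZhAlgˣ) : ZhAlg) with hf
  have h1 := iterated_integral_eq (G := fun x => ext f (chart R x) * (Real.sin (x 3) * Real.cos (x 3)))
    ((continuous_ext_chart hR f).mul (by fun_prop))
  have h2 : ∀ x : Fin 4 → ℝ, ext f (chart R x) * (Real.sin (x 3) * Real.cos (x 3)) =
      (-1) ^ c * (R : ℂ) ^ (a + b + c + e + 2 * k) * exp (x 0 * I) ^ ((a : ℤ) - e)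
        * exp (x 1 * I) ^ ((b : ℤ) + e + k) * exp (x 2 * I) ^ ((c : ℤ) + e + k)
        * ((Real.cos (x 3) ^ (a + e + 1) * Real.sin (x 3) ^ (b + c + 1) : ℝ) : ℂ) := by
    intro x
    rw [ext_chart hR, hf]
    simp only [mul_apply, pow_apply, zc_apply, nu_zpow_apply, chartU_coe]
    rw [N_chart, chart_zero_zero, chart_zero_one, chart_one_zero, chart_one_one, exp_sub_add_mul_I]
    have h0 := Complex.exp_ne_zero (x 0 * I)
    have h1 := Complex.exp_ne_zero (x 1 * I)
    have h2 := Complex.exp_ne_zero (x 2 * I)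
    generalize exp (x 0 * I) = u at *
    generalize exp (x 1 * I) = v at *
    generalize exp (x 2 * I) = w at *
    rw [zpow_add₀ hR0, zpow_mul, zpow_sub₀ h0, zpow_add₀ h1, zpow_add₀ h1, zpow_add₀ h2,
      zpow_add₀ h2, mul_zpow, mul_zpow, neg_pow]
    rw [zpow_add₀ hR0, zpow_add₀ hR0, zpow_add₀ hR0]
    simp only [mul_pow, inv_pow, zpow_natCast, zpow_ofNat]
    push_cast
    field_simp
    ring
  have h3 : meanL hR f = (4 * (Real.pi : ℂ) ^ 3)⁻¹ * ∫ y in paramBox,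
      ext f (chart R (vec4 y)) * (Real.sin (vec4 y 3) * Real.cos (vec4 y 3)) := rfl
  rw [h3, ← h1]
  simp only [h2]
  simp only [Matrix.cons_val_zero, Matrix.cons_val_one, Matrix.cons_val]
  simp only [intervalIntegral.integral_const_mul, intervalIntegral.integral_mul_const,
    integral_exp_zpow, intervalIntegral.integral_ofReal]
  by_cases h : a = e ∧ b = c ∧ k = -(a + b : ℤ)
  · obtain ⟨rfl, rfl, rfl⟩ := h
    have e1 : a + a + 1 = 2 * a + 1 := by ring
    have e2 : b + b + 1 = 2 * b + 1 := by ring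
    have e3 : (a : ℤ) + b + b + a + 2 * -(a + b : ℤ) = 0 := by ring
    have e4 : (b : ℤ) + a + -(a + b : ℤ) = 0 := by ring
    rw [e1, e2, e3, e4, integral_cos_sin_odd]
    simp
    field_simp
    norm_num
  · rw [if_neg h]
    by_cases h4 : (a : ℤ) - e = 0
    · by_cases h5 : (b : ℤ) + e + k = 0
      · have h6 : ¬ (c : ℤ) + e + k = 0 := by
          intro h6
          exact h ⟨by omega, by omega, by omega⟩
        simp [h6]
      · simp [h5]
    · simp [h4]

end

section

/-! ### Means of products of linear forms -/

open scoped Nat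

theorem trw_eq_sum (W : HC) : trw W = ∑ i : Fin 4,
    ![W 1 1, -W 1 0, -W 0 1, W 0 0] i • ![zc 0 0, zc 0 1, zc 1 0, zc 1 1] i := by
  simp only [Fin.sum_univ_four, trw, Matrix.cons_val]
  module

theorem trw_pow_mul_nu (W : HC) (n : ℕ) (k : ℤ) {R : ℝ} (hR : 0 < R) :
    meanL hR (trw W ^ n * ((nu ^ k : ZhAlgˣ) : ZhAlg)) =
      ∑ κ ∈ Finset.piAntidiag (Finset.univ : Finset (Fin 4)) n,
        (Nat.multinomial Finset.univ κ : ℂ) *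
        (W 1 1 ^ κ 0 * (-W 1 0) ^ κ 1 * (-W 0 1) ^ κ 2 * W 0 0 ^ κ 3) *
        if κ 0 = κ 3 ∧ κ 1 = κ 2 ∧ k = -(κ 0 + κ 1 : ℤ) then
          (-1) ^ κ 1 * ((κ 0)! * (κ 1)! : ℂ) / (κ 0 + κ 1 + 1)! else 0 := by
  rw [trw_eq_sum, Finset.sum_pow_eq_sum_piAntidiag, Finset.sum_mul, map_sum]
  refine Finset.sum_congr rfl fun κ _ => ?_
  rw [← meanL_monomial hR]
  refine Eq.trans ?_ ((meanL hR).map_smul ((Nat.multinomial Finset.univ κ : ℂ) *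
    (W 1 1 ^ κ 0 * (-W 1 0) ^ κ 1 * (-W 0 1) ^ κ 2 * W 0 0 ^ κ 3)) _)
  congr 1
  simp only [Fin.prod_univ_four, Matrix.cons_val, Algebra.smul_def, map_mul, map_pow,
    map_natCast, mul_pow, map_neg]
  ring

theorem meanL_trw_pow_of_ne (W : HC) {n : ℕ} {k : ℤ} (h : (n : ℤ) ≠ -2 * k) {R : ℝ} (hR : 0 < R) :
    meanL hR (trw W ^ n * ((nu ^ k : ZhAlgˣ) : ZhAlg)) = 0 := by
  rw [trw_pow_mul_nu]
  refine Finset.sum_eq_zero fun κ hκ => ?_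
  rw [if_neg, mul_zero]
  rintro ⟨h1, h2, h3⟩
  have h4 := (Finset.mem_piAntidiag.1 hκ).1
  rw [Fin.sum_univ_four] at h4
  omega

/-- The means of the powers of a linear form are Catalan numbers times powers of the norm. -/
theorem meanL_trw_pow (W : HC) (M : ℕ) {R : ℝ} (hR : 0 < R) :
    meanL hR (trw W ^ (2 * M) * ((nu ^ (-(M : ℤ)) : ZhAlgˣ) : ZhAlg)) =
      ((2 * M)! : ℂ) / (M ! * (M + 1)!) * N W ^ M := by
  rw [trw_pow_mul_nu]
  have hN : N W ^ M = ∑ i ∈ Finset.range (M + 1),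
      (W 0 0 * W 1 1) ^ i * (-(W 0 1 * W 1 0)) ^ (M - i) * (M.choose i : ℂ) := by
    rw [← add_pow, N, sub_eq_add_neg]
  rw [hN, Finset.mul_sum]
  symm
  refine Finset.sum_of_injOn (fun i => ![i, M - i, M - i, i]) ?_ ?_ ?_ ?_
  · intro i _ j _ hij
    simpa using congrFun hij 0
  · intro i hi
    have hi : i < M + 1 := Finset.mem_range.1 hi
    refine Finset.mem_coe.2 (Finset.mem_piAntidiag.2 ⟨?_, fun _ _ => Finset.mem_univ _⟩)
    simp only [Fin.sum_univ_four, Matrix.cons_val]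
    omega
  · intro κ hκ h
    have h4 := (Finset.mem_piAntidiag.1 hκ).1
    rw [Fin.sum_univ_four] at h4
    rw [if_neg, mul_zero]
    rintro ⟨h1, h2, h3⟩
    refine h ⟨κ 0, by simp; omega, ?_⟩
    ext i
    fin_cases i <;> simp <;> omega
  · intro i hi
    obtain ⟨j, rfl⟩ : ∃ j, M = i + j := ⟨M - i, by have := Finset.mem_range.1 hi; omega⟩
    have hm : (Nat.multinomial Finset.univ ![i, j, j, i] : ℂ) * (i ! * j ! * j ! * i !) = (2 * (i + j))! := by
      have := Nat.multinomial_spec Finset.univ ![i, j, j, i]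
      simp only [Fin.prod_univ_four, Fin.sum_univ_four, Matrix.cons_val] at this
      have e : i + j + j + i = 2 * (i + j) := by ring
      rw [e] at this
      rw [← this]
      push_cast
      ring
    have hc : ((i + j).choose i : ℂ) * (i ! * j !) = (i + j)! := by
      rw [← Nat.choose_mul_factorial_mul_factorial (Nat.le_add_right i j)]
      simp [mul_assoc]
    simp only [add_tsub_cancel_left, Matrix.cons_val]
    rw [if_pos (by refine ⟨trivial, trivial, ?_⟩; push_cast; ring), ← hm, ← hc]
    have h1 : (i ! : ℂ) ≠ 0 := by exact_mod_cast i.factorial_ne_zero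
    have h2 : (j ! : ℂ) ≠ 0 := by exact_mod_cast j.factorial_ne_zero
    have h3 : ((i + j).choose i : ℂ) ≠ 0 := by
      exact_mod_cast (Nat.choose_pos (Nat.le_add_right i j)).ne'
    have h4 : ((i + j + 1)! : ℂ) ≠ 0 := by exact_mod_cast (i + j + 1).factorial_ne_zero
    have h6 : (-1 : ℂ) ^ (j * 2) = 1 := by rw [mul_comm, pow_mul]; simp
    rw [neg_pow (W 0 1 * W 1 0), neg_pow (W 0 1), neg_pow (W 1 0)]
    field_simp
    ring_nf
    rw [h6, mul_one]

theorem trw_add_smul (W Y : HC) (ε : ℂ) : trw (W + ε • Y) = trw W + ε • trw Y := by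
  simp only [trw, Matrix.add_apply, Matrix.smul_apply, smul_eq_mul]
  module

theorem N_add_smul {Y : HC} (hY : N Y = 0) (W : HC) (ε : ℂ) : N (W + ε • Y) = N W + ε * trB W Y := by
  simp only [N, trB, Matrix.add_apply, Matrix.smul_apply, smul_eq_mul] at *
  linear_combination ε ^ 2 * hY

theorem meanL_trw_add_pow (W Y : HC) (m : ℕ) (k : ℤ) (ε : ℂ) {R : ℝ} (hR : 0 < R) :
    meanL hR (trw (W + ε • Y) ^ m * ((nu ^ k : ZhAlgˣ) : ZhAlg)) =
      ∑ d ∈ Finset.range (m + 1), ε ^ d • ((m.choose d : ℂ) *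
        meanL hR (trw Y ^ d * trw W ^ (m - d) * ((nu ^ k : ZhAlgˣ) : ZhAlg))) := by
  rw [trw_add_smul, add_comm, add_pow, Finset.sum_mul, map_sum]
  refine Finset.sum_congr rfl fun d _ => ?_
  rw [← smul_eq_mul (m.choose d : ℂ), ← map_smul, ← map_smul]
  congr 1
  simp only [Algebra.smul_def, map_natCast, map_pow, mul_pow]
  ring

theorem eq_zero_of_sum_pow_smul (n : ℕ) (v : ℕ → ℂ)
    (h : ∀ x : ℂ, ∑ i ∈ Finset.range n, x ^ i • v i = 0) {i : ℕ} (hi : i < n) : v i = 0 := by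
  simpa using mem_of_sum_pow_smul_mem (⊥ : Submodule ℂ ℂ) n v (fun x => by simpa using h x) hi

theorem meanL_trw_mul_of_ne (W Y : HC) {d n : ℕ} {k : ℤ} (h : (d + n : ℤ) ≠ -2 * k) {R : ℝ}
    (hR : 0 < R) : meanL hR (trw Y ^ d * trw W ^ n * ((nu ^ k : ZhAlgˣ) : ZhAlg)) = 0 := by
  have h1 := eq_zero_of_sum_pow_smul (d + n + 1) _ (fun ε => by
    rw [← meanL_trw_add_pow W Y (d + n) k ε hR]
    exact meanL_trw_pow_of_ne _ (by push_cast; exact h) hR) (show d < d + n + 1 by omega)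
  simp only [add_tsub_cancel_left] at h1
  refine (mul_eq_zero.1 h1).resolve_left ?_
  exact_mod_cast (Nat.choose_pos (by omega)).ne'

/-- The polarized form of the formula for the means of the powers of a linear form. -/
theorem meanL_trw_mul (W : HC) {Y : HC} (hY : N Y = 0) {d n M : ℕ} (h : d + n = 2 * M) {R : ℝ}
    (hR : 0 < R) : ((2 * M).choose d : ℂ) *
      meanL hR (trw Y ^ d * trw W ^ n * ((nu ^ (-(M : ℤ)) : ZhAlgˣ) : ZhAlg)) =
      ((2 * M)! : ℂ) / (M ! * (M + 1)!) * (M.choose d * (N W ^ (M - d) * trB W Y ^ d)) := by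
  have h1 := eq_zero_of_sum_pow_smul (2 * M + 1) (fun d => ((2 * M).choose d : ℂ) *
      meanL hR (trw Y ^ d * trw W ^ (2 * M - d) * ((nu ^ (-(M : ℤ)) : ZhAlgˣ) : ZhAlg)) -
      ((2 * M)! : ℂ) / (M ! * (M + 1)!) * (M.choose d * (N W ^ (M - d) * trB W Y ^ d))) (fun ε => ?_)
    (show d < 2 * M + 1 by omega)
  · have e : 2 * M - d = n := by omega
    simp only [e] at h1
    exact sub_eq_zero.1 h1
  · simp only [smul_sub, Finset.sum_sub_distrib]
    rw [← meanL_trw_add_pow, meanL_trw_pow, N_add_smul hY, sub_eq_zero, add_comm (N W), add_pow,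
      Finset.mul_sum]
    refine Finset.sum_subset_zero_on_sdiff (Finset.range_mono (by omega)) ?_ ?_
    · intro i hi
      have : M < i := by
        have := (Finset.mem_sdiff.1 hi).2
        simp at this
        omega
      simp [Nat.choose_eq_zero_of_lt this]
    · intro i _
      rw [smul_eq_mul, mul_pow]
      ring

/-! ### Characters of the symmetric powers -/

section chi

open Finset.HasAntidiagonal (antidiagonal)

variable {S : Type*} [CommRing S]

/-- The trace of the `e`-th symmetric power of a `2 × 2` matrix with trace `τ` and
determinant `δ`. -/
def chi (e : ℕ) (τ δ : S) : S :=
  ∑ x ∈ antidiagonal e, (x.1.choose x.2 : S) * (τ ^ (x.1 - x.2) * (-δ) ^ x.2)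

theorem chi_add_two (e : ℕ) (τ δ : S) : chi (e + 2) τ δ = τ * chi (e + 1) τ δ - δ * chi e τ δ := by
  have hg : ∀ a j : ℕ, ((a + 1).choose (j + 1) : S) * (τ ^ (a + 1 - (j + 1)) * (-δ) ^ (j + 1)) =
      τ * ((a.choose (j + 1) : S) * (τ ^ (a - (j + 1)) * (-δ) ^ (j + 1)))
        - δ * ((a.choose j : S) * (τ ^ (a - j) * (-δ) ^ j)) := by
    intro a j
    rcases Nat.lt_or_ge j a with h | h
    · obtain ⟨b, rfl⟩ := Nat.exists_eq_add_of_lt h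
      have e1 : j + b + 1 + 1 - (j + 1) = b + 1 := by omega
      have e2 : j + b + 1 - (j + 1) = b := by omega
      have e3 : j + b + 1 - j = b + 1 := by omega
      rw [Nat.choose_succ_succ, e1, e2, e3]
      push_cast
      ring
    · rw [Nat.choose_succ_succ, Nat.choose_eq_zero_of_lt (show a < j + 1 by omega),
        show a + 1 - (j + 1) = a - j by omega]
      push_cast
      ring
  unfold chi
  rw [Finset.Nat.sum_antidiagonal_succ, Finset.Nat.sum_antidiagonal_succ']
  simp only [hg, Finset.sum_sub_distrib, ← Finset.mul_sum]
  rw [Finset.Nat.sum_antidiagonal_succ' (n := e)]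
  simp
  ring

theorem chi_zero (τ δ : S) : chi 0 τ δ = 1 := by simp [chi]

theorem chi_one (τ δ : S) : chi 1 τ δ = τ := by
  simp [chi, Finset.Nat.antidiagonal_succ]

theorem chi_add_mul (e : ℕ) (x y : S) :
    chi e (x + y) (x * y) = ∑ p ∈ antidiagonal e, x ^ p.1 * y ^ p.2 := by
  have hrec : ∀ e, ∑ p ∈ antidiagonal (e + 1), x ^ p.1 * y ^ p.2
      = x * ∑ p ∈ antidiagonal e, x ^ p.1 * y ^ p.2 + y ^ (e + 1) := by
    intro e
    rw [Finset.Nat.sum_antidiagonal_succ, Finset.mul_sum, add_comm, pow_zero, one_mul]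
    congr 1
    exact Finset.sum_congr rfl fun p _ => by ring
  induction e using Nat.strong_induction_on with
  | _ e ih =>
    match e with
    | 0 => simp [chi_zero]
    | 1 => simp [chi_one, Finset.Nat.antidiagonal_succ]; ring
    | e + 2 =>
      rw [chi_add_two, ih (e + 1) (by omega), ih e (by omega), hrec (e + 1), hrec e]
      ring

end chi

/-- The `(K + 1)`-st finite difference of a polynomial of degree `K` vanishes. -/
theorem sum_choose_mul_choose_eq_zero (K y : ℕ) :
    ∑ j ∈ Finset.range (K + 2), (-1 : ℤ) ^ j * (K + 1).choose j * (y + (K + 1 - j)).choose K = 0 := by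
  have h1 : (fwdDiff 1)^[K + 1] (fun x ↦ x.choose K : ℕ → ℤ) y = 0 := by
    have := fwdDiff_iter_choose 0 K
    rw [add_zero] at this
    rw [Function.iterate_succ_apply', this]
    simp [fwdDiff]
  rw [fwdDiff_iter_eq_sum_shift, ← Finset.sum_range_reflect] at h1
  rw [← h1]
  refine Finset.sum_congr rfl fun j hj => ?_
  have hj : j < K + 2 := Finset.mem_range.1 hj
  have e1 : K + 1 + 1 - 1 - j = K + 1 - j := by omega
  have e2 : K + 1 - (K + 1 - j) = j := by omega
  simp only [e1, e2, smul_eq_mul, mul_one]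
  rw [Nat.choose_symm (by omega)]

theorem alternating_factorial_sum (d K : ℕ) :
    ∑ j ∈ Finset.range (K + 1), (-1 : ℂ) ^ j * (d + 2 * K - j)! / (j ! * (K - j)! * (d + K + 1 - j)!)
      = if K = 0 then 1 / (d + 1 : ℂ) else 0 := by
  rcases K with _ | K
  · have : (d ! : ℂ) ≠ 0 := by exact_mod_cast d.factorial_ne_zero
    have h2 : (d + 1 : ℂ) ≠ 0 := by exact_mod_cast d.succ_ne_zero
    simp [Nat.factorial_succ]
    field_simp
  · rw [if_neg (Nat.succ_ne_zero K)]
    have h := congrArg (fun z : ℤ => ((K ! : ℂ) / (K + 1)!) * (z : ℂ)) (sum_choose_mul_choose_eq_zero K (d + (K + 1)))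
    simp only [Int.cast_zero, mul_zero] at h
    rw [← h]
    push_cast
    rw [Finset.mul_sum]
    refine Finset.sum_congr rfl fun j hj => ?_
    obtain ⟨i, hi⟩ : ∃ i, K + 1 = j + i := ⟨K + 1 - j, by have := Finset.mem_range.1 hj; omega⟩
    have e1 : K + 1 - j = i := by omega
    have e2 : d + 2 * (K + 1) - j = d + (K + 1) + i := by omega
    have e3 : d + (K + 1) + 1 - j = d + 1 + i := by omega
    rw [e1, e2, e3]
    have h1 := Nat.choose_mul_factorial_mul_factorial (show K ≤ d + (K + 1) + i by omega)
    rw [show d + (K + 1) + i - K = d + 1 + i by omega] at h1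
    have h2 := Nat.choose_mul_factorial_mul_factorial (show j ≤ K + 1 by omega)
    rw [e1] at h2
    rw [← h1, ← h2]
    have n1 : (i ! : ℂ) ≠ 0 := by exact_mod_cast i.factorial_ne_zero
    have n2 : (j ! : ℂ) ≠ 0 := by exact_mod_cast j.factorial_ne_zero
    have n3 : (K ! : ℂ) ≠ 0 := by exact_mod_cast K.factorial_ne_zero
    have n4 : ((d + 1 + i)! : ℂ) ≠ 0 := by exact_mod_cast (d + 1 + i).factorial_ne_zero
    have n5 : ((K + 1).choose j : ℂ) ≠ 0 := by exact_mod_cast (Nat.choose_pos (by omega)).ne'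
    push_cast
    field_simp

end

section

/-! ### The reproducing property of the kernel -/

open scoped Nat

open Finset.HasAntidiagonal (antidiagonal)

/-- The term of index `j` in the expansion of the character of degree `d + 2 K`, for `j ≤ K`,
where `K = i + j`. -/
theorem choose_mul_meanL_trw (W : HC) {Y : HC} (hY : N Y = 0) (d i j : ℕ) {R : ℝ} (hR : 0 < R) :
    ((d + j + 2 * i).choose j : ℂ) * (-N W) ^ j *
      meanL hR (trw Y ^ d * trw W ^ (d + 2 * i) * ((nu ^ (-((d + i : ℕ) : ℤ)) : ZhAlgˣ) : ZhAlg)) =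
      (-1) ^ j * (d + j + 2 * i)! / (j ! * i ! * (d + i + 1)!) * (N W ^ (i + j) * trB W Y ^ d) := by
  have h := meanL_trw_mul W hY (d := d) (n := d + 2 * i) (M := d + i) (by ring) hR
  set m := meanL hR (trw Y ^ d * trw W ^ (d + 2 * i) * ((nu ^ (-((d + i : ℕ) : ℤ)) : ZhAlgˣ) : ZhAlg))
  have h1 := Nat.choose_mul_factorial_mul_factorial (show d ≤ 2 * (d + i) by omega)
  rw [show 2 * (d + i) - d = d + 2 * i by omega] at h1
  have h2 := Nat.choose_mul_factorial_mul_factorial (show d ≤ d + i by omega)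
  have h3 := Nat.choose_mul_factorial_mul_factorial (show j ≤ d + j + 2 * i by omega)
  rw [show d + j + 2 * i - j = d + 2 * i by omega] at h3
  rw [add_tsub_cancel_left] at h h2
  rw [← h1, ← h2] at h
  rw [← h3]
  have n1 : (i ! : ℂ) ≠ 0 := by exact_mod_cast i.factorial_ne_zero
  have n2 : (j ! : ℂ) ≠ 0 := by exact_mod_cast j.factorial_ne_zero
  have n3 : (d ! : ℂ) ≠ 0 := by exact_mod_cast d.factorial_ne_zero
  have n4 : ((d + i + 1)! : ℂ) ≠ 0 := by exact_mod_cast (d + i + 1).factorial_ne_zero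
  have n5 : ((2 * (d + i)).choose d : ℂ) ≠ 0 := by exact_mod_cast (Nat.choose_pos (by omega)).ne'
  have n6 : ((d + i).choose d : ℂ) ≠ 0 := by exact_mod_cast (Nat.choose_pos (by omega)).ne'
  have n7 : ((d + 2 * i)! : ℂ) ≠ 0 := by exact_mod_cast (d + 2 * i).factorial_ne_zero
  have h4 : m = (d + 2 * i)! / (i ! * (d + i + 1)!) * (N W ^ i * trB W Y ^ d) := by
    refine mul_left_cancel₀ n5 (h.trans ?_)
    push_cast
    field_simp
  rw [h4]
  push_cast
  rw [neg_pow (N W), pow_add]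
  field_simp

theorem choose_mul_meanL_trw_eq_zero (W : HC) {Y : HC} (hY : N Y = 0) {d a j : ℕ} {k : ℤ}
    (h : ((a + j : ℕ) : ℤ) = d + 2 * (k + 1) → k + 1 < j) {R : ℝ} (hR : 0 < R) :
    (a.choose j : ℂ) * meanL hR (trw Y ^ d * trw W ^ (a - j) *
      ((nu ^ (k + 1 - a) : ZhAlgˣ) : ZhAlg)) = 0 := by
  rcases Nat.lt_or_ge a j with haj | haj
  · simp [Nat.choose_eq_zero_of_lt haj]
  · by_cases hd : ((a + j : ℕ) : ℤ) = d + 2 * (k + 1)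
    · have h1 := h hd
      push_cast at hd
      obtain ⟨M, hM⟩ : ∃ M : ℕ, (M : ℤ) = a - (k + 1) := ⟨(a - (k + 1)).toNat, by omega⟩
      have h2 := meanL_trw_mul W hY (d := d) (n := a - j) (M := M) (by omega) hR
      rw [Nat.choose_eq_zero_of_lt (show M < d by omega), Nat.cast_zero, zero_mul, mul_zero] at h2
      rw [show k + 1 - (a : ℤ) = -(M : ℤ) by omega]
      rw [(mul_eq_zero.1 h2).resolve_left, mul_zero]
      exact_mod_cast (Nat.choose_pos (by omega)).ne'
    · rw [meanL_trw_mul_of_ne W Y (by push_cast at hd; omega) hR, mul_zero]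

theorem meanL_trw_mul_chi_eq_sum (W Y : HC) (d e : ℕ) (k : ℤ) {R : ℝ} (hR : 0 < R) :
    meanL hR (trw Y ^ d * ((nu ^ (k + 1) : ZhAlgˣ) : ZhAlg) * chi e (trw W * ((nu⁻¹ : ZhAlgˣ) : ZhAlg))
      (N W • ((nu⁻¹ : ZhAlgˣ) : ZhAlg))) =
    ∑ j ∈ Finset.range (e + 1), (-N W) ^ j * (((e - j).choose j : ℂ) *
      meanL hR (trw Y ^ d * trw W ^ (e - j - j) *
      ((nu ^ (k + 1 - ((e - j : ℕ) : ℤ)) : ZhAlgˣ) : ZhAlg))) := by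
  rw [chi, Finset.mul_sum, map_sum, ← Finset.Nat.sum_antidiagonal_swap,
    Finset.Nat.sum_antidiagonal_eq_sum_range_succ_mk]
  refine Finset.sum_congr rfl fun j _ => ?_
  simp only [Prod.fst_swap, Prod.snd_swap]
  generalize e - j = a
  rcases Nat.lt_or_ge a j with haj | haj
  · simp [Nat.choose_eq_zero_of_lt haj]
  · rw [← mul_assoc ((-N W) ^ j)]
    refine Eq.trans ?_ ((meanL hR).map_smul ((-N W) ^ j * (a.choose j : ℂ)) _)
    congr 1
    obtain ⟨b, rfl⟩ := Nat.exists_eq_add_of_le haj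
    have hn : ((nu ^ (k + 1 - ((j + b : ℕ) : ℤ)) : ZhAlgˣ) : ZhAlg) = ((nu ^ (k + 1) : ZhAlgˣ) : ZhAlg)
        * (((nu⁻¹ : ZhAlgˣ) : ZhAlg) ^ j * ((nu⁻¹ : ZhAlgˣ) : ZhAlg) ^ b) := by
      rw [← pow_add, ← Units.val_pow_eq_pow_val, ← Units.val_mul, zpow_sub, inv_pow, zpow_natCast]
    rw [hn, add_tsub_cancel_left, mul_pow, ← neg_smul, smul_pow]
    simp only [Algebra.smul_def, map_mul, map_natCast]
    ring

/-- The mean of `tr(Z♯ Y)^d N^(k+1)` times the character of `Z⁻¹ W` in degree `e`: this is a case of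
the orthogonality relations. -/
theorem meanL_trw_mul_chi (W : HC) {Y : HC} (hY : N Y = 0) (d e : ℕ) (k : ℤ) {R : ℝ} (hR : 0 < R) :
    meanL hR (trw Y ^ d * ((nu ^ (k + 1) : ZhAlgˣ) : ZhAlg) * chi e (trw W * ((nu⁻¹ : ZhAlgˣ) : ZhAlg))
      (N W • ((nu⁻¹ : ZhAlgˣ) : ZhAlg))) =
      if e = d ∧ k = -1 then trB W Y ^ d / (d + 1) else 0 := by
  rw [meanL_trw_mul_chi_eq_sum]
  by_cases hK : (e : ℤ) = d + 2 * (k + 1) ∧ 0 ≤ k + 1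
  · obtain ⟨he, hk⟩ := hK
    obtain ⟨K, hK⟩ : ∃ K : ℕ, (K : ℤ) = k + 1 := ⟨(k + 1).toNat, by omega⟩
    obtain rfl : k = K - 1 := by omega
    obtain rfl : e = d + 2 * K := by omega
    have h1 := alternating_factorial_sum d K
    have h2 : ∑ j ∈ Finset.range (d + 2 * K + 1), (-N W) ^ j * (((d + 2 * K - j).choose j : ℂ) *
        meanL hR (trw Y ^ d * trw W ^ (d + 2 * K - j - j) *
        ((nu ^ ((K : ℤ) - 1 + 1 - ((d + 2 * K - j : ℕ) : ℤ)) : ZhAlgˣ) : ZhAlg)))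
        = ∑ j ∈ Finset.range (K + 1), (-1 : ℂ) ^ j * (d + 2 * K - j)! / (j ! * (K - j)! * (d + K + 1 - j)!)
          * (N W ^ K * trB W Y ^ d) := by
      symm
      refine Finset.sum_subset_zero_on_sdiff (Finset.range_mono (by omega)) ?_ ?_
      · intro j hj
        simp only [Finset.mem_sdiff, Finset.mem_range] at hj
        rw [choose_mul_meanL_trw_eq_zero W hY (fun _ => by omega) hR, mul_zero]
      · intro j hj
        obtain ⟨i, rfl⟩ : ∃ i, K = i + j := ⟨K - j, by have := Finset.mem_range.1 hj; omega⟩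
        have h3 := choose_mul_meanL_trw W hY d i j hR
        have e1 : d + 2 * (i + j) - j = d + j + 2 * i := by omega
        have e2 : d + j + 2 * i - j = d + 2 * i := by omega
        have e3 : d + (i + j) + 1 - j = d + i + 1 := by omega
        have e4 : ((i + j : ℕ) : ℤ) - 1 + 1 - ((d + j + 2 * i : ℕ) : ℤ) = -((d + i : ℕ) : ℤ) := by
          push_cast; ring
        have e5 : i + j - j = i := by omega
        rw [e1, e2, e3, e4, e5, ← h3]
        ring
    rw [h2, ← Finset.sum_mul, h1]
    rcases K with _ | K
    · simp
      ring
    · rw [if_neg (Nat.succ_ne_zero K), if_neg (by rintro ⟨-, h⟩; push_cast at h; omega), zero_mul]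
  · rw [if_neg (by rintro ⟨rfl, rfl⟩; exact hK (by simp))]
    refine Finset.sum_eq_zero fun j hj => ?_
    have := Finset.mem_range.1 hj
    rw [choose_mul_meanL_trw_eq_zero W hY (fun h => ?_) hR, mul_zero]
    by_contra h3
    exact hK ⟨by omega, by omega⟩

theorem chart_mul_conjTranspose (R : ℝ) (x : Fin 4 → ℝ) : chart R x * (chart R x)ᴴ = ((R : ℂ) ^ 2) • (1 : HC) := by
  have hs : (Real.sin (x 3) : ℂ) ^ 2 + (Real.cos (x 3) : ℂ) ^ 2 = 1 := by
    exact_mod_cast Real.sin_sq_add_cos_sq (x 3)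
  have he : ∀ a : ℝ, (starRingEnd ℂ) (Complex.exp (a * Complex.I)) = (Complex.exp (a * Complex.I))⁻¹ := by
    intro a
    rw [← Complex.exp_conj, ← Complex.exp_neg]
    simp
  have h0 := Complex.exp_ne_zero (x 0 * Complex.I)
  have h1 := Complex.exp_ne_zero (x 1 * Complex.I)
  have h2 := Complex.exp_ne_zero (x 2 * Complex.I)
  ext i j
  simp only [Matrix.mul_apply, Fin.sum_univ_two, Matrix.conjTranspose_apply]
  fin_cases i <;> fin_cases j <;>
  · simp only [Fin.zero_eta, Fin.mk_one, chart_zero_zero, chart_zero_one, chart_one_zero,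
      chart_one_one, exp_sub_add_mul_I, RCLike.star_def, map_mul, map_neg, map_inv₀, he,
      Complex.conj_ofReal, Matrix.smul_apply, Matrix.one_apply_eq, smul_eq_mul, mul_one,
      Matrix.one_apply_ne (zero_ne_one), Matrix.one_apply_ne (one_ne_zero), mul_zero]
    field_simp
    first
      | linear_combination hs
      | linear_combination (R : ℂ) ^ 2 * hs
      | ring

/-- On `D⁺_R`, the numbers `λ` for which `W - λ Z` is singular for some `Z` in `U(2)_R` are bounded
by a constant less than `1`. -/
theorem exists_bound_of_mem_DPlus {R : ℝ} (hR : 0 < R) {W : HC} (hW : W ∈ DPlus R) :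
    ∃ ρ : ℝ, 0 ≤ ρ ∧ ρ < 1 ∧ ∀ x (l : ℂ), N (W - l • chart R x) = 0 → ‖l‖ ≤ ρ := by
  set M : HC := ((R : ℂ) ^ 2) • (1 : HC) - W * Wᴴ with hM
  have hpos : M.PosDef := hW
  set q : (Fin 2 → ℂ) → ℝ := fun v => (v ⬝ᵥ (M *ᵥ star v)).re with hq
  have hqc : Continuous q := by
    simp only [hq]
    fun_prop
  have hqpos : ∀ v : Fin 2 → ℂ, v ≠ 0 → 0 < q v := by
    intro v hv
    have h := hpos.dotProduct_mulVec_pos (x := star v) (by simpa using hv)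
    rw [star_star] at h
    exact (Complex.lt_def.1 h).1
  obtain ⟨v₀, hv₀, hmin⟩ := (isCompact_sphere (0 : Fin 2 → ℂ) 1).exists_isMinOn
    ⟨fun _ => 1, by simp⟩ hqc.continuousOn
  set m := q v₀
  have hm : 0 < m := hqpos v₀ (by rintro rfl; simp at hv₀)
  refine ⟨Real.sqrt (1 - m / (2 * R ^ 2)), Real.sqrt_nonneg _, ?_, fun x l hl => ?_⟩
  · rw [Real.sqrt_lt' one_pos]
    have : 0 < m / (2 * R ^ 2) := by positivity
    linarith
  · rw [N_eq_det] at hl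
    obtain ⟨v', hv', hnull'⟩ := Matrix.exists_vecMul_eq_zero_iff.2 hl
    obtain ⟨v, hv, hnull⟩ : ∃ v : Fin 2 → ℂ, ‖v‖ = 1 ∧ v ᵥ* (W - l • chart R x) = 0 := by
      refine ⟨((‖v'‖ : ℂ)⁻¹) • v', ?_, ?_⟩
      · rw [norm_smul, norm_inv, Complex.norm_real, norm_norm, inv_mul_cancel₀ (norm_ne_zero_iff.2 hv')]
      · rw [Matrix.smul_vecMul, hnull', smul_zero]
    rw [Matrix.vecMul_sub, Matrix.vecMul_smul, sub_eq_zero] at hnull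
    have hrow : ∀ A : HC, v ⬝ᵥ ((A * Aᴴ) *ᵥ star v) = (v ᵥ* A) ⬝ᵥ star (v ᵥ* A) := by
      intro A
      rw [← Matrix.mulVec_mulVec, Matrix.dotProduct_mulVec, Matrix.star_vecMul]
    have hS : v ⬝ᵥ star v = ((‖v 0‖ ^ 2 + ‖v 1‖ ^ 2 : ℝ) : ℂ) := by
      simp [dotProduct, Fin.sum_univ_two, Complex.mul_conj']
    have hZ : (v ᵥ* chart R x) ⬝ᵥ star (v ᵥ* chart R x) = (R : ℂ) ^ 2 * (v ⬝ᵥ star v) := by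
      rw [← hrow, chart_mul_conjTranspose, Matrix.smul_mulVec, Matrix.one_mulVec, dotProduct_smul,
        smul_eq_mul]
    have hqv : q v = R ^ 2 * (‖v 0‖ ^ 2 + ‖v 1‖ ^ 2) * (1 - ‖l‖ ^ 2) := by
      have h1 : v ⬝ᵥ (M *ᵥ star v) = ((R ^ 2 * (‖v 0‖ ^ 2 + ‖v 1‖ ^ 2) * (1 - ‖l‖ ^ 2) : ℝ) : ℂ) := by
        rw [hM, Matrix.sub_mulVec, dotProduct_sub, hrow, hnull, star_smul, smul_dotProduct,
          dotProduct_smul, hZ, Matrix.smul_mulVec, Matrix.one_mulVec, dotProduct_smul, hS]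
        simp only [smul_eq_mul, RCLike.star_def]
        have h2 : l * (starRingEnd ℂ) l = (‖l‖ : ℂ) ^ 2 := Complex.mul_conj' l
        push_cast
        linear_combination (-(R : ℂ) ^ 2 * ((‖v 0‖ : ℂ) ^ 2 + (‖v 1‖ : ℂ) ^ 2)) * h2
      simp only [hq, h1, Complex.ofReal_re]
    have hge : m ≤ q v := hmin (by simpa using hv)
    have hle : ‖v 0‖ ^ 2 + ‖v 1‖ ^ 2 ≤ 2 := by
      have h0 : ‖v 0‖ ≤ 1 := hv ▸ norm_le_pi_norm v 0
      have h1 : ‖v 1‖ ≤ 1 := hv ▸ norm_le_pi_norm v 1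
      have := norm_nonneg (v 0)
      have := norm_nonneg (v 1)
      nlinarith
    have hR2 : 0 < R ^ 2 := by positivity
    refine Real.le_sqrt_of_sq_le ?_
    rw [hqv] at hge
    have hl1 : 0 ≤ 1 - ‖l‖ ^ 2 := by
      by_contra hneg
      push Not at hneg
      have : R ^ 2 * (‖v 0‖ ^ 2 + ‖v 1‖ ^ 2) * (1 - ‖l‖ ^ 2) ≤ 0 :=
        mul_nonpos_of_nonneg_of_nonpos (by positivity) hneg.le
      linarith
    have h3 : m ≤ R ^ 2 * 2 * (1 - ‖l‖ ^ 2) :=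
      hge.trans (mul_le_mul_of_nonneg_right (mul_le_mul_of_nonneg_left hle hR2.le) hl1)
    have h4 : m / (2 * R ^ 2) ≤ 1 - ‖l‖ ^ 2 := by
      rw [div_le_iff₀ (by positivity)]
      linarith
    linarith

theorem N_sub_smul (W Z : HC) (l : ℂ) : N (W - l • Z) = N W - l * trB Z W + l ^ 2 * N Z := by
  simp only [N, trB, Matrix.sub_apply, Matrix.smul_apply, smul_eq_mul]
  ring

/-- The eigenvalues of `Z⁻¹ W`. -/
theorem exists_roots (W : HC) {Z : HC} (hZ : N Z ≠ 0) : ∃ l₁ l₂ : ℂ,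
    trB Z W / N Z = l₁ + l₂ ∧ N W / N Z = l₁ * l₂ ∧ N (W - l₁ • Z) = 0 ∧ N (W - l₂ • Z) = 0 := by
  obtain ⟨s, hs⟩ : ∃ s, discrim (N Z) (-trB Z W) (N W) = s * s := by
    exact IsAlgClosed.exists_eq_mul_self _
  have h2 : s * s = trB Z W ^ 2 - 4 * N Z * N W := by rw [← hs, discrim]; ring
  refine ⟨(trB Z W + s) / (2 * N Z), (trB Z W - s) / (2 * N Z), ?_, ?_, ?_, ?_⟩
  · field_simp
    ring
  · field_simp
    linear_combination h2
  · rw [N_sub_smul]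
    field_simp
    linear_combination h2
  · rw [N_sub_smul]
    field_simp
    linear_combination h2

theorem norm_chi_le {l₁ l₂ : ℂ} {ρ : ℝ} (h₁ : ‖l₁‖ ≤ ρ) (h₂ : ‖l₂‖ ≤ ρ) (e : ℕ) :
    ‖chi e (l₁ + l₂) (l₁ * l₂)‖ ≤ (e + 1) * ρ ^ e := by
  have hρ : 0 ≤ ρ := (norm_nonneg _).trans h₁
  rw [chi_add_mul]
  refine (norm_sum_le_of_le (antidiagonal e) (f := fun p => l₁ ^ p.1 * l₂ ^ p.2) (n := fun _ => ρ ^ e)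
    fun p hp => ?_).trans ?_
  · rw [norm_mul, norm_pow, norm_pow, ← Finset.HasAntidiagonal.mem_antidiagonal.1 hp, pow_add]
    gcongr
  · simp

/-- The generating function `∑ h_e(l₁, l₂) = 1 / ((1 - l₁) (1 - l₂))` of the complete homogeneous symmetric
polynomials, written in the elementary symmetric ones. -/
theorem hasSum_chi {l₁ l₂ : ℂ} {ρ : ℝ} (h₁ : ‖l₁‖ ≤ ρ) (h₂ : ‖l₂‖ ≤ ρ) (hρ : ρ < 1) :
    HasSum (fun e => chi e (l₁ + l₂) (l₁ * l₂)) (1 / (1 - (l₁ + l₂) + l₁ * l₂)) := by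
  have s1 : Summable fun n => ‖l₁ ^ n‖ := by
    simpa using summable_geometric_of_lt_one (norm_nonneg _) (h₁.trans_lt hρ)
  have s2 : Summable fun n => ‖l₂ ^ n‖ := by
    simpa using summable_geometric_of_lt_one (norm_nonneg _) (h₂.trans_lt hρ)
  simp only [chi_add_mul]
  have h := (summable_norm_sum_mul_antidiagonal_of_summable_norm s1 s2).of_norm.hasSum
  rw [← tsum_mul_tsum_eq_tsum_sum_antidiagonal_of_summable_norm s1 s2,
    tsum_geometric_of_norm_lt_one (h₁.trans_lt hρ), tsum_geometric_of_norm_lt_one (h₂.trans_lt hρ),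
    ← mul_inv] at h
  rwa [one_div, show 1 - (l₁ + l₂) + l₁ * l₂ = (1 - l₁) * (1 - l₂) by ring]

end

section

open MeasureTheory

theorem N_sub_comm (Z W : HC) : N (Z - W) = N (W - Z) := by
  simp only [N, Matrix.sub_apply]
  ring

theorem N_chart_sub_ne_zero {R : ℝ} (hR : 0 < R) {W : HC} (hW : W ∈ DPlus R) (x : Fin 4 → ℝ) :
    N (chart R x - W) ≠ 0 := by
  obtain ⟨ρ, -, hρ1, hρ⟩ := exists_bound_of_mem_DPlus hR hW
  intro h
  have := hρ x 1 (by rwa [one_smul, ← N_sub_comm])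
  rw [norm_one] at this
  linarith

theorem continuous_N_chart_sub (R : ℝ) (W : HC) : Continuous fun x => N (chart R x - W) := by
  have := continuous_chart_apply R
  simp only [N, Matrix.sub_apply]
  fun_prop

theorem continuous_kernel {R : ℝ} (hR : 0 < R) {W : HC} (hW : ∀ x, N (chart R x - W) ≠ 0) (f : ZhAlg) :
    Continuous fun x => ext f (chart R x) / N (chart R x - W) :=
  (continuous_ext_chart hR f).div (continuous_N_chart_sub R W) hW

theorem coe_nu_inv (Z : HCx) : (((nu⁻¹ : ZhAlgˣ) : ZhAlg) : Fn) Z = (N (Z : HC))⁻¹ := rfl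

theorem chi_apply (W : HC) (e : ℕ) (Z : HCx) :
    ((chi e (trw W * ((nu⁻¹ : ZhAlgˣ) : ZhAlg)) (N W • ((nu⁻¹ : ZhAlgˣ) : ZhAlg)) : ZhAlg) : Fn) Z
      = chi e (trB Z W / N (Z : HC)) (N W / N (Z : HC)) := by
  have h := map_sum (evalAt Z) (fun x : ℕ × ℕ => (x.1.choose x.2 : ZhAlg) *
    ((trw W * ((nu⁻¹ : ZhAlgˣ) : ZhAlg)) ^ (x.1 - x.2) * (-(N W • ((nu⁻¹ : ZhAlgˣ) : ZhAlg))) ^ x.2))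
    (Finset.HasAntidiagonal.antidiagonal e)
  refine h.trans (Finset.sum_congr rfl fun x _ => ?_)
  simp only [map_mul, map_natCast, map_pow, map_neg, map_smul]
  rfl

/-- The integral kernel `1/N(Z-W)` is expanded in the characters of `Z⁻¹ W`. -/
theorem hasSum_meanL_chi {R : ℝ} (hR : 0 < R) {W : HC} (hW : W ∈ DPlus R) (f : ZhAlg) :
    HasSum (fun e => meanL hR (f * (nu : ZhAlg) * chi e (trw W * ((nu⁻¹ : ZhAlgˣ) : ZhAlg))
      (N W • ((nu⁻¹ : ZhAlgˣ) : ZhAlg))))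
      (mean R fun Z => ext f Z / N (Z - W) * N Z ^ 2) := by
  obtain ⟨ρ, hρ0, hρ1, hρ⟩ := exists_bound_of_mem_DPlus hR hW
  set X : ℕ → ZhAlg := fun e => chi e (trw W * ((nu⁻¹ : ZhAlgˣ) : ZhAlg))
      (N W • ((nu⁻¹ : ZhAlgˣ) : ZhAlg)) with hX
  set g : ZhAlg := f * (nu : ZhAlg) with hg
  have hroots : ∀ x : Fin 4 → ℝ, ∃ l₁ l₂ : ℂ, ‖l₁‖ ≤ ρ ∧ ‖l₂‖ ≤ ρ ∧
      trB (chart R x) W / N (chart R x) = l₁ + l₂ ∧ N W / N (chart R x) = l₁ * l₂ := by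
    intro x
    obtain ⟨l₁, l₂, h1, h2, h3, h4⟩ := exists_roots W (N_chart_ne_zero hR x)
    exact ⟨l₁, l₂, hρ x _ h3, hρ x _ h4, h1, h2⟩
  have hXx : ∀ e x, (X e : Fn) (chartU hR x)
      = chi e (trB (chart R x) W / N (chart R x)) (N W / N (chart R x)) :=
    fun e x => chi_apply W e (chartU hR x)
  have hF : ∀ e, Continuous fun y => ext (g * X e : ZhAlg) (chart R (vec4 y)) * density y := fun e =>
    ((continuous_ext_chart hR _).comp continuous_vec4).mul continuous_density
  have hgc : Continuous fun y => ext g (chart R (vec4 y)) * density y :=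
    ((continuous_ext_chart hR _).comp continuous_vec4).mul continuous_density
  have hbound : ∀ e y, ‖ext (g * X e : ZhAlg) (chart R (vec4 y)) * density y‖
      ≤ ((e + 1) * ρ ^ e) * ‖ext g (chart R (vec4 y)) * density y‖ := by
    intro e y
    obtain ⟨l₁, l₂, h1, h2, h3, h4⟩ := hroots (vec4 y)
    rw [ext_chart hR, ext_chart hR, mul_apply, hXx, h3, h4, mul_right_comm, norm_mul, mul_comm]
    exact mul_le_mul_of_nonneg_right (norm_chi_le h1 h2 e) (norm_nonneg _)
  have hsum := hasSum_integral_of_summable_integral_norm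
    (μ := volume.restrict paramBox)
    (F := fun e y => ext (g * X e : ZhAlg) (chart R (vec4 y)) * density y)
    (fun e => integrableOn_paramBox (hF e)) (by
      have hs : Summable fun e : ℕ => ((e + 1 : ℝ) * ρ ^ e)
          * ∫ y in paramBox, ‖ext g (chart R (vec4 y)) * density y‖ := by
        refine Summable.mul_right _ ?_
        have h1 := summable_pow_mul_geometric_of_norm_lt_one (R := ℝ) 1 (r := ρ)
          (by rwa [Real.norm_of_nonneg hρ0])
        have h2 := summable_geometric_of_lt_one hρ0 hρ1
        refine (h1.add h2).congr fun e => ?_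
        ring
      refine Summable.of_nonneg_of_le (fun e => integral_nonneg fun _ => norm_nonneg _)
        (fun e => ?_) hs
      rw [← integral_const_mul]
      exact integral_mono (integrableOn_paramBox (hF e)).norm
        ((integrableOn_paramBox hgc).norm.const_mul _) (hbound e))
  have h := hsum.mul_left ((4 * (Real.pi : ℂ) ^ 3)⁻¹)
  have hval : (mean R fun Z => ext f Z / N (Z - W) * N Z ^ 2) = (4 * (Real.pi : ℂ) ^ 3)⁻¹ *
      ∫ y in paramBox, ∑' e, ext (g * X e : ZhAlg) (chart R (vec4 y)) * density y := by
    rw [mean]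
    congr 1
    refine integral_congr_ae (Filter.Eventually.of_forall fun y => ?_)
    obtain ⟨l₁, l₂, h1, h2, h3, h4⟩ := hroots (vec4 y)
    have hs := ((hasSum_chi h1 h2 hρ1).mul_left (ext g (chart R (vec4 y)))).mul_right (density y)
    have hN0 := N_chart_ne_zero hR (vec4 y)
    have hNW := N_chart_sub_ne_zero hR hW (vec4 y)
    have hker : 1 - (l₁ + l₂) + l₁ * l₂ = N (chart R (vec4 y) - W) / N (chart R (vec4 y)) := by
      rw [← h3, ← h4, eq_div_iff hN0]
      have := N_sub_smul W (chart R (vec4 y)) 1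
      rw [one_smul, ← N_sub_comm] at this
      rw [this]
      field_simp
      ring
    have hgx : ext g (chart R (vec4 y)) = ext f (chart R (vec4 y)) * N (chart R (vec4 y)) := by
      rw [ext_chart hR, ext_chart hR]
      rfl
    have hext : ∀ e, ext (g * X e : ZhAlg) (chart R (vec4 y))
        = ext g (chart R (vec4 y)) * chi e (l₁ + l₂) (l₁ * l₂) := by
      intro e
      rw [ext_chart hR, ext_chart hR, mul_apply, hXx, h3, h4]
    simp only [hext]
    rw [hs.tsum_eq, hker, hgx]
    field_simp
  rw [hval]
  exact h

/-- The pairing with the kernel `1/N(Z-W)` as a linear functional. -/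
def kernelL {R : ℝ} (hR : 0 < R) {W : HC} (hW : W ∈ DPlus R) : ZhAlg →ₗ[ℂ] ℂ where
  toFun f := mean R fun Z => ext f Z / N (Z - W) * N Z ^ 2
  map_add' f g := by
    have hc : ∀ f : ZhAlg, Continuous fun x => ext f (chart R x) / N (chart R x - W) * N (chart R x) ^ 2 :=
      fun f => (continuous_kernel hR (N_chart_sub_ne_zero hR hW) f).mul
        ((by simpa using continuous_N_chart_sub R 0 : Continuous fun x => N (chart R x)).pow 2)
    rw [← mean_add R (hc f) (hc g)]
    unfold mean
    simp only [ext_chart hR, add_apply, add_div, add_mul]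
  map_smul' c f := by
    rw [RingHom.id_apply, smul_eq_mul, ← mean_const_mul]
    unfold mean
    simp only [ext_chart hR, smul_apply, mul_div_assoc, mul_assoc]

theorem pairKernel_eq_mean {R : ℝ} (hR : 0 < R) {W : HC} (hW : ∀ x, N (chart R x - W) ≠ 0) (f : Zh) :
    pairKernel R f W = mean R fun Z => ext (f : Fn) Z / N (Z - W) * N Z ^ 2 :=
  intU2_eq_mean R (continuous_kernel hR hW ⟨f, f.2⟩)

theorem pairKernel_eq_kernelL {R : ℝ} (hR : 0 < R) {W : HC} (hW : W ∈ DPlus R) (f : Zh) :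
    pairKernel R f W = kernelL hR hW ⟨f, f.2⟩ :=
  pairKernel_eq_mean hR (N_chart_sub_ne_zero hR hW) f

/-- The reproducing property of `1 / N (Z - W)` on powers of an isotropic linear form, up to the factor `d + 1`
that `degN` removes: only the exponent `k = -1` of `N` survives. -/
theorem kernelL_trw {R : ℝ} (hR : 0 < R) {W : HC} (hW : W ∈ DPlus R) {Y : HC} (hY : N Y = 0)
    (d : ℕ) (k : ℤ) : kernelL hR hW (trw Y ^ d * ((nu ^ k : ZhAlgˣ) : ZhAlg)) =
      if k = -1 then trB W Y ^ d / (d + 1) else 0 := by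
  have h := hasSum_meanL_chi hR hW (trw Y ^ d * ((nu ^ k : ZhAlgˣ) : ZhAlg))
  have h2 : ∀ e, meanL hR (trw Y ^ d * ((nu ^ k : ZhAlgˣ) : ZhAlg) * (nu : ZhAlg) *
      chi e (trw W * ((nu⁻¹ : ZhAlgˣ) : ZhAlg)) (N W • ((nu⁻¹ : ZhAlgˣ) : ZhAlg)))
      = if e = d then (if k = -1 then trB W Y ^ d / (d + 1) else 0) else 0 := by
    intro e
    rw [mul_assoc (trw Y ^ d), mul_comm _ (nu : ZhAlg), nu_mul_zpow, meanL_trw_mul_chi W hY d e k hR]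
    split_ifs <;> simp_all
  simp only [h2] at h
  exact h.unique (hasSum_ite_eq d _)

/-- The reproducing property: pairing `t^l_{n m} N^k` with the kernel gives zero unless `k = -1`,
in which case it reproduces the matrix coefficient up to the factor `2 l + 1`. -/
theorem kernelL_tau {R : ℝ} (hR : 0 < R) {W : HC} (hW : W ∈ DPlus R) (p q r : ℕ) (k : ℤ) :
    kernelL hR hW (tau p q r * ((nu ^ k : ZhAlgˣ) : ZhAlg)) =
      if k = -1 then tcoef p q r W / (p + q + 1) else 0 := by
  -- Working in the ring `ZhAlg × ℂ` evaluates the polynomials also at singular matrices `W`.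
  have h := tauC_mem_span (S := ZhAlg × ℂ) (zc 0 0, W 0 0) (zc 0 1, W 0 1) (zc 1 0, W 1 0)
    (zc 1 1, W 1 1) p q r
  have e1 : (tauC (S := ZhAlg × ℂ) (zc 0 0, W 0 0) (zc 0 1, W 0 1) (zc 1 0, W 1 0)
    (zc 1 1, W 1 1) p q r).1 = tau p q r := map_tauC (RingHom.fst ZhAlg ℂ) _ _ _ _ p q r
  have e2 : (tauC (S := ZhAlg × ℂ) (zc 0 0, W 0 0) (zc 0 1, W 0 1) (zc 1 0, W 1 0)
    (zc 1 1, W 1 1) p q r).2 = tcoef p q r W := by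
    rw [tcoef_eq_tauC]
    exact map_tauC (RingHom.snd ZhAlg ℂ) _ _ _ _ p q r
  have key : ∀ t ∈ Submodule.span ℂ {f : ZhAlg × ℂ | ∃ Y : HC, N Y = 0 ∧
      f = (Y 0 0 • (zc 1 1, W 1 1) - Y 1 0 • (zc 0 1, W 0 1) - Y 0 1 • (zc 1 0, W 1 0)
        + Y 1 1 • (zc 0 0, W 0 0)) ^ (p + q)},
      kernelL hR hW (t.1 * ((nu ^ k : ZhAlgˣ) : ZhAlg)) = if k = -1 then t.2 / (p + q + 1) else 0 := by
    intro t ht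
    induction ht using Submodule.span_induction with
    | mem t ht =>
      obtain ⟨Y, hY, rfl⟩ := ht
      have h1 := kernelL_trw hR hW hY (p + q) k
      push_cast at h1
      rw [Prod.pow_fst, Prod.pow_snd]
      exact h1
    | zero => simp
    | add t u _ _ h1 h2 =>
      rw [Prod.fst_add, add_mul, map_add, h1, h2, Prod.snd_add]
      split_ifs
      · ring
      · ring
    | smul c t _ h1 =>
      rw [Prod.smul_fst, smul_mul_assoc, map_smul, h1, Prod.smul_snd, smul_eq_mul, smul_eq_mul]
      split_ifs
      · ring
      · ring
  have h3 := key _ h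
  rwa [e1, e2] at h3

theorem norm_sq_add_le (a b c d : ℂ) :
    ‖a * b + c * d‖ ^ 2 ≤ (‖a‖ ^ 2 + ‖c‖ ^ 2) * (‖b‖ ^ 2 + ‖d‖ ^ 2) := by
  have h : ‖a * b + c * d‖ ≤ ‖a‖ * ‖b‖ + ‖c‖ * ‖d‖ := by
    refine (norm_add_le _ _).trans ?_
    rw [norm_mul, norm_mul]
  have h2 := pow_le_pow_left₀ (norm_nonneg _) h 2
  nlinarith [sq_nonneg (‖a‖ * ‖d‖ - ‖c‖ * ‖b‖)]

theorem exists_mem_DPlus (W : HC) : ∃ R : ℝ, 0 < R ∧ W ∈ DPlus R := by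
  set s : ℝ := ‖W 0 0‖ ^ 2 + ‖W 0 1‖ ^ 2 + ‖W 1 0‖ ^ 2 + ‖W 1 1‖ ^ 2 with hs
  have hs0 : 0 ≤ s := by positivity
  refine ⟨s + 1, by positivity, Matrix.PosDef.of_dotProduct_mulVec_pos ?_ fun x hx => ?_⟩
  · have h1 : (((((s + 1 : ℝ) : ℂ)) ^ 2) • (1 : HC)).IsHermitian := by
      rw [Matrix.IsHermitian, Matrix.conjTranspose_smul, Matrix.conjTranspose_one]
      simp
    exact h1.sub (Matrix.isHermitian_mul_conjTranspose_self W)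
  · have e : star x ⬝ᵥ ((((((s + 1 : ℝ) : ℂ)) ^ 2) • (1 : HC) - W * Wᴴ) *ᵥ x) =
        (((s + 1) ^ 2 * (‖x 0‖ ^ 2 + ‖x 1‖ ^ 2) - (‖star (x 0) * W 0 0 + star (x 1) * W 1 0‖ ^ 2
          + ‖star (x 0) * W 0 1 + star (x 1) * W 1 1‖ ^ 2) : ℝ) : ℂ) := by
      simp only [Complex.ofReal_sub, Complex.ofReal_add, Complex.ofReal_mul, Complex.ofReal_pow,
        ← Complex.mul_conj']
      simp [dotProduct, Matrix.mulVec, Fin.sum_univ_two, Matrix.mul_apply, Matrix.one_apply]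
      ring
    rw [e]
    have h1 := norm_sq_add_le (star (x 0)) (W 0 0) (star (x 1)) (W 1 0)
    have h2 := norm_sq_add_le (star (x 0)) (W 0 1) (star (x 1)) (W 1 1)
    rw [norm_star, norm_star] at h1 h2
    have hx2 : 0 < ‖x 0‖ ^ 2 + ‖x 1‖ ^ 2 := by
      by_contra hn
      have h3 : ‖x 0‖ = 0 := by nlinarith [sq_nonneg (‖x 0‖), sq_nonneg (‖x 1‖)]
      have h4 : ‖x 1‖ = 0 := by nlinarith [sq_nonneg (‖x 0‖), sq_nonneg (‖x 1‖)]
      refine hx (funext fun i => ?_)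
      fin_cases i
      · exact norm_eq_zero.1 h3
      · exact norm_eq_zero.1 h4
    have : s < (s + 1) ^ 2 := by nlinarith
    have h5 : (‖x 0‖ ^ 2 + ‖x 1‖ ^ 2) * s < (‖x 0‖ ^ 2 + ‖x 1‖ ^ 2) * (s + 1) ^ 2 :=
      mul_lt_mul_of_pos_left this hx2
    have h6 : 0 < (s + 1) ^ 2 * (‖x 0‖ ^ 2 + ‖x 1‖ ^ 2) - (‖star (x 0) * W 0 0 + star (x 1) * W 1 0‖ ^ 2
          + ‖star (x 0) * W 0 1 + star (x 1) * W 1 1‖ ^ 2) := by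
      rw [hs] at h5 ⊢
      nlinarith
    exact_mod_cast h6

end

theorem intU2_one_div_N_sq {R : ℝ} (hR : 0 < R) :
    intU2 R (fun Z => 1 / N Z ^ 2) = -2 * (Real.pi : ℂ) ^ 3 * Complex.I := by
  have hc : Continuous fun x => N (chart R x) := by simpa using continuous_N_chart_sub R 0
  have h := intU2_eq_mean R (F := fun Z => 1 / N Z ^ 2)
    (continuous_const.div (hc.pow 2) fun x => pow_ne_zero 2 (N_chart_ne_zero hR x))
  have h1 : (mean R fun Z => 1 / N Z ^ 2 * N Z ^ 2) = meanL hR 1 := by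
    rw [meanL_apply, mean, mean]
    congr 2
    funext y
    rw [ext_chart hR, one_apply, div_mul_cancel₀ _ (pow_ne_zero 2 (N_chart_ne_zero hR _))]
  have h2 : meanL hR 1 = 1 := by
    have := meanL_monomial hR 0 0 0 0 0
    simpa using this
  rw [h1, h2] at h
  have hpi : (Real.pi : ℂ) ≠ 0 := by exact_mod_cast Real.pi_ne_zero
  have h3 : Complex.I * intU2 R (fun Z => 1 / N Z ^ 2) = 2 * (Real.pi : ℂ) ^ 3 := by
    field_simp at h
    linear_combination h
  linear_combination (-Complex.I) * h3 + intU2 R (fun Z => 1 / N Z ^ 2) * Complex.I_sq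

/-! ### The basis of matrix coefficients times powers of the norm -/

/-- The indices `(p, q, r, k)` of the functions `t^l_{n m} N^k`. -/
abbrev TauIndex : Type := {x : ℕ × ℕ × ℕ × ℤ // x.2.2.1 ≤ x.1 + x.2.1}

/-- The number `2 l`. -/
def TauIndex.deg (i : TauIndex) : ℕ := i.1.1 + i.1.2.1

/-- The exponent of the norm. -/
def TauIndex.pow (i : TauIndex) : ℤ := i.1.2.2.2

/-- The function `t^l_{n m} N^k`. -/
def tauFn (i : TauIndex) : ZhAlg :=
  tau i.1.1 i.1.2.1 i.1.2.2.1 * ((nu ^ i.1.2.2.2 : ZhAlgˣ) : ZhAlg)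

theorem kernelL_tauFn_mul {R : ℝ} (hR : 0 < R) {W : HC} (hW : W ∈ DPlus R) (i : TauIndex) (k : ℤ) :
    kernelL hR hW (((nu ^ (-1 - k) : ZhAlgˣ) : ZhAlg) * tauFn i) =
      if i.pow = k then tcoef i.1.1 i.1.2.1 i.1.2.2.1 W / (i.1.1 + i.1.2.1 + 1) else 0 := by
  rw [tauFn, mul_left_comm, ← Units.val_mul, ← zpow_add, kernelL_tau]
  have : -1 - k + i.1.2.2.2 = -1 ↔ i.pow = k := by
    rw [TauIndex.pow]
    omega
  simp only [this]

/-- The coefficients in a linear relation are detected by the pairing with `1 / N (Z - W)` after multiplying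
by a power of `N`, read off at rank-one `W`, where the values are distinct monomials in the parameters. -/
theorem linearIndependent_tauFn : LinearIndependent ℂ tauFn := by
  rw [linearIndependent_iff]
  intro l hl
  ext i₀
  rw [Finsupp.coe_zero, Pi.zero_apply]
  let m : TauIndex → (Fin 3 →₀ ℕ) := fun i => Finsupp.equivFunOnFinite.symm ![i.1.2.2.1, i.1.1, i.1.2.1]
  let c : TauIndex → ℂ := fun i => if i.pow = i₀.pow then
    ((i.1.1 + i.1.2.1).choose i.1.2.2.1 : ℂ) / (i.1.1 + i.1.2.1 + 1) else 0
  have hP : l.sum (fun i a => MvPolynomial.monomial (m i) (a * c i)) = 0 := by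
    refine MvPolynomial.funext fun v => ?_
    obtain ⟨R, hR, hW⟩ := exists_mem_DPlus !![v 0 * v 1, v 0 * v 2; v 1, v 2]
    have h1 := congrArg (fun f => kernelL hR hW (((nu ^ (-1 - i₀.pow) : ZhAlgˣ) : ZhAlg) * f)) hl
    simp only [mul_zero, map_zero] at h1
    rw [map_zero, ← h1, Finsupp.linearCombination_apply, Finsupp.mul_sum, map_finsuppSum,
      map_finsuppSum]
    refine Finsupp.sum_congr fun i _ => ?_
    rw [mul_smul_comm, map_smul, kernelL_tauFn_mul, MvPolynomial.eval_monomial, tcoef_eq_tauC,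
      Finsupp.prod_fintype _ _ (fun _ => pow_zero _), Fin.prod_univ_three]
    have h2 := tauC_rank_one (v 0) (v 1) (v 2) i.1.1 i.1.2.1 i.1.2.2.1
    simp only [Matrix.of_apply, Matrix.cons_val', Matrix.cons_val_zero, Matrix.cons_val_one,
      Matrix.cons_val_fin_one]
    rw [h2]
    simp only [m, c, Finsupp.equivFunOnFinite_symm_apply_apply, Matrix.cons_val]
    split_ifs
    · rw [smul_eq_mul]
      ring
    · simp
  have h2 := congrArg (MvPolynomial.coeff (m i₀)) hP
  rw [MvPolynomial.coeff_zero, Finsupp.sum, MvPolynomial.coeff_sum] at h2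
  by_contra hne
  rw [Finset.sum_eq_single i₀] at h2
  · rw [MvPolynomial.coeff_monomial, if_pos rfl] at h2
    simp only [c, if_pos] at h2
    refine hne ((mul_eq_zero.1 h2).resolve_right (div_ne_zero ?_ ?_))
    · exact_mod_cast (Nat.choose_pos i₀.2).ne'
    · exact_mod_cast (i₀.1.1 + i₀.1.2.1).succ_ne_zero
  · intro i _ hi
    rw [MvPolynomial.coeff_monomial]
    split_ifs with hm
    · have hk : i.pow ≠ i₀.pow := by
        intro hk
        have hm := Finsupp.equivFunOnFinite.symm.injective hm
        refine hi (Subtype.ext ?_)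
        have a0 := congrFun hm 0
        have a1 := congrFun hm 1
        have a2 := congrFun hm 2
        simp only [Matrix.cons_val] at a0 a1 a2
        exact Prod.ext a1 (Prod.ext a2 (Prod.ext a0 hk))
      simp [c, hk]
    · rfl
  · intro h
    exact absurd (Finsupp.notMem_support_iff.1 h) hne

theorem range_tauFn_span : ⊤ ≤ Submodule.span ℂ (Set.range tauFn) := by
  rw [← tauSpan_univ]
  refine Submodule.span_mono ?_
  rintro f ⟨p, q, r, k, hr, -, rfl⟩
  exact ⟨⟨(p, q, r, k), hr⟩, rfl⟩

/-- The functions `t^l_{n m} N^k` form a basis of `ZhAlg`. -/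
def tauBasis : Module.Basis TauIndex ℂ ZhAlg := Module.Basis.mk linearIndependent_tauFn range_tauFn_span

theorem tauBasis_apply (i : TauIndex) : tauBasis i = tauFn i := Module.Basis.mk_apply _ _ _

/-- The span of the `t^l_{n m} N^k` for which `P (2 l) k` holds. -/
def tauSpanP (P : ℕ → ℤ → Prop) : Submodule ℂ ZhAlg :=
  Submodule.span ℂ (tauBasis '' {i | P i.deg i.pow})

theorem mem_tauSpanP {P : ℕ → ℤ → Prop} {f : ZhAlg} :
    f ∈ tauSpanP P ↔ ∀ i, tauBasis.repr f i ≠ 0 → P i.deg i.pow := by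
  rw [tauSpanP, Module.Basis.mem_span_image]
  constructor
  · exact fun h i hi => h (Finsupp.mem_support_iff.2 hi)
  · exact fun h i hi => h i (Finsupp.mem_support_iff.1 hi)

theorem tau_mul_mem_tauSpanP {P : ℕ → ℤ → Prop} {p q : ℕ} {k : ℤ} (h : P (p + q) k) (r : ℕ) :
    tau p q r * ((nu ^ k : ZhAlgˣ) : ZhAlg) ∈ tauSpanP P := by
  by_cases hr : r ≤ p + q
  · exact Submodule.subset_span ⟨⟨(p, q, r, k), hr⟩, h, tauBasis_apply _⟩
  · rw [tau_eq_zero (by omega), zero_mul]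
    exact zero_mem _

theorem polyA_eq_tauSpanP : Subalgebra.toSubmodule polyA = tauSpanP fun _ k => 0 ≤ k := by
  rw [← tauSpan_nonneg]
  apply le_antisymm
  · refine Submodule.span_le.2 ?_
    rintro f ⟨p, q, r, k, hr, hk, rfl⟩
    exact tau_mul_mem_tauSpanP (P := fun _ k => 0 ≤ k) hk r
  · refine Submodule.span_le.2 ?_
    rintro f ⟨i, hi, rfl⟩
    rw [tauBasis_apply]
    exact tau_mem_tauSpan (K := {k | 0 ≤ k}) hi _ _ _

theorem disjoint_tauSpanP {P Q : ℕ → ℤ → Prop} (h : ∀ n k, P n k → ¬ Q n k) :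
    Disjoint (tauSpanP P) (tauSpanP Q) := by
  rw [Submodule.disjoint_def]
  intro f hP hQ
  rw [mem_tauSpanP] at hP hQ
  rw [← tauBasis.repr.map_eq_zero_iff]
  ext i
  by_contra hi
  exact h _ _ (hP i hi) (hQ i hi)

/-- If a linear map sends the basis vectors to multiples of basis vectors, its kernel
is spanned by basis vectors. -/
theorem repr_mul_eq_zero (T : ZhAlg →ₗ[ℂ] ZhAlg) (σ : TauIndex → TauIndex)
    (hσ : Function.Injective σ) (a : TauIndex → ℂ) (hT : ∀ i, T (tauFn i) = a i • tauFn (σ i))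
    {f : ZhAlg} (hf : T f = 0) (i : TauIndex) : tauBasis.repr f i * a i = 0 := by
  have h1 : ∑ i ∈ (tauBasis.repr f).support, (tauBasis.repr f i * a i) • (tauFn ∘ σ) i = 0 := by
    rw [← hf]
    conv_rhs => rw [← tauBasis.linearCombination_repr f, Finsupp.linearCombination_apply,
      map_finsuppSum]
    refine Finset.sum_congr rfl fun i _ => ?_
    beta_reduce
    rw [map_smul, tauBasis_apply, hT, smul_smul]
    rfl
  have h2 := linearIndependent_iff'.1 (linearIndependent_tauFn.comp σ hσ) _ _ h1
  by_cases hi : i ∈ (tauBasis.repr f).support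
  · exact h2 i hi
  · rw [Finsupp.notMem_support_iff.1 hi, zero_mul]

/-! ### Homogeneous harmonic polynomials -/

/-- The operator `□` on `ZhAlg`. -/
def boxA : ZhAlg →ₗ[ℂ] ZhAlg where
  toFun f := 4 * (pdD 0 0 (pdD 1 1 f) - pdD 0 1 (pdD 1 0 f))
  map_add' f g := by
    simp only [map_add]
    ring
  map_smul' c f := by
    simp only [Derivation.map_smul, RingHom.id_apply, ← smul_sub, mul_smul_comm]

theorem boxA_apply (f : ZhAlg) : boxA f = 4 * (pdD 0 0 (pdD 1 1 f) - pdD 0 1 (pdD 1 0 f)) := rfl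

theorem boxA_coe (f : ZhAlg) : (boxA f : Fn) = box f := by
  funext Z
  rfl

/-- The Euler operator `∑ z_{ij} ∂_{ij}`. -/
def eulerD : Derivation ℂ ZhAlg ZhAlg := ∑ i, ∑ j, zc i j • pdD i j

theorem eulerD_apply (f : ZhAlg) : eulerD f = zc 0 0 * pdD 0 0 f + zc 0 1 * pdD 0 1 f
    + (zc 1 0 * pdD 1 0 f + zc 1 1 * pdD 1 1 f) := by
  simp [eulerD, Fin.sum_univ_two]

theorem degt_coe (f : ZhAlg) : ((f + eulerD f : ZhAlg) : Fn) = degt f := by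
  funext Z
  rw [add_apply, eulerD_apply]
  simp only [degt, Fin.sum_univ_two]
  rfl

theorem eulerD_zc (i j : Fin 2) : eulerD (zc i j) = zc i j := by
  rw [eulerD_apply]
  fin_cases i <;> fin_cases j <;> simp [pdD_zc]

theorem eulerD_nu : eulerD (nu : ZhAlg) = 2 * (nu : ZhAlg) := by
  simp only [nu_val, map_sub, Derivation.leibniz, eulerD_zc, smul_eq_mul]
  ring

theorem eulerD_nu_zpow (k : ℤ) :
    eulerD ((nu ^ k : ZhAlgˣ) : ZhAlg) = (2 * k : ℂ) • ((nu ^ k : ZhAlgˣ) : ZhAlg) := by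
  rw [derivation_nu_zpow, eulerD_nu, mul_left_comm, mul_comm _ (nu : ZhAlg), nu_mul_zpow,
    sub_add_cancel, mul_smul, two_mul, two_smul, smul_add]

theorem pdD_eulerD (i j : Fin 2) (f : ZhAlg) : eulerD (pdD i j f) = pdD i j (eulerD f) - pdD i j f := by
  have h : ⁅pdD i j, eulerD⁆ = pdD i j := by
    refine derivation_ext fun k l => ?_
    rw [Derivation.commutator_apply, eulerD_zc, pdD_zc]
    split_ifs <;> simp
  have h2 := congrArg (fun D : Derivation ℂ ZhAlg ZhAlg => D f) h
  simp only [Derivation.commutator_apply] at h2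
  linear_combination -h2

theorem boxA_mul (f g : ZhAlg) : boxA (f * g) = f * boxA g + g * boxA f
    + 4 * (pdD 0 0 f * pdD 1 1 g + pdD 1 1 f * pdD 0 0 g
      - pdD 0 1 f * pdD 1 0 g - pdD 1 0 f * pdD 0 1 g) := by
  simp only [boxA_apply, Derivation.leibniz, map_add, smul_eq_mul]
  ring

theorem pdD_nu : pdD 0 0 (nu : ZhAlg) = zc 1 1 ∧ pdD 1 1 (nu : ZhAlg) = zc 0 0 ∧
    pdD 0 1 (nu : ZhAlg) = -zc 1 0 ∧ pdD 1 0 (nu : ZhAlg) = -zc 0 1 := by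
  refine ⟨?_, ?_, ?_, ?_⟩ <;> simp [nu_val, Derivation.leibniz, pdD_zc]

theorem boxA_nu_zpow (k : ℤ) : boxA ((nu ^ k : ZhAlgˣ) : ZhAlg) =
    (4 * k * (k + 1) : ℂ) • ((nu ^ (k - 1) : ZhAlgˣ) : ZhAlg) := by
  obtain ⟨h00, h11, h01, h10⟩ := pdD_nu
  have e2 : ((nu ^ (k - 1) : ZhAlgˣ) : ZhAlg) = (nu : ZhAlg) * ((nu ^ (k - 1 - 1) : ZhAlgˣ) : ZhAlg) := by
    rw [nu_mul_zpow, sub_add_cancel]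
  rw [boxA_apply, derivation_nu_zpow (pdD 1 1), derivation_nu_zpow (pdD 1 0)]
  simp only [Derivation.map_smul, Derivation.leibniz, derivation_nu_zpow, h00, h11, h01, h10, pdD_zc,
    map_neg]
  simp only [Algebra.smul_def]
  rw [e2, nu_val]
  generalize ((nu ^ (k - 1 - 1) : ZhAlgˣ) : ZhAlg) = u
  simp [map_ofNat (algebraMap ℂ ZhAlg) 4]
  ring

/-- For `f` homogeneous of degree `d`, the commutator of `□` with `N ^ k` is the scalar `4 k (k + 1 + d)` times
`N ^ (k - 1)`. Its zeros at `k = 0` and `k = -(d + 1)` account for the two kinds of harmonic functions. -/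
theorem boxA_mul_nu_zpow {f : ZhAlg} {d : ℂ} (hE : eulerD f = d • f) (k : ℤ) :
    boxA (f * ((nu ^ k : ZhAlgˣ) : ZhAlg)) = boxA f * ((nu ^ k : ZhAlgˣ) : ZhAlg) +
      (4 * k * (k + 1 + d) : ℂ) • (f * ((nu ^ (k - 1) : ZhAlgˣ) : ZhAlg)) := by
  obtain ⟨h00, h11, h01, h10⟩ := pdD_nu
  rw [eulerD_apply] at hE
  rw [boxA_mul, boxA_nu_zpow]
  simp only [derivation_nu_zpow, h00, h11, h01, h10]
  simp only [Algebra.smul_def, map_mul, map_add, map_one, map_intCast, map_ofNat] at hE ⊢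
  linear_combination (4 * (k : ZhAlg) * ((nu ^ (k - 1) : ZhAlgˣ) : ZhAlg)) * hE

theorem pdD_mem_polyA (i j : Fin 2) {f : ZhAlg} (hf : f ∈ polyA) : pdD i j f ∈ polyA := by
  induction hf using Algebra.adjoin_induction with
  | mem f hf =>
    obtain ⟨kl, rfl⟩ := hf
    rw [pdD_zc]
    split_ifs
    · exact one_mem _
    · exact zero_mem _
  | algebraMap c => rw [Derivation.map_algebraMap]; exact zero_mem _
  | add f g _ _ h1 h2 => rw [map_add]; exact add_mem h1 h2
  | mul f g hf hg h1 h2 =>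
    rw [Derivation.leibniz]
    exact add_mem (mul_mem hf h2) (mul_mem hg h1)

/-- The harmonic polynomials that are homogeneous of degree `d`. The degree is an integer,
so that differentiation lowers it in all cases. -/
def harm (d : ℤ) : Submodule ℂ ZhAlg where
  carrier := {f | f ∈ polyA ∧ boxA f = 0 ∧ eulerD f = (d : ℂ) • f}
  add_mem' := by
    rintro f g ⟨h1, h2, h3⟩ ⟨h4, h5, h6⟩
    exact ⟨add_mem h1 h4, by rw [map_add, h2, h5, add_zero], by rw [map_add, h3, h6, smul_add]⟩
  zero_mem' := ⟨zero_mem _, map_zero _, by simp⟩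
  smul_mem' := by
    rintro c f ⟨h1, h2, h3⟩
    exact ⟨polyA.smul_mem h1 c, by rw [map_smul, h2, smul_zero],
      by rw [Derivation.map_smul, h3, smul_comm]⟩

theorem boxA_pdD (i j : Fin 2) (f : ZhAlg) : boxA (pdD i j f) = pdD i j (boxA f) := by
  have h6 : pdD i j (4 : ZhAlg) = 0 := by
    simpa using (pdD i j).map_natCast 4
  rw [boxA_apply, boxA_apply, Derivation.leibniz, h6, smul_zero, add_zero, map_sub,
    pdD_comm i j 0 0, pdD_comm i j 0 1, pdD_comm i j 1 1, pdD_comm i j 1 0, smul_eq_mul]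

theorem pdD_mem_harm (i j : Fin 2) {d : ℤ} {f : ZhAlg} (hf : f ∈ harm d) : pdD i j f ∈ harm (d - 1) := by
  obtain ⟨h1, h2, h3⟩ := hf
  refine ⟨pdD_mem_polyA i j h1, ?_, ?_⟩
  · rw [boxA_pdD, h2, map_zero]
  · rw [pdD_eulerD, h3, Derivation.map_smul]
    push_cast
    rw [sub_smul, one_smul]

/-- The derivative in the direction `B`. -/
def dirD (B : HC) : Derivation ℂ ZhAlg ZhAlg := ∑ i, ∑ j, B i j • pdD i j

theorem dirD_apply (B : HC) (f : ZhAlg) : dirD B f = B 0 0 • pdD 0 0 f + B 0 1 • pdD 0 1 f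
    + (B 1 0 • pdD 1 0 f + B 1 1 • pdD 1 1 f) := by
  simp [dirD, Fin.sum_univ_two]

theorem dirD_mem_harm (B : HC) {d : ℤ} {f : ZhAlg} (hf : f ∈ harm d) : dirD B f ∈ harm (d - 1) := by
  rw [dirD_apply]
  have h := fun i j => Submodule.smul_mem _ (B i j) (pdD_mem_harm i j hf)
  exact add_mem (add_mem (h 0 0) (h 0 1)) (add_mem (h 1 0) (h 1 1))

theorem dirD_mem_polyA (B : HC) {f : ZhAlg} (hf : f ∈ polyA) : dirD B f ∈ polyA := by
  rw [dirD_apply]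
  have h := fun i j => polyA.smul_mem (pdD_mem_polyA i j hf) (B i j)
  exact add_mem (add_mem (h 0 0) (h 0 1)) (add_mem (h 1 0) (h 1 1))

theorem trw_mem_polyA (B : HC) : trw B ∈ polyA := by
  have h := fun i j (c : ℂ) => polyA.smul_mem (zc_mem_polyA i j) c
  exact add_mem (sub_mem (sub_mem (h _ _ _) (h _ _ _)) (h _ _ _)) (h _ _ _)

theorem pdD_trw (B : HC) : pdD 0 0 (trw B) = algebraMap ℂ ZhAlg (B 1 1) ∧
    pdD 1 1 (trw B) = algebraMap ℂ ZhAlg (B 0 0) ∧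
    pdD 0 1 (trw B) = -algebraMap ℂ ZhAlg (B 1 0) ∧ pdD 1 0 (trw B) = -algebraMap ℂ ZhAlg (B 0 1) := by
  refine ⟨?_, ?_, ?_, ?_⟩ <;> simp [trw, pdD_zc, Algebra.smul_def]

theorem eulerD_trw (B : HC) : eulerD (trw B) = trw B := by
  simp only [trw, map_add, map_sub, Derivation.map_smul, eulerD_zc]

/-- The leading part of `tr(Z♯ B) f` in its decomposition into harmonic polynomials times
powers of the norm. -/
theorem trw_mul_sub_mem_harm (B : HC) {d : ℤ} {f : ZhAlg} (hf : f ∈ harm d) :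
    (d + 1 : ℂ) • (trw B * f) - (nu : ZhAlg) * dirD B f ∈ harm (d + 1) := by
  have hD := dirD_mem_harm B hf
  obtain ⟨h1, h2, h3⟩ := hf
  obtain ⟨g1, g2, g3⟩ := hD
  refine ⟨sub_mem (polyA.smul_mem (mul_mem (trw_mem_polyA B) h1) _) (mul_mem nu_mem_polyA g1), ?_, ?_⟩
  · have h4 : boxA (trw B) = 0 := by
      obtain ⟨-, h11, -, h10⟩ := pdD_trw B
      simp [boxA_apply, h11, h10]
    have h5 := boxA_mul_nu_zpow g3 1
    obtain ⟨t00, t11, t01, t10⟩ := pdD_trw B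
    rw [map_sub, map_smul, boxA_mul, h2, h4, t00, t11, t01, t10]
    rw [g2, zpow_one, sub_self, zpow_zero, mul_comm (dirD B f)] at h5
    rw [h5]
    rw [dirD_apply]
    simp only [Algebra.smul_def, map_mul, map_add, map_one, map_intCast, map_ofNat, Units.val_one]
    push_cast
    simp
    ring
  · rw [map_sub, Derivation.map_smul, Derivation.leibniz, Derivation.leibniz, eulerD_trw, eulerD_nu, h3, g3]
    simp only [smul_eq_mul, Algebra.smul_def, map_add, map_one, map_intCast]
    push_cast
    ring

/-- The powers of isotropic linear forms are harmonic. -/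
theorem trw_pow_mem_harm {Y : HC} (hY : N Y = 0) (d : ℕ) : trw Y ^ d ∈ harm d := by
  refine ⟨pow_mem (trw_mem_polyA Y) d, ?_, ?_⟩
  · obtain ⟨h00, h11, h01, h10⟩ := pdD_trw Y
    have hN : algebraMap ℂ ZhAlg (Y 0 0) * algebraMap ℂ ZhAlg (Y 1 1)
        = algebraMap ℂ ZhAlg (Y 0 1) * algebraMap ℂ ZhAlg (Y 1 0) := by
      rw [← map_mul, ← map_mul, sub_eq_zero.1 hY]
    rcases d with _ | _ | d
    · simp [boxA_apply]
    · simp [boxA_apply, h11, h10]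
    · simp only [boxA_apply, Derivation.leibniz_pow, h11, h10, h00, h01, Derivation.leibniz,
        Derivation.map_algebraMap, map_neg, smul_eq_mul, nsmul_eq_mul, mul_zero, neg_zero, zero_add,
        add_zero, Derivation.map_natCast]
      simp only [Nat.add_sub_cancel]
      linear_combination (4 * ((d + 1 + 1 : ℕ) : ZhAlg) * ((d + 1 : ℕ) : ZhAlg) * trw Y ^ d) * hN
  · rw [Derivation.leibniz_pow, eulerD_trw]
    rcases d with _ | d
    · simp
    · rw [Nat.add_sub_cancel, smul_eq_mul, ← pow_succ, ← Nat.cast_smul_eq_nsmul ℂ]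
      simp

theorem tau_mem_harm (p q r : ℕ) : tau p q r ∈ harm (p + q : ℕ) := by
  refine Submodule.span_le.2 ?_ (tau_mem_span_trw p q r)
  rintro f ⟨Y, hY, rfl⟩
  exact trw_pow_mem_harm hY _

theorem boxA_tauFn (i : TauIndex) : boxA (tauFn i) = (4 * i.pow * (i.pow + 1 + i.deg) : ℂ) •
    tauFn ⟨(i.1.1, i.1.2.1, i.1.2.2.1, i.1.2.2.2 - 1), i.2⟩ := by
  obtain ⟨-, h2, h3⟩ := tau_mem_harm i.1.1 i.1.2.1 i.1.2.2.1
  rw [tauFn, boxA_mul_nu_zpow h3, h2, zero_mul, zero_add]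
  rfl

theorem eulerD_tauFn (i : TauIndex) : eulerD (tauFn i) = (i.deg + 2 * i.pow : ℂ) • tauFn i := by
  obtain ⟨-, -, h3⟩ := tau_mem_harm i.1.1 i.1.2.1 i.1.2.2.1
  rw [tauFn, Derivation.leibniz, h3, eulerD_nu_zpow, smul_eq_mul, smul_eq_mul]
  simp only [TauIndex.pow, TauIndex.deg, Algebra.smul_def, map_mul, map_add, map_natCast, map_intCast,
    map_ofNat]
  push_cast
  ring

/-- The harmonic polynomials are spanned by the matrix coefficients. -/
theorem mem_tauSpanP_of_box_eq_zero {f : ZhAlg} (hf : f ∈ polyA) (hb : boxA f = 0) :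
    f ∈ tauSpanP fun _ k => k = 0 := by
  rw [mem_tauSpanP]
  intro i hi
  have h0 : 0 ≤ i.pow := by
    have hf' : f ∈ Subalgebra.toSubmodule polyA := hf
    rw [polyA_eq_tauSpanP, mem_tauSpanP] at hf'
    exact hf' i hi
  have h := repr_mul_eq_zero boxA (fun i => ⟨(i.1.1, i.1.2.1, i.1.2.2.1, i.1.2.2.2 - 1), i.2⟩) (by
    rintro ⟨⟨p, q, r, k⟩, h⟩ ⟨⟨p', q', r', k'⟩, h'⟩ e
    simp only [Subtype.mk.injEq, Prod.mk.injEq, sub_left_inj] at e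
    simpa only [Subtype.mk.injEq, Prod.mk.injEq] using e) _ boxA_tauFn hb i
  have h2 := (mul_eq_zero.1 h).resolve_left hi
  have h3 : 4 * i.pow * (i.pow + 1 + i.deg) = 0 := by exact_mod_cast h2
  rcases mul_eq_zero.1 h3 with h4 | h4 <;> omega

theorem mem_tauSpanP_of_mem_harm {d : ℤ} {f : ZhAlg} (hf : f ∈ harm d) :
    f ∈ tauSpanP fun n k => (n : ℤ) = d ∧ k = 0 := by
  have h0 := mem_tauSpanP_of_box_eq_zero hf.1 hf.2.1
  rw [mem_tauSpanP] at h0 ⊢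
  intro i hi
  refine ⟨?_, h0 i hi⟩
  have h := repr_mul_eq_zero ((eulerD : ZhAlg →ₗ[ℂ] ZhAlg) - (d : ℂ) • LinearMap.id) id
    Function.injective_id (fun i => (i.deg + 2 * i.pow - d : ℂ)) (fun i => by
      rw [LinearMap.sub_apply, sub_smul]
      congr 1
      exact eulerD_tauFn i) (f := f) (by
      rw [LinearMap.sub_apply]
      exact sub_eq_zero.2 hf.2.2) i
  have h2 := (mul_eq_zero.1 h).resolve_left hi
  rw [h0 i hi] at h2
  have h3 : (i.deg : ℤ) + 2 * 0 - d = 0 := by exact_mod_cast h2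
  omega

theorem harm_mul_mem_tauSpanP {P : ℕ → ℤ → Prop} {d k : ℤ} {f : ZhAlg} (hf : f ∈ harm d)
    (h : ∀ n : ℕ, (n : ℤ) = d → P n k) : f * ((nu ^ k : ZhAlgˣ) : ZhAlg) ∈ tauSpanP P := by
  have h1 := mem_tauSpanP_of_mem_harm hf
  have h2 : (tauSpanP fun n k => (n : ℤ) = d ∧ k = 0) ≤
      (tauSpanP P).comap (LinearMap.mulRight ℂ ((nu ^ k : ZhAlgˣ) : ZhAlg)) := by
    refine Submodule.span_le.2 ?_
    rintro f ⟨i, ⟨hi, hi0⟩, rfl⟩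
    have h0 : i.1.2.2.2 = 0 := hi0
    simp only [Submodule.comap_coe, Set.mem_preimage, LinearMap.mulRight_apply, SetLike.mem_coe]
    rw [tauBasis_apply, tauFn, h0, zpow_zero, Units.val_one, mul_one]
    exact tau_mul_mem_tauSpanP (h _ hi) _
  exact h2 h1

/-! ### The Lie algebra actions on `ZhAlg` -/

/-- The matrix of the coordinate functions. -/
def zmat : Matrix (Fin 2) (Fin 2) ZhAlg := Matrix.of zc

/-- A constant matrix, as a matrix of functions. -/
def cmat : HC →ₐ[ℂ] Matrix (Fin 2) (Fin 2) ZhAlg := (Algebra.ofId ℂ ZhAlg).mapMatrix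

theorem cmat_apply (A : HC) (i j : Fin 2) : cmat A i j = algebraMap ℂ ZhAlg (A i j) := rfl

theorem zmat_apply (i j : Fin 2) : zmat i j = zc i j := rfl

/-- The vector field `-AZ - B + ZCZ + ZD` that generates the conformal action of `exp(-tX)`,
for `X` with blocks `A, B, C, D`. -/
def vfield : gl2HC →ₗ[ℂ] Matrix (Fin 2) (Fin 2) ZhAlg where
  toFun X := -(cmat X.toBlocks₁₁ * zmat) - cmat X.toBlocks₁₂ + zmat * cmat X.toBlocks₂₁ * zmat
    + zmat * cmat X.toBlocks₂₂
  map_add' X Y := by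
    have h : (X + Y).toBlocks₁₁ = X.toBlocks₁₁ + Y.toBlocks₁₁ ∧
      (X + Y).toBlocks₁₂ = X.toBlocks₁₂ + Y.toBlocks₁₂ ∧
      (X + Y).toBlocks₂₁ = X.toBlocks₂₁ + Y.toBlocks₂₁ ∧
      (X + Y).toBlocks₂₂ = X.toBlocks₂₂ + Y.toBlocks₂₂ := ⟨rfl, rfl, rfl, rfl⟩
    simp only [h, map_add]
    noncomm_ring
  map_smul' c X := by
    have h : (c • X).toBlocks₁₁ = c • X.toBlocks₁₁ ∧ (c • X).toBlocks₁₂ = c • X.toBlocks₁₂ ∧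
      (c • X).toBlocks₂₁ = c • X.toBlocks₂₁ ∧ (c • X).toBlocks₂₂ = c • X.toBlocks₂₂ :=
      ⟨rfl, rfl, rfl, rfl⟩
    simp only [h, map_smul, RingHom.id_apply, smul_add, smul_sub, smul_neg, Matrix.smul_mul,
      Matrix.mul_smul]

theorem vfield_apply (X : gl2HC) : vfield X = -(cmat X.toBlocks₁₁ * zmat) - cmat X.toBlocks₁₂
    + zmat * cmat X.toBlocks₂₁ * zmat + zmat * cmat X.toBlocks₂₂ := rfl

/-- The function `tr(CZ + D)`, for `X` with blocks `A, B, C, D`. -/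
def kappa : gl2HC →ₗ[ℂ] ZhAlg where
  toFun X := (cmat X.toBlocks₂₁ * zmat + cmat X.toBlocks₂₂).trace
  map_add' X Y := by
    have h : (X + Y).toBlocks₂₁ = X.toBlocks₂₁ + Y.toBlocks₂₁ ∧
      (X + Y).toBlocks₂₂ = X.toBlocks₂₂ + Y.toBlocks₂₂ := ⟨rfl, rfl⟩
    simp only [h, map_add, add_mul, Matrix.trace_add]
    ring
  map_smul' c X := by
    have h : (c • X).toBlocks₂₁ = c • X.toBlocks₂₁ ∧ (c • X).toBlocks₂₂ = c • X.toBlocks₂₂ :=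
      ⟨rfl, rfl⟩
    simp only [h, map_smul, RingHom.id_apply, Matrix.smul_mul, ← smul_add, Matrix.trace_smul]

theorem kappa_apply (X : gl2HC) :
    kappa X = (cmat X.toBlocks₂₁ * zmat + cmat X.toBlocks₂₂).trace := rfl

/-- The derivation of `ZhAlg` given by the vector field `vfield X`. -/
def vder : gl2HC →ₗ[ℂ] Derivation ℂ ZhAlg ZhAlg where
  toFun X := ∑ i, ∑ j, vfield X i j • pdD i j
  map_add' X Y := by
    simp only [map_add, Matrix.add_apply, add_smul, Finset.sum_add_distrib]
  map_smul' c X := by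
    simp only [map_smul, Matrix.smul_apply, smul_assoc, RingHom.id_apply, Finset.smul_sum]

theorem vder_apply (X : gl2HC) (f : ZhAlg) : vder X f =
    vfield X 0 0 * pdD 0 0 f + vfield X 0 1 * pdD 0 1 f
      + (vfield X 1 0 * pdD 1 0 f + vfield X 1 1 * pdD 1 1 f) := by
  simp [vder, Fin.sum_univ_two]

theorem vder_zc (X : gl2HC) (i j : Fin 2) : vder X (zc i j) = vfield X i j := by
  rw [vder_apply]
  fin_cases i <;> fin_cases j <;> simp [pdD_zc]

theorem map_derivation_mul (D : Derivation ℂ ZhAlg ZhAlg) (P Q : Matrix (Fin 2) (Fin 2) ZhAlg) :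
    (P * Q).map D = P.map D * Q + P * Q.map D := by
  ext1 i j
  simp only [Matrix.map_apply, Matrix.mul_apply, Matrix.add_apply, Fin.sum_univ_two, map_add,
    Derivation.leibniz, smul_eq_mul]
  ring

theorem map_derivation_cmat (D : Derivation ℂ ZhAlg ZhAlg) (A : HC) : (cmat A).map D = 0 := by
  ext1 i j
  rw [Matrix.map_apply, cmat_apply, D.map_algebraMap, Matrix.zero_apply]

theorem map_vder_zmat (X : gl2HC) : zmat.map (vder X) = vfield X := by
  ext1 i j
  rw [Matrix.map_apply, zmat_apply, vder_zc]

theorem map_vder_vfield (X Y : gl2HC) : (vfield Y).map (vder X) =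
    -(cmat Y.toBlocks₁₁ * vfield X) + (vfield X * cmat Y.toBlocks₂₁ * zmat
      + zmat * cmat Y.toBlocks₂₁ * vfield X) + vfield X * cmat Y.toBlocks₂₂ := by
  have hadd := fun P Q : Matrix (Fin 2) (Fin 2) ZhAlg =>
    Matrix.map_add (vder X) (fun a b => map_add _ a b) P Q
  have hsub := fun P Q : Matrix (Fin 2) (Fin 2) ZhAlg =>
    Matrix.map_sub (vder X) (fun a b => map_sub _ a b) P Q
  have hneg : ∀ P : Matrix (Fin 2) (Fin 2) ZhAlg, (-P).map (vder X) = -P.map (vder X) := fun P => by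
    ext1 i j
    simp
  rw [vfield_apply Y, hadd, hadd, hsub, hneg]
  simp only [map_derivation_mul, map_derivation_cmat, map_vder_zmat]
  noncomm_ring

theorem toBlocks_lie (X Y : gl2HC) :
    ⁅X, Y⁆.toBlocks₁₁ = X.toBlocks₁₁ * Y.toBlocks₁₁ + X.toBlocks₁₂ * Y.toBlocks₂₁
      - (Y.toBlocks₁₁ * X.toBlocks₁₁ + Y.toBlocks₁₂ * X.toBlocks₂₁) ∧
    ⁅X, Y⁆.toBlocks₁₂ = X.toBlocks₁₁ * Y.toBlocks₁₂ + X.toBlocks₁₂ * Y.toBlocks₂₂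
      - (Y.toBlocks₁₁ * X.toBlocks₁₂ + Y.toBlocks₁₂ * X.toBlocks₂₂) ∧
    ⁅X, Y⁆.toBlocks₂₁ = X.toBlocks₂₁ * Y.toBlocks₁₁ + X.toBlocks₂₂ * Y.toBlocks₂₁
      - (Y.toBlocks₂₁ * X.toBlocks₁₁ + Y.toBlocks₂₂ * X.toBlocks₂₁) ∧
    ⁅X, Y⁆.toBlocks₂₂ = X.toBlocks₂₁ * Y.toBlocks₁₂ + X.toBlocks₂₂ * Y.toBlocks₂₂
      - (Y.toBlocks₂₁ * X.toBlocks₁₂ + Y.toBlocks₂₂ * X.toBlocks₂₂) := by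
  have h : ⁅X, Y⁆ = X * Y - Y * X := rfl
  refine ⟨?_, ?_, ?_, ?_⟩ <;> ext1 i j <;>
    simp [h, Matrix.toBlocks₁₁, Matrix.toBlocks₁₂, Matrix.toBlocks₂₁, Matrix.toBlocks₂₂,
      Matrix.mul_apply]

theorem vder_lie (X Y : gl2HC) : vder ⁅X, Y⁆ = ⁅vder X, vder Y⁆ := by
  obtain ⟨h1, h2, h3, h4⟩ := toBlocks_lie X Y
  have h : vfield ⁅X, Y⁆ = (vfield Y).map (vder X) - (vfield X).map (vder Y) := by
    rw [map_vder_vfield, map_vder_vfield]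
    simp only [vfield_apply, h1, h2, h3, h4, map_add, map_sub, map_mul, mul_add, add_mul, mul_sub,
      sub_mul, Matrix.neg_mul, Matrix.mul_neg, mul_assoc]
    abel
  refine derivation_ext fun i j => ?_
  rw [vder_zc, h, Derivation.commutator_apply, vder_zc, vder_zc]
  rfl

theorem vder_kappa (X Y : gl2HC) : vder X (kappa Y) = (cmat Y.toBlocks₂₁ * vfield X).trace := by
  have h : vder X (kappa Y)
      = ((cmat Y.toBlocks₂₁ * zmat).map (vder X) + (cmat Y.toBlocks₂₂).map (vder X)).trace := by
    simp only [kappa_apply, Matrix.trace_fin_two, Matrix.add_apply, Matrix.map_apply, map_add]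
  rw [h, map_derivation_mul, map_derivation_cmat, map_derivation_cmat, map_vder_zmat, zero_mul,
    zero_add, add_zero]

/-- The cocycle condition that makes a vector field plus a multiple of `kappa` a Lie algebra action. -/
theorem kappa_lie (X Y : gl2HC) : kappa ⁅X, Y⁆ = vder X (kappa Y) - vder Y (kappa X) := by
  obtain ⟨-, -, h3, h4⟩ := toBlocks_lie X Y
  rw [vder_kappa, vder_kappa]
  simp only [vfield_apply, kappa_apply, h3, h4, map_add, map_sub, map_mul]
  simp only [Matrix.trace_fin_two, Matrix.mul_apply, Matrix.add_apply, Matrix.sub_apply,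
    Matrix.neg_apply, Fin.sum_univ_two]
  ring

/-- The first order operators `f ↦ vder X f + (α tr(CZ + D) + β tr X) f`. -/
def rep (α β : ℂ) : gl2HC →ₗ⁅ℂ⁆ Module.End ℂ ZhAlg where
  toFun X := (vder X : ZhAlg →ₗ[ℂ] ZhAlg)
    + LinearMap.mulLeft ℂ (α • kappa X + algebraMap ℂ ZhAlg (β * X.trace))
  map_add' X Y := by
    refine LinearMap.ext fun f => ?_
    simp only [LinearMap.add_apply, Derivation.coeFn_coe, LinearMap.mulLeft_apply, map_add,
      Derivation.add_apply, Matrix.trace_add, mul_add, smul_add]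
    ring
  map_smul' c X := by
    refine LinearMap.ext fun f => ?_
    simp only [LinearMap.add_apply, LinearMap.smul_apply, Derivation.coeFn_coe,
      LinearMap.mulLeft_apply, map_smul, Derivation.smul_apply, Matrix.trace_smul, RingHom.id_apply]
    simp only [Algebra.smul_def (A := ZhAlg), smul_eq_mul, map_mul]
    ring
  map_lie' {X Y} := by
    refine LinearMap.ext fun f => ?_
    have ht : Matrix.trace ⁅X, Y⁆ = 0 := by
      rw [Ring.lie_def, Matrix.trace_sub, Matrix.trace_mul_comm, sub_self]
    rw [vder_lie, kappa_lie, ht, Ring.lie_def]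
    simp only [LinearMap.add_apply, LinearMap.sub_apply, Module.End.mul_apply, Derivation.coeFn_coe,
      LinearMap.mulLeft_apply, map_add, Derivation.commutator_apply, Derivation.leibniz,
      Derivation.map_algebraMap, smul_eq_mul, Algebra.smul_def, mul_zero,
      map_zero]
    ring

theorem rep_apply (α β : ℂ) (X : gl2HC) (f : ZhAlg) :
    rep α β X f = vder X f + (α • kappa X + algebraMap ℂ ZhAlg (β * X.trace)) * f := rfl

set_option maxRecDepth 4000 in
set_option maxHeartbeats 1000000 in
/-- The operator `□` intertwines two of the actions. -/
theorem boxA_rep (X : gl2HC) (f : ZhAlg) : boxA (rep 1 0 X f) = rep 3 (-1) X (boxA f) := by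
  have ht : X.trace = X.toBlocks₁₁ 0 0 + X.toBlocks₁₁ 1 1 + (X.toBlocks₂₂ 0 0 + X.toBlocks₂₂ 1 1) := by
    simp [Matrix.trace, Fin.sum_univ_two, Matrix.toBlocks₁₁, Matrix.toBlocks₂₂]
  rw [rep_apply, rep_apply, vder_apply, vder_apply, ht]
  simp only [vfield_apply, kappa_apply]
  generalize X.toBlocks₁₁ = A
  generalize X.toBlocks₁₂ = B
  generalize X.toBlocks₂₁ = C
  generalize X.toBlocks₂₂ = D
  simp only [Matrix.trace_fin_two, Matrix.mul_apply, Matrix.add_apply, Matrix.sub_apply,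
    Matrix.neg_apply, Fin.sum_univ_two, cmat_apply, zmat_apply, map_add, boxA_mul, boxA_pdD]
  generalize pdD 0 0 (boxA f) = b00
  generalize pdD 0 1 (boxA f) = b01
  generalize pdD 1 0 (boxA f) = b10
  generalize pdD 1 1 (boxA f) = b11
  simp only [boxA_apply]
  simp [Derivation.leibniz, pdD_zc, Algebra.smul_def]
  rw [pdD_comm 1 1 0 0, pdD_comm 1 0 0 0, pdD_comm 0 1 0 0, pdD_comm 1 0 0 1, pdD_comm 1 1 0 1,
    pdD_comm 1 1 1 0]
  generalize pdD 0 0 (pdD 0 1 f) = f1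
  generalize pdD 0 0 (pdD 1 0 f) = f2
  generalize pdD 0 0 (pdD 1 1 f) = f3
  generalize pdD 0 1 (pdD 1 0 f) = f4
  generalize pdD 0 1 (pdD 1 1 f) = f5
  generalize pdD 1 0 (pdD 1 1 f) = f6
  have h3 : algebraMap ℂ ZhAlg 3 = 3 := map_ofNat _ 3
  rw [h3]
  ring

/-! ### Differentiation of the group actions -/

theorem expGL_inv (X : gl2HC) : (expGL X)⁻¹ = expGL (-X) :=
  Units.ext (by rw [Matrix.coe_units_inv]; exact (Matrix.exp_neg X).symm)

section MatrixNorm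

attribute [local instance] Matrix.linftyOpNormedRing Matrix.linftyOpNormedAlgebra

/-- The derivative at `0` of a linear expression in `exp(tX)`. -/
theorem hasDerivAt_linearMap_expGL {V : Type} [NormedAddCommGroup V] [NormedSpace ℂ V]
    (L : gl2HC →ₗ[ℂ] V) (X : gl2HC) :
    HasDerivAt (fun t : ℂ => L (expGL (t • X) : gl2HC)) (L X) 0 := by
  have h : HasDerivAt (fun t : ℂ => NormedSpace.exp (t • X)) X 0 := by
    have h' := hasDerivAt_exp_smul_const X (0 : ℂ)
    rw [zero_smul, NormedSpace.exp_zero, one_mul] at h'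
    exact h'
  exact (LinearMap.toContinuousLinearMap L).hasFDerivAt.comp_hasDerivAt (0 : ℂ) h

/-- The linear map `X ↦ AZ + B` on matrices with blocks `A, B, C, D`. -/
def blockNum (Z : HC) : gl2HC →ₗ[ℂ] HC where
  toFun X := X.toBlocks₁₁ * Z + X.toBlocks₁₂
  map_add' X Y := by
    change (X.toBlocks₁₁ + Y.toBlocks₁₁) * Z + (X.toBlocks₁₂ + Y.toBlocks₁₂) = _
    noncomm_ring
  map_smul' c X := by
    change (c • X.toBlocks₁₁) * Z + c • X.toBlocks₁₂ = _
    rw [RingHom.id_apply, smul_add, Matrix.smul_mul]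

/-- The linear map `X ↦ CZ + D` on matrices with blocks `A, B, C, D`. -/
def blockDen (Z : HC) : gl2HC →ₗ[ℂ] HC where
  toFun X := X.toBlocks₂₁ * Z + X.toBlocks₂₂
  map_add' X Y := by
    change (X.toBlocks₂₁ + Y.toBlocks₂₁) * Z + (X.toBlocks₂₂ + Y.toBlocks₂₂) = _
    noncomm_ring
  map_smul' c X := by
    change (c • X.toBlocks₂₁) * Z + c • X.toBlocks₂₂ = _
    rw [RingHom.id_apply, smul_add, Matrix.smul_mul]

/-- The linear map `X ↦ A - ZC` on matrices with blocks `A, B, C, D`. -/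
def blockLeft (Z : HC) : gl2HC →ₗ[ℂ] HC where
  toFun X := X.toBlocks₁₁ - Z * X.toBlocks₂₁
  map_add' X Y := by
    change (X.toBlocks₁₁ + Y.toBlocks₁₁) - Z * (X.toBlocks₂₁ + Y.toBlocks₂₁) = _
    noncomm_ring
  map_smul' c X := by
    change c • X.toBlocks₁₁ - Z * (c • X.toBlocks₂₁) = _
    rw [RingHom.id_apply, smul_sub, Matrix.mul_smul]

theorem toBlocks_one : (1 : gl2HC).toBlocks₁₁ = 1 ∧ (1 : gl2HC).toBlocks₁₂ = 0 ∧
    (1 : gl2HC).toBlocks₂₁ = 0 ∧ (1 : gl2HC).toBlocks₂₂ = 1 := by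
  rw [← Matrix.fromBlocks_one]
  simp only [Matrix.toBlocks_fromBlocks₁₁, Matrix.toBlocks_fromBlocks₁₂,
    Matrix.toBlocks_fromBlocks₂₁, Matrix.toBlocks_fromBlocks₂₂, and_self]

theorem expGL_zero_smul (X : gl2HC) : expGL ((0 : ℂ) • X) = 1 :=
  Units.ext (by
    change NormedSpace.exp ((0 : ℂ) • X) = 1
    rw [zero_smul, NormedSpace.exp_zero])

theorem blockNum_expGL_zero (Z : HC) (X : gl2HC) : blockNum Z (expGL ((0 : ℂ) • X) : gl2HC) = Z := by
  obtain ⟨h1, h2, -, -⟩ := toBlocks_one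
  rw [expGL_zero_smul]
  change (1 : gl2HC).toBlocks₁₁ * Z + (1 : gl2HC).toBlocks₁₂ = Z
  rw [h1, h2, one_mul, add_zero]

theorem blockDen_expGL_zero (Z : HC) (X : gl2HC) : blockDen Z (expGL ((0 : ℂ) • X) : gl2HC) = 1 := by
  obtain ⟨-, -, h3, h4⟩ := toBlocks_one
  rw [expGL_zero_smul]
  change (1 : gl2HC).toBlocks₂₁ * Z + (1 : gl2HC).toBlocks₂₂ = 1
  rw [h3, h4, zero_mul, zero_add]

theorem blockLeft_expGL_zero (Z : HC) (X : gl2HC) :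
    blockLeft Z (expGL ((0 : ℂ) • X) : gl2HC) = 1 := by
  obtain ⟨h1, -, h3, -⟩ := toBlocks_one
  rw [expGL_zero_smul]
  change (1 : gl2HC).toBlocks₁₁ - Z * (1 : gl2HC).toBlocks₂₁ = 1
  rw [h1, h3, mul_zero, sub_zero]

theorem mobius_eq (g : GL2HC) (Z : HC) :
    mobius g Z = blockNum Z (g : gl2HC) * Ring.inverse (blockDen Z (g : gl2HC)) := by
  rw [← Matrix.nonsing_inv_eq_ringInverse]
  rfl

/-- The derivative at the identity of the fractional linear action. -/
theorem hasDerivAt_mobius (X : gl2HC) (Z : HC) (i j : Fin 2) :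
    HasDerivAt (fun t : ℂ => mobius (expGL (t • X)) Z i j) ((blockNum Z X - Z * blockDen Z X) i j) 0 := by
  have h1 := hasDerivAt_linearMap_expGL (blockNum Z) X
  have h2 := hasDerivAt_linearMap_expGL (blockDen Z) X
  have h3 : HasFDerivAt Ring.inverse (-ContinuousLinearMap.mulLeftRight ℂ HC 1 1)
      (blockDen Z (expGL ((0 : ℂ) • X) : gl2HC)) := by
    rw [blockDen_expGL_zero]
    simpa using hasFDerivAt_ringInverse (𝕜 := ℂ) (1 : HCˣ)
  have h4 := h1.mul (h3.comp_hasDerivAt (0 : ℂ) h2)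
  have h5 := (LinearMap.toContinuousLinearMap
    (Matrix.entryLinearMap ℂ ℂ i j)).hasFDerivAt.comp_hasDerivAt (0 : ℂ) h4
  refine (h5.congr_deriv ?_).congr_of_eventuallyEq (Filter.Eventually.of_forall fun t => ?_)
  · rw [Function.comp_apply, blockNum_expGL_zero, blockDen_expGL_zero]
    simp [sub_eq_add_neg]
    rfl
  · simp [mobius_eq]

/-- The norm of a linear expression in `exp(tX)` that is the identity matrix at `t = 0`. -/
theorem hasDerivAt_N_expGL (L : gl2HC →ₗ[ℂ] HC) (X : gl2HC)
    (h0 : L (expGL ((0 : ℂ) • X) : gl2HC) = 1) :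
    HasDerivAt (fun t : ℂ => N (L (expGL (t • X) : gl2HC))) (L X).trace 0 := by
  have h := fun i j => hasDerivAt_linearMap_expGL ((Matrix.entryLinearMap ℂ ℂ i j).comp L) X
  have h2 := ((h 0 0).mul (h 1 1)).sub ((h 0 1).mul (h 1 0))
  refine h2.congr_deriv ?_
  simp only [LinearMap.comp_apply, Matrix.entryLinearMap_apply, h0]
  simp [Matrix.trace_fin_two]

end MatrixNorm

theorem vfield_coe (X : gl2HC) (Z : HCx) (i j : Fin 2) :
    (vfield X i j : Fn) Z = -(blockNum (Z : HC) X - Z * blockDen (Z : HC) X) i j := by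
  rw [← evalAt_apply]
  simp [vfield_apply, blockNum, blockDen, Matrix.mul_apply, Fin.sum_univ_two, cmat_apply, zmat_apply,
    evalAt_apply, zc_apply]
  ring

theorem kappa_coe (X : gl2HC) (Z : HCx) : (kappa X : Fn) Z = (blockDen (Z : HC) X).trace := by
  rw [← evalAt_apply]
  simp [kappa_apply, blockDen, Matrix.trace_fin_two, Matrix.mul_apply, Fin.sum_univ_two, cmat_apply, zmat_apply,
    evalAt_apply, zc_apply]

theorem hasDerivAt_ext_mobius (X : gl2HC) (f : ZhAlg) (Z : HCx) :
    HasDerivAt (fun t : ℂ => ext f (mobius (expGL (t • X))⁻¹ (Z : HC))) ((vder X f : Fn) Z) 0 := by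
  have h0 : mobius (expGL ((0 : ℂ) • X))⁻¹ (Z : HC) = Z := by
    rw [expGL_inv, ← smul_neg, mobius_eq, blockNum_expGL_zero, blockDen_expGL_zero, Ring.inverse_one,
      mul_one]
  refine (hasDerivAt_ext_curve (f := f)
    (ξ := -(blockNum (Z : HC) X - Z * blockDen (Z : HC) X)) h0 fun i j => ?_).congr_deriv ?_
  · have h := hasDerivAt_mobius (-X) Z i j
    simp only [expGL_inv, ← smul_neg]
    refine h.congr_deriv ?_
    simp only [map_neg, mul_neg, ← neg_sub', Matrix.neg_apply]
  · rw [vder_apply]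
    simp only [add_apply, mul_apply, vfield_coe, Fin.sum_univ_two]
    rfl

theorem autR_eq (g : GL2HC) (Z : HC) : autR g Z = N (blockDen Z (g : gl2HC)) := rfl

theorem autL_eq (g : GL2HC) (Z : HC) : autL g Z = N (blockLeft Z (g : gl2HC)) := rfl

theorem N_one : N 1 = 1 := by simp [N]

theorem hasDerivAt_autR (X : gl2HC) (Z : HCx) :
    HasDerivAt (fun t : ℂ => autR (expGL (t • X))⁻¹ (Z : HC)) (-(kappa X : Fn) Z) 0 := by
  have h := hasDerivAt_N_expGL (blockDen (Z : HC)) (-X) (blockDen_expGL_zero _ _)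
  simp only [expGL_inv, ← smul_neg]
  refine h.congr_deriv ?_
  rw [map_neg, Matrix.trace_neg, kappa_coe]

theorem autR_zero (X : gl2HC) (Z : HC) : autR (expGL ((0 : ℂ) • X))⁻¹ Z = 1 := by
  rw [expGL_inv, ← smul_neg, autR_eq, blockDen_expGL_zero, N_one]

theorem ext_mobius_zero (X : gl2HC) (f : Fn) (Z : HCx) :
    ext f (mobius (expGL ((0 : ℂ) • X))⁻¹ (Z : HC)) = f Z := by
  rw [expGL_inv, ← smul_neg, mobius_eq, blockNum_expGL_zero, blockDen_expGL_zero, Ring.inverse_one,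
    mul_one, ext_coe]

/-- The derivative of the action `π⁰_l`. -/
theorem hasDerivAt_piL (X : gl2HC) (f : ZhAlg) (Z : HCx) :
    HasDerivAt (fun t : ℂ => piL (expGL (t • X)) f Z) ((rep 1 0 X f : Fn) Z) 0 := by
  have h := (hasDerivAt_ext_mobius X f Z).div (hasDerivAt_autR X Z) (by rw [autR_zero]; exact one_ne_zero)
  refine h.congr_deriv ?_
  rw [autR_zero, ext_mobius_zero, rep_apply]
  simp [add_apply, mul_apply]
  ring

/-- The derivative of the action `ϖ₂`. -/
theorem hasDerivAt_varpi (X : gl2HC) (f : ZhAlg) (Z : HCx) :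
    HasDerivAt (fun t : ℂ => varpi 2 (expGL (t • X)) f Z) ((rep 3 (-1) X f : Fn) Z) 0 := by
  have hL := hasDerivAt_N_expGL (blockLeft (Z : HC)) X (blockLeft_expGL_zero _ _)
  have hL0 : autL (expGL ((0 : ℂ) • X)) (Z : HC) = 1 := by rw [autL_eq, blockLeft_expGL_zero, N_one]
  have h := (hasDerivAt_ext_mobius X f Z).div (((hasDerivAt_autR X Z).pow 2).mul hL)
    (by
      rw [Pi.mul_apply, Pi.pow_apply, autR_zero, ← autL_eq, hL0]
      simp)
  refine h.congr_deriv ?_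
  have ht : (blockLeft (Z : HC) X).trace = X.trace - (kappa X : Fn) Z := by
    rw [kappa_coe]
    simp [blockLeft, blockDen, Matrix.trace, Fin.sum_univ_two, Matrix.toBlocks₁₁, Matrix.toBlocks₂₁,
      Matrix.toBlocks₂₂, Matrix.mul_apply]
    ring
  simp only [← autL_eq]
  rw [ht]
  simp only [Pi.mul_apply, Pi.pow_apply, autR_zero, ext_mobius_zero, rep_apply, hL0]
  simp [add_apply, mul_apply, smul_apply]
  ring

/-! ### Invariant subspaces -/

/-- The block diagonal part of a block matrix. -/
def diagPart (X : gl2HC) : gl2HC := Matrix.fromBlocks X.toBlocks₁₁ 0 0 X.toBlocks₂₂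

/-- The vector field of `X` is the sum of a linear, a constant and a quadratic one. The quadratic
one is `ZCZ = tr(CZ) Z - N(Z) C♯`. -/
theorem vder_eq (X : gl2HC) (f : ZhAlg) : vder X f = vder (diagPart X) f - dirD X.toBlocks₁₂ f
    + (trw X.toBlocks₂₁.adjugate * eulerD f - (nu : ZhAlg) * dirD X.toBlocks₂₁.adjugate f) := by
  rw [vder_apply, vder_apply, dirD_apply, dirD_apply, eulerD_apply]
  simp only [vfield_apply, diagPart, Matrix.toBlocks_fromBlocks₁₁, Matrix.toBlocks_fromBlocks₁₂,
    Matrix.toBlocks_fromBlocks₂₁, Matrix.toBlocks_fromBlocks₂₂, map_zero, zero_mul, mul_zero,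
    add_zero, sub_zero, Matrix.adjugate_fin_two, trw, nu_val]
  simp [Matrix.mul_apply, Fin.sum_univ_two, cmat_apply, zmat_apply, Algebra.smul_def]
  ring

theorem kappa_eq (X : gl2HC) : kappa X = trw X.toBlocks₂₁.adjugate
    + algebraMap ℂ ZhAlg X.toBlocks₂₂.trace := by
  simp [kappa_apply, Matrix.trace_fin_two, Matrix.adjugate_fin_two, trw, Matrix.mul_apply,
    Fin.sum_univ_two, cmat_apply, zmat_apply, Algebra.smul_def]
  ring

theorem trace_eq (X : gl2HC) : X.trace = X.toBlocks₁₁.trace + X.toBlocks₂₂.trace := by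
  rw [Matrix.trace, Fintype.sum_sum_type]
  rfl

theorem vder_diagPart_nu (X : gl2HC) : vder (diagPart X) (nu : ZhAlg) =
    (X.toBlocks₂₂.trace - X.toBlocks₁₁.trace) • (nu : ZhAlg) := by
  simp only [nu_val, map_sub, Derivation.leibniz, vder_zc, smul_eq_mul]
  simp only [vfield_apply, diagPart, Matrix.toBlocks_fromBlocks₁₁, Matrix.toBlocks_fromBlocks₁₂,
    Matrix.toBlocks_fromBlocks₂₁, Matrix.toBlocks_fromBlocks₂₂, map_zero, zero_mul, mul_zero,
    add_zero, sub_zero]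
  simp [Matrix.mul_apply, Fin.sum_univ_two, cmat_apply, zmat_apply, Algebra.smul_def,
    Matrix.trace_fin_two]
  ring

theorem dirD_nu (B : HC) : dirD B (nu : ZhAlg) = trw B := by
  obtain ⟨h00, h11, h01, h10⟩ := pdD_nu
  rw [dirD_apply, h00, h11, h01, h10, trw]
  simp only [smul_neg]
  ring

theorem vfield_mem_polyA (X : gl2HC) (i j : Fin 2) : vfield X i j ∈ polyA := by
  have hc : ∀ (A : HC) (k l : Fin 2), cmat A k l ∈ polyA := fun A k l => polyA.algebraMap_mem _
  simp only [vfield_apply, Matrix.add_apply, Matrix.sub_apply, Matrix.neg_apply, Matrix.mul_apply,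
    Fin.sum_univ_two, zmat_apply]
  have hz := zc_mem_polyA
  exact add_mem (add_mem (sub_mem (neg_mem (add_mem (mul_mem (hc _ _ _) (hz _ _))
    (mul_mem (hc _ _ _) (hz _ _)))) (hc _ _ _)) (add_mem
    (mul_mem (add_mem (mul_mem (hz _ _) (hc _ _ _)) (mul_mem (hz _ _) (hc _ _ _))) (hz _ _))
    (mul_mem (add_mem (mul_mem (hz _ _) (hc _ _ _)) (mul_mem (hz _ _) (hc _ _ _))) (hz _ _))))
    (add_mem (mul_mem (hz _ _) (hc _ _ _)) (mul_mem (hz _ _) (hc _ _ _)))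

theorem vder_mem_polyA (X : gl2HC) {f : ZhAlg} (hf : f ∈ polyA) : vder X f ∈ polyA := by
  rw [vder_apply]
  have h := fun i j => mul_mem (vfield_mem_polyA X i j) (pdD_mem_polyA i j hf)
  exact add_mem (add_mem (h _ _) (h _ _)) (add_mem (h _ _) (h _ _))

theorem rep_mem_polyA (α β : ℂ) (X : gl2HC) {f : ZhAlg} (hf : f ∈ polyA) : rep α β X f ∈ polyA := by
  rw [rep_apply, kappa_eq]
  exact add_mem (vder_mem_polyA X hf) (mul_mem (add_mem (polyA.smul_mem
    (add_mem (trw_mem_polyA _) (polyA.algebraMap_mem _)) _) (polyA.algebraMap_mem _)) hf)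

theorem vder_diagPart_mem_harm (X : gl2HC) {d : ℤ} {f : ZhAlg} (hf : f ∈ harm d) :
    vder (diagPart X) f ∈ harm d := by
  obtain ⟨h1, h2, h3⟩ := hf
  refine ⟨vder_mem_polyA _ h1, ?_, ?_⟩
  · have h := boxA_rep (diagPart X) f
    have hk : kappa (diagPart X) = algebraMap ℂ ZhAlg X.toBlocks₂₂.trace := by
      rw [kappa_eq]
      simp [diagPart, trw]
    rw [rep_apply, h2, map_zero, map_add, hk, zero_mul, map_zero, add_zero, one_smul,
      ← Algebra.smul_def, map_smul, h2, smul_zero, add_zero] at h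
    exact h
  · have h : ⁅eulerD, vder (diagPart X)⁆ = 0 := by
      refine derivation_ext fun k l => ?_
      rw [Derivation.commutator_apply, eulerD_zc, vder_zc]
      simp only [vfield_apply, diagPart, Matrix.toBlocks_fromBlocks₁₁, Matrix.toBlocks_fromBlocks₁₂,
        Matrix.toBlocks_fromBlocks₂₁, Matrix.toBlocks_fromBlocks₂₂, map_zero, zero_mul, mul_zero,
        add_zero, sub_zero]
      simp [Matrix.mul_apply, Fin.sum_univ_two, cmat_apply, zmat_apply, eulerD_zc,
        Derivation.leibniz]
      ring
    have h2 := congrArg (fun D : Derivation ℂ ZhAlg ZhAlg => D f) h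
    simp only [Derivation.commutator_apply, h3, Derivation.map_smul, Derivation.zero_apply] at h2
    exact sub_eq_zero.1 h2

/-- The action of the form `ϖ₂` on a homogeneous harmonic polynomial times a power of the norm. -/
theorem rep_harm_mul_nu_zpow (X : gl2HC) {d : ℤ} {f : ZhAlg} (hf : f ∈ harm d) (k : ℤ) :
    rep 3 (-1) X (f * ((nu ^ k : ZhAlgˣ) : ZhAlg)) =
      (vder (diagPart X) f + (k * (X.toBlocks₂₂.trace - X.toBlocks₁₁.trace) + 3 * X.toBlocks₂₂.trace
        - X.trace) • f) * ((nu ^ k : ZhAlgˣ) : ZhAlg)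
      - dirD X.toBlocks₁₂ f * ((nu ^ k : ZhAlgˣ) : ZhAlg)
      - (k : ℂ) • (trw X.toBlocks₁₂ * f * ((nu ^ (k - 1) : ZhAlgˣ) : ZhAlg))
      + (d + k + 3 : ℂ) • (trw X.toBlocks₂₁.adjugate * f * ((nu ^ k : ZhAlgˣ) : ZhAlg))
      - dirD X.toBlocks₂₁.adjugate f * ((nu ^ (k + 1) : ZhAlgˣ) : ZhAlg) := by
  obtain ⟨-, -, h3⟩ := hf
  have e1 := nu_mul_zpow k
  have e2 := nu_mul_zpow (k - 1)
  rw [sub_add_cancel] at e2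
  rw [rep_apply, vder_eq, kappa_eq]
  simp only [Derivation.leibniz, derivation_nu_zpow, vder_diagPart_nu, dirD_nu, eulerD_nu, h3,
    smul_eq_mul]
  rw [← e1, ← e2]
  simp only [Algebra.smul_def (A := ZhAlg), map_mul, map_add, map_sub, map_neg, map_one,
    map_ofNat, map_intCast]
  ring

/-- On a harmonic homogeneous `f` the weight-one action splits into a part preserving the degree, a part
lowering it by one and a part raising it by one; each of them is again harmonic. -/
theorem rep_one_harm (X : gl2HC) {d : ℤ} {f : ZhAlg} (hf : f ∈ harm d) :
    rep 1 0 X f = vder (diagPart X) f + X.toBlocks₂₂.trace • f - dirD X.toBlocks₁₂ f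
      + ((d + 1 : ℂ) • (trw X.toBlocks₂₁.adjugate * f) - (nu : ZhAlg) * dirD X.toBlocks₂₁.adjugate f) := by
  obtain ⟨-, -, h3⟩ := hf
  rw [rep_apply, vder_eq, kappa_eq, h3]
  simp only [Algebra.smul_def (A := ZhAlg), map_mul, map_add, map_one, map_intCast, map_zero]
  ring

theorem tauSpanP_induction {P : ℕ → ℤ → Prop} {S : Submodule ℂ ZhAlg} (T : ZhAlg →ₗ[ℂ] ZhAlg)
    (h : ∀ (d : ℕ) (k : ℤ), P d k → ∀ f ∈ harm d, T (f * ((nu ^ k : ZhAlgˣ) : ZhAlg)) ∈ S)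
    {f : ZhAlg} (hf : f ∈ tauSpanP P) : T f ∈ S := by
  have h2 : tauSpanP P ≤ S.comap T := by
    refine Submodule.span_le.2 ?_
    rintro f ⟨i, hi, rfl⟩
    rw [tauBasis_apply]
    exact h i.deg i.pow hi _ (tau_mem_harm _ _ _)
  exact h2 hf

/-- The decomposition of the product of `tr(Z♯ B)` with a homogeneous harmonic polynomial. -/
theorem exists_trw_mul_eq (B : HC) {d : ℕ} {f : ZhAlg} (hf : f ∈ harm d) :
    ∃ g ∈ harm (d + 1), trw B * f = g + (1 / (d + 1 : ℂ)) • ((nu : ZhAlg) * dirD B f) := by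
  have hd : (d + 1 : ℂ) ≠ 0 := by exact_mod_cast d.succ_ne_zero
  have h := trw_mul_sub_mem_harm B hf
  refine ⟨(1 / (d + 1 : ℂ)) • ((d + 1 : ℂ) • (trw B * f) - (nu : ZhAlg) * dirD B f), ?_, ?_⟩
  · refine Submodule.smul_mem _ _ ?_
    simpa using h
  · rw [smul_sub, smul_smul, one_div, inv_mul_cancel₀ hd, one_smul, sub_add_cancel]

/-- The span of the `t^l_{n m} N^k` with `k ≤ -2` is invariant under `ϖ₂`. In the image of
`f N^k` the coefficient of `N^(k+1)` contains the factor `k + 2`. -/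
theorem rep_mem_tauSpanP_le (X : gl2HC) {f : ZhAlg} (hf : f ∈ tauSpanP fun _ k => k ≤ -2) :
    rep 3 (-1) X f ∈ tauSpanP fun _ k => k ≤ -2 := by
  refine tauSpanP_induction (rep 3 (-1) X) (fun d k hk f hf => ?_) hf
  have hd : (d + 1 : ℂ) ≠ 0 := by exact_mod_cast d.succ_ne_zero
  obtain ⟨g, hg, hgB⟩ := exists_trw_mul_eq X.toBlocks₁₂ hf
  obtain ⟨h, hh, hhC⟩ := exists_trw_mul_eq X.toBlocks₂₁.adjugate hf
  rw [rep_harm_mul_nu_zpow X hf, hgB, hhC]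
  have e1 := nu_mul_zpow k
  have e2 := nu_mul_zpow (k - 1)
  rw [sub_add_cancel] at e2
  have hm : ∀ {e : ℤ} {u : ZhAlg} {m : ℤ}, u ∈ harm e → m ≤ -2 →
      u * ((nu ^ m : ZhAlgˣ) : ZhAlg) ∈ tauSpanP fun _ k => k ≤ -2 := fun hu hm =>
    harm_mul_mem_tauSpanP hu fun _ _ => hm
  have m1 := hm (add_mem (vder_diagPart_mem_harm X hf) (Submodule.smul_mem _
    (k * (X.toBlocks₂₂.trace - X.toBlocks₁₁.trace) + 3 * X.toBlocks₂₂.trace - X.trace) hf)) hk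
  have m2 := hm (dirD_mem_harm X.toBlocks₁₂ hf) hk
  have m3 := hm hg (show k - 1 ≤ -2 by omega)
  have m4 := hm hh hk
  have m5 : (k + 2 : ℂ) • (dirD X.toBlocks₂₁.adjugate f * ((nu ^ (k + 1) : ZhAlgˣ) : ZhAlg)) ∈
      tauSpanP fun _ k => k ≤ -2 := by
    rcases eq_or_ne k (-2) with rfl | hk2
    · norm_num
    · exact Submodule.smul_mem _ _ (hm (dirD_mem_harm X.toBlocks₂₁.adjugate hf) (by omega))
  have key := add_mem (add_mem (sub_mem (sub_mem m1 (Submodule.smul_mem _ (1 + k / (d + 1) : ℂ) m2))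
    (Submodule.smul_mem _ (k : ℂ) m3)) (Submodule.smul_mem _ (d + k + 3 : ℂ) m4))
    (Submodule.smul_mem _ (1 / (d + 1) : ℂ) m5)
  convert key using 1
  have hc : ((d : ℂ) + k + 3) * (1 / (d + 1)) = 1 + 1 / (d + 1) * (k + 2) := by
    field_simp
    ring
  have hc' := congrArg (algebraMap ℂ ZhAlg) hc
  have hk' : (k : ℂ) / (d + 1) = k * (1 / (d + 1)) := by ring
  rw [hk', ← e1, ← e2]
  generalize (1 / (d + 1) : ℂ) = c at hc' ⊢
  simp only [Algebra.smul_def (A := ZhAlg), map_mul, map_add, map_sub, map_one,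
    map_ofNat, map_intCast, map_natCast, Int.cast_natCast] at hc' ⊢
  linear_combination ((nu : ZhAlg) * (nu : ZhAlg) * ((nu ^ (k - 1) : ZhAlgˣ) : ZhAlg) *
    dirD X.toBlocks₂₁.adjugate f) * hc'

/-! ### The map `φ ↦ N⁻¹ (1 + E) φ` -/

/-- The harmonic polynomials. -/
def harmA : Submodule ℂ ZhAlg := Subalgebra.toSubmodule polyA ⊓ LinearMap.ker boxA

/-- The map `φ ↦ N⁻¹ (φ + E φ)`, where `E` is the Euler operator. -/
def degN : ZhAlg →ₗ[ℂ] ZhAlg :=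
  (LinearMap.mulRight ℂ ((nu⁻¹ : ZhAlgˣ) : ZhAlg)).comp (LinearMap.id + (eulerD : ZhAlg →ₗ[ℂ] ZhAlg))

theorem degN_apply (f : ZhAlg) : degN f = (f + eulerD f) * ((nu⁻¹ : ZhAlgˣ) : ZhAlg) := rfl

theorem degN_of_mem_harm {d : ℤ} {f : ZhAlg} (hf : f ∈ harm d) :
    degN f = (d + 1 : ℂ) • (f * ((nu ^ (-1 : ℤ) : ZhAlgˣ) : ZhAlg)) := by
  rw [degN_apply, hf.2.2, zpow_neg_one, ← smul_mul_assoc, add_smul, one_smul, add_comm]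

theorem harm_le_harmA (d : ℤ) : harm d ≤ harmA := fun _ hf => ⟨hf.1, hf.2.1⟩

theorem mem_tauSpanP_of_mem_harmA {f : ZhAlg} (hf : f ∈ harmA) : f ∈ tauSpanP fun _ k => k = 0 :=
  mem_tauSpanP_of_box_eq_zero hf.1 hf.2

theorem rep_one_mem_harmA (X : gl2HC) {f : ZhAlg} (hf : f ∈ harmA) : rep 1 0 X f ∈ harmA :=
  ⟨rep_mem_polyA 1 0 X hf.1, (boxA_rep X f).trans (by rw [LinearMap.mem_ker.1 hf.2, map_zero])⟩

/-- The span of the `t^l_{n m} N^k` with `k ≤ -2`, together with the polynomials. -/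
def sumPlus : Submodule ℂ ZhAlg := (tauSpanP fun _ k => k ≤ -2) ⊔ Subalgebra.toSubmodule polyA

theorem sumPlus_eq : sumPlus = tauSpanP fun _ k => k ≠ -1 := by
  rw [sumPlus, polyA_eq_tauSpanP, tauSpanP, tauSpanP, tauSpanP, ← Submodule.span_union,
    ← Set.image_union]
  congr 2
  ext i
  simp only [Set.mem_union, Set.mem_ofPred_eq]
  omega

theorem rep_mem_sumPlus (X : gl2HC) {f : ZhAlg} (hf : f ∈ sumPlus) : rep 3 (-1) X f ∈ sumPlus := by
  obtain ⟨g, hg, h, hh, rfl⟩ := Submodule.mem_sup.1 hf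
  rw [map_add]
  exact Submodule.add_mem_sup (rep_mem_tauSpanP_le X hg) (rep_mem_polyA 3 (-1) X hh)

/-- Modulo `sumPlus`, the map `φ ↦ N⁻¹ (φ + E φ)` intertwines the two actions. -/
theorem rep_degN_sub_mem (X : gl2HC) {f : ZhAlg} (hf : f ∈ harmA) :
    rep 3 (-1) X (degN f) - degN (rep 1 0 X f) ∈ sumPlus := by
  have h0 := mem_tauSpanP_of_mem_harmA hf
  refine tauSpanP_induction ((rep 3 (-1) X).comp degN - degN.comp (rep 1 0 X))
    (fun d k hk f hf => ?_) h0
  subst hk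
  rw [zpow_zero, Units.val_one, mul_one, LinearMap.sub_apply, LinearMap.comp_apply,
    LinearMap.comp_apply, degN_of_mem_harm hf, map_smul, rep_harm_mul_nu_zpow X hf, rep_one_harm X hf,
    map_add, map_sub, degN_of_mem_harm (trw_mul_sub_mem_harm X.toBlocks₂₁.adjugate hf),
    degN_of_mem_harm (dirD_mem_harm X.toBlocks₁₂ hf),
    degN_of_mem_harm (add_mem (vder_diagPart_mem_harm X hf) (Submodule.smul_mem _ _ hf))]
  have m1 : ((d + 1 : ℂ) • (trw X.toBlocks₁₂ * f) - (nu : ZhAlg) * dirD X.toBlocks₁₂ f)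
      * ((nu ^ (-2 : ℤ) : ZhAlgˣ) : ZhAlg) ∈ sumPlus :=
    Submodule.mem_sup_left (harm_mul_mem_tauSpanP (trw_mul_sub_mem_harm X.toBlocks₁₂ hf)
      fun _ _ => le_rfl)
  have m2 : dirD X.toBlocks₂₁.adjugate f ∈ sumPlus :=
    Submodule.mem_sup_right (dirD_mem_polyA X.toBlocks₂₁.adjugate hf.1)
  convert add_mem m1 m2 using 1
  have e1 : (nu : ZhAlg) * ((nu ^ (-2 : ℤ) : ZhAlgˣ) : ZhAlg) = ((nu ^ (-1 : ℤ) : ZhAlgˣ) : ZhAlg) :=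
    nu_mul_zpow (-2)
  have e2 : (nu : ZhAlg) * ((nu ^ (-1 : ℤ) : ZhAlgˣ) : ZhAlg) = 1 := by
    rw [nu_mul_zpow, neg_add_cancel, zpow_zero, Units.val_one]
  have e3 : ((nu ^ (-1 + 1 : ℤ) : ZhAlgˣ) : ZhAlg) = 1 := by
    rw [neg_add_cancel, zpow_zero, Units.val_one]
  rw [e3, trace_eq, show (-1 - 1 : ℤ) = -2 from rfl]
  simp only [Algebra.smul_def (A := ZhAlg), map_mul, map_add, map_sub, map_one,
    map_neg, map_ofNat, map_natCast, Int.cast_natCast, Int.cast_neg, Int.cast_one, Int.cast_sub,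
    Int.cast_add]
  set u := ((nu ^ (-1 : ℤ) : ZhAlgˣ) : ZhAlg)
  set v := ((nu ^ (-2 : ℤ) : ZhAlgˣ) : ZhAlg)
  linear_combination dirD X.toBlocks₁₂ f * e1 + (d + 2) * dirD X.toBlocks₂₁.adjugate f * e2

theorem degN_tauFn (i : TauIndex) : degN (tauFn i) = (1 + (i.deg + 2 * i.pow) : ℂ) •
    tauFn ⟨(i.1.1, i.1.2.1, i.1.2.2.1, i.1.2.2.2 - 1), i.2⟩ := by
  rw [degN_apply, eulerD_tauFn, add_smul 1, one_smul, tauFn, tauFn, zpow_sub_one, Units.val_mul]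
  simp only [Algebra.smul_def (A := ZhAlg), TauIndex.pow, TauIndex.deg]
  ring

/-- The map `φ ↦ N⁻¹ (φ + E φ)` on harmonic polynomials is injective modulo `sumPlus`. -/
theorem eq_zero_of_degN_mem {f : ZhAlg} (hf : f ∈ harmA) (h : degN f ∈ sumPlus) : f = 0 := by
  have h0 := mem_tauSpanP_of_mem_harmA hf
  have h1 : degN f ∈ tauSpanP fun _ k => k = -1 := by
    refine tauSpanP_induction degN (fun d k hk f hf => ?_) h0
    subst hk
    rw [zpow_zero, Units.val_one, mul_one, degN_of_mem_harm hf]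
    exact Submodule.smul_mem _ _ (harm_mul_mem_tauSpanP hf fun _ _ => rfl)
  rw [sumPlus_eq] at h
  have h2 : degN f = 0 := Submodule.disjoint_def.1
    (disjoint_tauSpanP (P := fun _ k => k = -1) fun _ _ hk hk' => hk' hk) _ h1 h
  refine tauBasis.repr.map_eq_zero_iff.1 (Finsupp.ext fun i => ?_)
  have h3 := repr_mul_eq_zero degN (fun i => ⟨(i.1.1, i.1.2.1, i.1.2.2.1, i.1.2.2.2 - 1), i.2⟩) (by
    rintro ⟨⟨p, q, r, k⟩, h⟩ ⟨⟨p', q', r', k'⟩, h'⟩ e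
    simp only [Subtype.mk.injEq, Prod.mk.injEq, sub_left_inj] at e
    simpa only [Subtype.mk.injEq, Prod.mk.injEq] using e) _ degN_tauFn h2 i
  rw [mem_tauSpanP] at h0
  by_contra hi
  have h4 := (mul_eq_zero.1 h3).resolve_left hi
  rw [h0 i hi, Int.cast_zero, mul_zero, add_zero] at h4
  have h5 : 1 + i.deg = 0 := by exact_mod_cast h4
  omega

/-- Each class modulo `sumPlus` is represented by `N⁻¹ (φ + E φ)` for a harmonic polynomial `φ`,
which is obtained from the class by pairing it with the kernel `1 / N(Z - W)`. -/
theorem exists_harmA (g : ZhAlg) : ∃ f ∈ harmA, ∃ P : MvPolynomial (Fin 2 × Fin 2) ℂ,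
    (∀ Z : HCx, (f : Fn) Z = polyEval P (Z : HC)) ∧ g - degN f ∈ sumPlus ∧
    ∀ (R : ℝ) (hR : 0 < R) (W : HC) (hW : W ∈ DPlus R), polyEval P W = kernelL hR hW g := by
  have hg : g ∈ Submodule.span ℂ (Set.range tauFn) := range_tauFn_span trivial
  induction hg using Submodule.span_induction with
  | zero => exact ⟨0, zero_mem _, 0, by simp [polyEval], by simp, by simp [polyEval]⟩
  | add g₁ g₂ _ _ h1 h2 =>
    obtain ⟨f₁, m1, P₁, a1, b1, c1⟩ := h1
    obtain ⟨f₂, m2, P₂, a2, b2, c2⟩ := h2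
    refine ⟨f₁ + f₂, add_mem m1 m2, P₁ + P₂, fun Z => ?_, ?_, fun R hR W hW => ?_⟩
    · rw [add_apply, a1, a2, polyEval, polyEval, polyEval, map_add]
    · rw [map_add, add_sub_add_comm]
      exact add_mem b1 b2
    · rw [map_add, ← c1, ← c2, polyEval, polyEval, polyEval, map_add]
  | smul c g _ h1 =>
    obtain ⟨f, m, P, a, b, e⟩ := h1
    refine ⟨c • f, Submodule.smul_mem _ c m, c • P, fun Z => ?_, ?_, fun R hR W hW => ?_⟩
    · rw [smul_apply, a, polyEval, polyEval, MvPolynomial.smul_eval]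
    · rw [map_smul, ← smul_sub]
      exact Submodule.smul_mem _ c b
    · rw [map_smul, ← e, polyEval, polyEval, MvPolynomial.smul_eval, smul_eq_mul]
  | mem g hg =>
    obtain ⟨i, rfl⟩ := hg
    obtain ⟨⟨p, q, r, k⟩, hr⟩ := i
    by_cases hk : k = -1
    · subst hk
      have hd : ((p + q : ℕ) + 1 : ℂ) ≠ 0 := by exact_mod_cast (p + q).succ_ne_zero
      have hp : ∀ W : HC, polyEval ((1 / ((p + q : ℕ) + 1 : ℂ)) • tauC (MvPolynomial.X (0, 0))
          (MvPolynomial.X (0, 1)) (MvPolynomial.X (1, 0)) (MvPolynomial.X (1, 1)) p q r) W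
          = 1 / ((p + q : ℕ) + 1 : ℂ) * tcoef p q r W := by
        intro W
        rw [polyEval, MvPolynomial.smul_eval, map_tauC, tcoef_eq_tauC]
        simp
      refine ⟨(1 / ((p + q : ℕ) + 1 : ℂ)) • tau p q r, Submodule.smul_mem _ _
        (harm_le_harmA _ (tau_mem_harm p q r)), _, fun Z => ((hp Z).trans ?_).symm, ?_,
        fun R hR W hW => (hp W).trans ?_⟩
      · rw [smul_apply, tau_apply]
      · rw [map_smul, degN_of_mem_harm (tau_mem_harm p q r), smul_smul, Int.cast_natCast, one_div,
          inv_mul_cancel₀ hd, one_smul]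
        exact (sub_self (tauFn ⟨(p, q, r, -1), hr⟩)).symm ▸ zero_mem _
      · rw [tauFn, kernelL_tau, if_pos rfl]
        push_cast
        ring
    · refine ⟨0, zero_mem _, 0, by simp [polyEval], ?_, fun R hR W hW => ?_⟩
      · rw [map_zero, sub_zero, sumPlus_eq]
        exact tau_mul_mem_tauSpanP hk r
      · rw [tauFn, kernelL_tau, if_neg hk]
        simp [polyEval]

/-! ### The inversion `Z ↦ Z⁻¹` -/

/-- The composition of functions with `Z ↦ Z⁻¹`. -/
def compInv : Fn →ₐ[ℂ] Fn where
  toFun f := fun Z => f Z⁻¹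
  map_one' := rfl
  map_mul' _ _ := rfl
  map_zero' := rfl
  map_add' _ _ := rfl
  commutes' _ := rfl

theorem N_inv (Z : HCx) : N ((Z⁻¹ : HCx) : HC) = (N (Z : HC))⁻¹ := by
  rw [N_eq_det, N_eq_det, Matrix.coe_units_inv, Matrix.det_nonsing_inv, Ring.inverse_eq_inv']

/-- The matrix of the coordinates of `Z⁻¹`. -/
def zinv : Matrix (Fin 2) (Fin 2) ZhAlg := ((nu⁻¹ : ZhAlgˣ) : ZhAlg) • zmat.adjugate

theorem zmat_mul_zinv : zmat * zinv = 1 := by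
  rw [zinv, Matrix.mul_smul, Matrix.mul_adjugate, smul_smul, Matrix.det_fin_two]
  have h : ((nu⁻¹ : ZhAlgˣ) : ZhAlg) * (zmat 0 0 * zmat 1 1 - zmat 0 1 * zmat 1 0) = 1 :=
    nu.inv_mul
  rw [h, one_smul]

theorem zinv_mul_zmat : zinv * zmat = 1 := mul_eq_one_comm.1 zmat_mul_zinv

theorem zinv_apply (Z : HCx) (i j : Fin 2) : (zinv i j : Fn) Z = ((Z⁻¹ : HCx) : HC) i j := by
  rw [Matrix.coe_units_inv, Matrix.inv_def, Ring.inverse_eq_inv', ← N_eq_det, zinv,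
    Matrix.adjugate_fin_two, Matrix.adjugate_fin_two]
  fin_cases i <;> fin_cases j <;> rfl

theorem ZhAlg_le_comap_compInv : ZhAlg ≤ ZhAlg.comap compInv := by
  refine Algebra.adjoin_le ?_
  rintro f (⟨⟨i, j⟩, rfl⟩ | rfl)
  · have h : compInv (coord (i, j)) = (zinv i j : Fn) := funext fun Z => (zinv_apply Z i j).symm
    change compInv _ ∈ ZhAlg
    rw [h]
    exact (zinv i j).2
  · have h : compInv invN = ((nu : ZhAlg) : Fn) := funext fun Z => by
      change (N ((Z⁻¹ : HCx) : HC))⁻¹ = N (Z : HC)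
      rw [N_inv, inv_inv]
    change compInv _ ∈ ZhAlg
    rw [h]
    exact (nu : ZhAlg).2

/-- The map `f(Z) ↦ f(Z⁻¹)` on `ZhAlg`. -/
def invA : ZhAlg →ₐ[ℂ] ZhAlg :=
  (compInv.comp ZhAlg.val).codRestrict ZhAlg fun f => ZhAlg_le_comap_compInv f.2

theorem invA_apply (f : ZhAlg) (Z : HCx) : (invA f : Fn) Z = (f : Fn) Z⁻¹ := rfl

theorem invA_invA (f : ZhAlg) : invA (invA f) = f := by
  ext Z
  rw [invA_apply, invA_apply, inv_inv]

theorem invA_zc (i j : Fin 2) : invA (zc i j) = zinv i j := by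
  ext Z
  rw [invA_apply, zinv_apply, zc_apply]

theorem invA_nu_zpow (k : ℤ) :
    invA ((nu ^ k : ZhAlgˣ) : ZhAlg) = ((nu ^ (-k) : ZhAlgˣ) : ZhAlg) := by
  ext Z
  rw [invA_apply, nu_zpow_apply, nu_zpow_apply, N_inv, inv_zpow, zpow_neg]

theorem map_invA_zmat : zmat.map invA = zinv := by
  ext1 i j
  rw [Matrix.map_apply, zmat_apply, invA_zc]

theorem map_invA_cmat (A : HC) : (cmat A).map invA = cmat A := by
  ext1 i j
  rw [Matrix.map_apply, cmat_apply, invA.commutes]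

/-- The conjugation of block matrices by the inversion interchanges the diagonal blocks
and the off-diagonal blocks. -/
def swapBlocks (X : gl2HC) : gl2HC :=
  Matrix.fromBlocks X.toBlocks₂₂ X.toBlocks₂₁ X.toBlocks₁₂ X.toBlocks₁₁

theorem map_invA_vfield (X : gl2HC) : (vfield (swapBlocks X)).map invA =
    -(cmat X.toBlocks₂₂ * zinv) - cmat X.toBlocks₂₁ + zinv * cmat X.toBlocks₁₂ * zinv
      + zinv * cmat X.toBlocks₁₁ := by
  have h : ∀ P : Matrix (Fin 2) (Fin 2) ZhAlg, P.map invA = invA.mapMatrix P := fun _ => rfl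
  have h1 := map_invA_cmat
  have h2 := map_invA_zmat
  simp only [h] at h1 h2
  rw [h, vfield_apply]
  simp only [swapBlocks, Matrix.toBlocks_fromBlocks₁₁, Matrix.toBlocks_fromBlocks₁₂,
    Matrix.toBlocks_fromBlocks₂₁, Matrix.toBlocks_fromBlocks₂₂, map_add, map_sub, map_neg, map_mul,
    h1, h2]

theorem map_vder_zinv (X : gl2HC) : zinv.map (vder X) = (vfield (swapBlocks X)).map invA := by
  have h1 := map_derivation_mul (vder X) zinv zmat
  have h0 : (1 : Matrix (Fin 2) (Fin 2) ZhAlg).map (vder X) = 0 := by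
    rw [← map_one cmat, map_derivation_cmat]
  rw [zinv_mul_zmat, h0, map_vder_zmat] at h1
  have h2 : zinv.map (vder X) = -(zinv * vfield X * zinv) := by
    have h3 := congrArg (fun P => P * zinv) h1
    simp only [zero_mul, add_mul] at h3
    rw [mul_assoc (zinv.map (vder X)), zmat_mul_zinv, mul_one] at h3
    exact eq_neg_of_add_eq_zero_left h3.symm
  have e2 : ∀ P : Matrix (Fin 2) (Fin 2) ZhAlg, zinv * (zmat * P) = P := fun P => by
    rw [← mul_assoc, zinv_mul_zmat, one_mul]
  rw [h2, map_invA_vfield, vfield_apply]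
  simp only [mul_add, add_mul, mul_sub, sub_mul, Matrix.neg_mul, Matrix.mul_neg, mul_assoc, e2,
    zmat_mul_zinv, mul_one]
  abel

theorem vder_invA (X : gl2HC) (f : ZhAlg) : vder X (invA f) = invA (vder (swapBlocks X) f) := by
  let D : Derivation ℂ ZhAlg ZhAlg := Derivation.mk'
    (invA.toLinearMap ∘ₗ (vder X : ZhAlg →ₗ[ℂ] ZhAlg) ∘ₗ invA.toLinearMap) fun f g => by
      simp only [LinearMap.comp_apply, AlgHom.toLinearMap_apply, map_mul, Derivation.coeFn_coe,
        Derivation.leibniz, smul_eq_mul, map_add, invA_invA]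
  have hD : ∀ f, D f = invA (vder X (invA f)) := fun f => rfl
  have h : D = vder (swapBlocks X) := by
    refine derivation_ext fun i j => ?_
    rw [hD, invA_zc, vder_zc]
    have := congrFun (congrFun (map_vder_zinv X) i) j
    simp only [Matrix.map_apply] at this
    rw [this, invA_invA]
  rw [← h, hD, invA_invA]

theorem vder_nu (X : gl2HC) :
    vder X (nu : ZhAlg) = (kappa X - invA (kappa (swapBlocks X))) * (nu : ZhAlg) := by
  have hk : invA (kappa (swapBlocks X)) = (cmat X.toBlocks₁₂ * zinv + cmat X.toBlocks₁₁).trace := by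
    have h1 := map_invA_cmat
    have h2 := map_invA_zmat
    have h : ∀ P : Matrix (Fin 2) (Fin 2) ZhAlg, P.map invA = invA.mapMatrix P := fun _ => rfl
    simp only [h] at h1 h2
    have h3 : ∀ P : Matrix (Fin 2) (Fin 2) ZhAlg, invA P.trace = (invA.mapMatrix P).trace := fun P => by
      simp [Matrix.trace_fin_two]
    rw [kappa_apply, h3]
    simp only [swapBlocks, Matrix.toBlocks_fromBlocks₂₁, Matrix.toBlocks_fromBlocks₂₂, map_add,
      map_mul, h1, h2]
  have hu : ((nu⁻¹ : ZhAlgˣ) : ZhAlg) * (nu : ZhAlg) = 1 := nu.inv_mul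
  rw [hk, kappa_apply]
  simp only [nu_val, map_sub, Derivation.leibniz, vder_zc, smul_eq_mul] at hu ⊢
  simp only [vfield_apply, zinv, Matrix.adjugate_fin_two, Matrix.trace_fin_two, Matrix.mul_apply,
    Matrix.add_apply, Matrix.sub_apply, Matrix.neg_apply, Fin.sum_univ_two, zmat_apply]
  simp
  generalize ((nu⁻¹ : ZhAlgˣ) : ZhAlg) = u at hu ⊢
  linear_combination ((cmat X.toBlocks₁₂ 0 0 * zc 1 1 - cmat X.toBlocks₁₂ 0 1 * zc 1 0
    - cmat X.toBlocks₁₂ 1 0 * zc 0 1 + cmat X.toBlocks₁₂ 1 1 * zc 0 0)) * hu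

/-- The inversion with the factor of automorphy `N^(-n)` intertwines the actions. -/
theorem rep_invA (n : ℤ) (β : ℂ) (X : gl2HC) (f : ZhAlg) :
    rep n β X (invA f * ((nu ^ (-n) : ZhAlgˣ) : ZhAlg)) =
      invA (rep n β (swapBlocks X) f) * ((nu ^ (-n) : ZhAlgˣ) : ZhAlg) := by
  have ht : (swapBlocks X).trace = X.trace := by
    rw [trace_eq, trace_eq, add_comm]
    rfl
  have e1 := nu_mul_zpow (-n - 1)
  rw [sub_add_cancel] at e1
  rw [rep_apply, rep_apply, ht, Derivation.leibniz, derivation_nu_zpow, vder_nu, vder_invA, ← e1]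
  simp only [map_add, map_mul, map_smul, AlgHom.commutes, smul_eq_mul]
  simp only [Algebra.smul_def (A := ZhAlg), map_intCast, Int.cast_neg, map_neg]
  ring

theorem eulerD_invA (f : ZhAlg) : eulerD (invA f) = -invA (eulerD f) := by
  have h1 : vder (Matrix.fromBlocks 0 0 0 1) = eulerD := derivation_ext fun i j => by
    rw [vder_zc, eulerD_zc, vfield_apply]
    simp [zmat_apply]
  have h2 : vder (Matrix.fromBlocks 1 0 0 0) = -eulerD := derivation_ext fun i j => by
    rw [vder_zc, Derivation.neg_apply, eulerD_zc, vfield_apply]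
    simp [zmat_apply]
  have h := vder_invA (Matrix.fromBlocks 0 0 0 1) f
  rw [h1, swapBlocks, Matrix.toBlocks_fromBlocks₁₁, Matrix.toBlocks_fromBlocks₁₂,
    Matrix.toBlocks_fromBlocks₂₁, Matrix.toBlocks_fromBlocks₂₂, h2, Derivation.neg_apply, map_neg] at h
  exact h

/-- The map `f(Z) ↦ N(Z)^(-n) f(Z⁻¹)`. -/
def invJ (n : ℤ) : ZhAlg →ₗ[ℂ] ZhAlg :=
  (LinearMap.mulRight ℂ ((nu ^ (-n) : ZhAlgˣ) : ZhAlg)).comp invA.toLinearMap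

theorem invJ_apply (n : ℤ) (f : ZhAlg) : invJ n f = invA f * ((nu ^ (-n) : ZhAlgˣ) : ZhAlg) := rfl

theorem invJ_invJ (n : ℤ) (f : ZhAlg) : invJ n (invJ n f) = f := by
  rw [invJ_apply, invJ_apply, map_mul, invA_invA, invA_nu_zpow, mul_assoc, ← Units.val_mul,
    ← zpow_add, neg_neg, add_neg_cancel, zpow_zero, Units.val_one, mul_one]

theorem rep_invJ (n : ℤ) (β : ℂ) (X : gl2HC) (f : ZhAlg) :
    rep n β X (invJ n f) = invJ n (rep n β (swapBlocks X) f) := rep_invA n β X f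

theorem swapBlocks_swapBlocks (X : gl2HC) : swapBlocks (swapBlocks X) = X :=
  Matrix.fromBlocks_toBlocks X

/-- Inversion intertwines `degN` up to sign; this sign is the one in front of the pairing in the formula for
the inverse of the second isomorphism. -/
theorem degN_invJ (f : ZhAlg) : degN (invJ 1 f) = -invJ 3 (degN f) := by
  rw [invJ_apply, invJ_apply, degN_apply, degN_apply, Derivation.leibniz, eulerD_invA, eulerD_nu_zpow,
    map_mul, ← zpow_neg_one, invA_nu_zpow, mul_assoc, ← Units.val_mul, ← zpow_add, map_add]
  have e : ((nu ^ (- -1 + -3 : ℤ) : ZhAlgˣ) : ZhAlg) =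
      ((nu ^ (-1 : ℤ) : ZhAlgˣ) : ZhAlg) * ((nu ^ (-1 : ℤ) : ZhAlgˣ) : ZhAlg) := by
    rw [← Units.val_mul, ← zpow_add]
    rfl
  rw [e]
  simp only [smul_eq_mul]
  simp only [Algebra.smul_def (A := ZhAlg), map_mul, map_ofNat, Int.cast_neg, Int.cast_one, map_neg,
    map_one]
  ring

/-- The inversion of a homogeneous harmonic polynomial of degree `d` is, up to the factor `N^(-d)`,
again such a polynomial, since `Z⁻¹ = N(Z)⁻¹ Z♯`. -/
theorem exists_invA_eq {d : ℕ} {f : ZhAlg} (hf : f ∈ harm d) :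
    ∃ g ∈ harm d, invA f = g * ((nu ^ (-d : ℤ) : ZhAlgˣ) : ZhAlg) := by
  have key : ∀ h ∈ harm d, invA h * ((nu ^ (d : ℤ) : ZhAlgˣ) : ZhAlg) ∈ harm d := by
    have h0 : Submodule.span ℂ {f : ZhAlg | ∃ Y : HC, N Y = 0 ∧ f = trw Y ^ d} ≤ (harm d).comap
        ((LinearMap.mulRight ℂ ((nu ^ (d : ℤ) : ZhAlgˣ) : ZhAlg)).comp invA.toLinearMap) := by
      refine Submodule.span_le.2 ?_
      rintro f ⟨Y, hY, rfl⟩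
      have hY2 : N Y.adjugate = 0 := by
        rw [N_eq_det, Matrix.det_adjugate, ← N_eq_det, hY]
        simp
      have h1 : invA (trw Y) * (nu : ZhAlg) = trw Y.adjugate := by
        have hu : ((nu⁻¹ : ZhAlgˣ) : ZhAlg) * (nu : ZhAlg) = 1 := nu.inv_mul
        simp only [trw, map_add, map_sub, map_smul, invA_zc, zinv, Matrix.adjugate_fin_two]
        simp only [Matrix.smul_apply, Matrix.of_apply, Matrix.cons_val', Matrix.cons_val_zero,
          Matrix.cons_val_one, Matrix.cons_val_fin_one, zmat_apply, smul_eq_mul,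
          Algebra.smul_def (A := ZhAlg), map_neg]
        linear_combination (algebraMap ℂ ZhAlg (Y 0 0) * zc 0 0 + algebraMap ℂ ZhAlg (Y 1 0) * zc 0 1
          + algebraMap ℂ ZhAlg (Y 0 1) * zc 1 0 + algebraMap ℂ ZhAlg (Y 1 1) * zc 1 1) * hu
      have h2 : invA (trw Y ^ d) * ((nu ^ (d : ℤ) : ZhAlgˣ) : ZhAlg) = trw Y.adjugate ^ d := by
        rw [zpow_natCast, Units.val_pow_eq_pow_val, map_pow, ← mul_pow, h1]
      change invA (trw Y ^ d) * ((nu ^ (d : ℤ) : ZhAlgˣ) : ZhAlg) ∈ harm d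
      rw [h2]
      exact trw_pow_mem_harm hY2 d
    intro h hh
    have h1 : (tauSpanP fun n k => (n : ℤ) = d ∧ k = 0) ≤
        Submodule.span ℂ {f : ZhAlg | ∃ Y : HC, N Y = 0 ∧ f = trw Y ^ d} := by
      refine Submodule.span_le.2 ?_
      rintro f ⟨i, ⟨hi, hi0⟩, rfl⟩
      have h0 : i.1.2.2.2 = 0 := hi0
      have h3 : i.1.1 + i.1.2.1 = d := by exact_mod_cast hi
      rw [SetLike.mem_coe, tauBasis_apply, tauFn, h0, zpow_zero, Units.val_one, mul_one, ← h3]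
      exact tau_mem_span_trw _ _ _
    exact h0 (h1 (mem_tauSpanP_of_mem_harm hh))
  refine ⟨_, key f hf, ?_⟩
  rw [mul_assoc, ← Units.val_mul, ← zpow_add, add_neg_cancel, zpow_zero, Units.val_one, mul_one]

/-- Inversion followed by `N ^ (-n)` reflects the exponent of `N`: degree `d` and exponent `k` go to exponent
`-d - k - n`. -/
theorem invJ_mem_tauSpanP {P Q : ℕ → ℤ → Prop} (n : ℤ) (h : ∀ d k, P d k → Q d (-d - k - n))
    {f : ZhAlg} (hf : f ∈ tauSpanP P) : invJ n f ∈ tauSpanP Q := by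
  refine tauSpanP_induction (invJ n) (fun d k hk f hf => ?_) hf
  obtain ⟨g, hg, e⟩ := exists_invA_eq hf
  rw [invJ_apply, map_mul, e, invA_nu_zpow, mul_assoc, mul_assoc, ← Units.val_mul, ← Units.val_mul,
    ← zpow_add, ← zpow_add]
  refine harm_mul_mem_tauSpanP hg fun m hm => ?_
  have hm' : m = d := by exact_mod_cast hm
  have e2 : (-(d : ℤ) + (-k + -n)) = -d - k - n := by ring
  rw [hm', e2]
  exact h d k hk

theorem boxA_invJ {f : ZhAlg} (hf : f ∈ harmA) : boxA (invJ 1 f) = 0 := by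
  have h0 := mem_tauSpanP_of_mem_harmA hf
  have h1 := tauSpanP_induction (S := ⊥) (boxA.comp (invJ 1)) (fun d k hk f hf => ?_) h0
  · exact (Submodule.mem_bot ℂ).1 h1
  · subst hk
    obtain ⟨g, hg, e⟩ := exists_invA_eq hf
    rw [Submodule.mem_bot, zpow_zero, Units.val_one, mul_one, LinearMap.comp_apply, invJ_apply, e,
      mul_assoc, ← Units.val_mul, ← zpow_add, boxA_mul_nu_zpow hg.2.2, hg.2.1, zero_mul, zero_add]
    push_cast
    ring_nf
    exact zero_smul _ _

section

/-! ### The inversion and the integral over `U(2)_R` -/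

open MeasureTheory

theorem integral_paramBox_swap (G : (Fin 4 → ℝ) → ℂ) :
    ∫ y in paramBox, G (vec4 y) = ∫ y in paramBox, G ![y.1, y.2.2.1, y.2.1, y.2.2.2] := by
  let e : ℝ × ℝ × ℝ ≃ᵐ ℝ × ℝ × ℝ := MeasurableEquiv.prodAssoc.symm.trans
    ((MeasurableEquiv.prodComm.prodCongr (MeasurableEquiv.refl ℝ)).trans MeasurableEquiv.prodAssoc)
  have he : MeasurePreserving e := (volume_preserving_prodAssoc.symm _).trans
    ((Measure.measurePreserving_swap.prod (MeasurePreserving.id volume)).trans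
      volume_preserving_prodAssoc)
  let e4 : ℝ × ℝ × ℝ × ℝ ≃ᵐ ℝ × ℝ × ℝ × ℝ := (MeasurableEquiv.refl ℝ).prodCongr e
  have he4 : MeasurePreserving e4 := (MeasurePreserving.id volume).prod he
  have hb : e4 ⁻¹' paramBox = paramBox := by
    ext ⟨a, b, c, d⟩
    change (a ∈ _ ∧ c ∈ _ ∧ b ∈ _ ∧ d ∈ _) ↔ (a ∈ _ ∧ b ∈ _ ∧ c ∈ _ ∧ d ∈ _)
    tauto
  have h := he4.setIntegral_preimage_emb e4.measurableEmbedding (fun y => G (vec4 y)) paramBox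
  rw [hb] at h
  exact h.symm

theorem integral_sub_left_periodic {g : ℝ → ℂ} (hg : Function.Periodic g (2 * Real.pi)) (c : ℝ) :
    ∫ x in (0 : ℝ)..(2 * Real.pi), g (c - x) = ∫ x in (0 : ℝ)..(2 * Real.pi), g x := by
  rw [intervalIntegral.integral_comp_sub_left, sub_zero]
  have h := hg.intervalIntegral_add_eq (c - 2 * Real.pi) 0
  rwa [sub_add_cancel, zero_add] at h

/-- The parameter change that realizes `U ↦ U⁻¹` on the unitary group; periodicity in the three phases brings
the reflected box back to the original one. -/
theorem integral_paramBox_reflect {G : (Fin 4 → ℝ) → ℂ} (hG : Continuous G)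
    (h0 : ∀ a b c d, G ![a + 2 * Real.pi, b, c, d] = G ![a, b, c, d])
    (h1 : ∀ a b c d, G ![a, b + 2 * Real.pi, c, d] = G ![a, b, c, d])
    (h2 : ∀ a b c d, G ![a, b, c + 2 * Real.pi, d] = G ![a, b, c, d]) :
    ∫ y in paramBox, G (vec4 y) =
      ∫ y in paramBox, G ![0 - y.1, Real.pi - y.2.1, Real.pi - y.2.2.1, y.2.2.2] := by
  have hc : Continuous fun x : Fin 4 → ℝ => ![0 - x 0, Real.pi - x 1, Real.pi - x 2, x 3] := by
    refine continuous_pi fun i => ?_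
    fin_cases i <;> simp <;> fun_prop
  have e1 := iterated_integral_eq hG
  have e2 := iterated_integral_eq (hG.comp hc)
  rw [← e1]
  refine Eq.trans ?_ e2
  simp only [Function.comp_apply]
  symm
  refine (intervalIntegral.integral_congr fun x₀ _ => ?_).trans
    (integral_sub_left_periodic (g := fun x₀ => ∫ x₁ in (0 : ℝ)..(2 * Real.pi),
      ∫ x₂ in (0 : ℝ)..(2 * Real.pi), ∫ x₃ in (0 : ℝ)..(Real.pi / 2), G ![x₀, x₁, x₂, x₃])
      (fun x₀ => by simp only [h0]) 0)
  refine (intervalIntegral.integral_congr fun x₁ _ => ?_).trans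
    (integral_sub_left_periodic (g := fun x₁ =>
      ∫ x₂ in (0 : ℝ)..(2 * Real.pi), ∫ x₃ in (0 : ℝ)..(Real.pi / 2), G ![0 - x₀, x₁, x₂, x₃])
      (fun x₁ => by simp only [h1]) Real.pi)
  exact integral_sub_left_periodic (g := fun x₂ =>
      ∫ x₃ in (0 : ℝ)..(Real.pi / 2), G ![0 - x₀, Real.pi - x₁, x₂, x₃])
      (fun x₂ => by simp only [h2]) Real.pi

theorem chart_periodic (R : ℝ) (a b c d : ℝ) :
    chart R ![a + 2 * Real.pi, b, c, d] = chart R ![a, b, c, d] ∧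
    chart R ![a, b + 2 * Real.pi, c, d] = chart R ![a, b, c, d] ∧
    chart R ![a, b, c + 2 * Real.pi, d] = chart R ![a, b, c, d] := by
  have h : ∀ x : ℂ, Complex.exp (x + 2 * Real.pi * Complex.I) = Complex.exp x :=
    Complex.exp_periodic
  have e1 : ∀ x : ℂ, (x + 2 * Real.pi) * Complex.I = x * Complex.I + 2 * Real.pi * Complex.I :=
    fun x => by ring
  refine ⟨?_, ?_, ?_⟩ <;> ext i j <;> fin_cases i <;> fin_cases j <;>
    simp [chart, exp_sub_add_mul_I, e1, h]

/-- In the coordinates of `chart`, the inversion is given by a reflection. -/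
theorem chart_reflect {R : ℝ} (hR : 0 < R) (a b c d : ℝ) :
    chart R⁻¹ ![0 - a, Real.pi - c, Real.pi - b, d] = (chart R ![a, b, c, d])⁻¹ := by
  symm
  have hR' : (R : ℂ) ≠ 0 := by exact_mod_cast hR.ne'
  have e0 : Complex.exp ((0 - a : ℝ) * Complex.I) = (Complex.exp (a * Complex.I))⁻¹ := by
    rw [← Complex.exp_neg]
    congr 1
    push_cast
    ring
  have e1 : ∀ x : ℝ, Complex.exp ((Real.pi - x : ℝ) * Complex.I) = -(Complex.exp (x * Complex.I))⁻¹ := by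
    intro x
    rw [← Complex.exp_neg, Complex.ofReal_sub, sub_mul, sub_eq_add_neg, Complex.exp_add,
      Complex.exp_pi_mul_I, neg_one_mul]
  have hsc := Complex.sin_sq_add_cos_sq d
  have ha := Complex.exp_ne_zero (a * Complex.I)
  have hb := Complex.exp_ne_zero (b * Complex.I)
  have hc := Complex.exp_ne_zero (c * Complex.I)
  refine Matrix.inv_eq_right_inv ?_
  ext i j
  rw [Matrix.mul_apply, Fin.sum_univ_two]
  simp only [chart, exp_sub_add_mul_I, Matrix.cons_val_zero, Matrix.cons_val_one, Matrix.cons_val,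
    e0, e1, Complex.ofReal_inv]
  generalize Complex.exp (a * Complex.I) = u at *
  generalize Complex.exp (b * Complex.I) = v at *
  generalize Complex.exp (c * Complex.I) = w at *
  fin_cases i <;> fin_cases j <;> simp <;> field_simp
  · linear_combination hsc
  · ring
  · ring
  · linear_combination hsc

/-- The mean over `U(2)_{1/R}` is transformed into that over `U(2)_R` by the inversion. -/
theorem mean_inv {R : ℝ} (hR : 0 < R) {F : HC → ℂ} (hF : Continuous fun x => F (chart R⁻¹ x)) :
    mean R⁻¹ F = mean R fun Z => F Z⁻¹ := by
  have hG : Continuous fun x : Fin 4 → ℝ =>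
      F (chart R⁻¹ x) * ((Real.sin (x 3) : ℂ) * (Real.cos (x 3) : ℂ)) := hF.mul (by fun_prop)
  have h1 := integral_paramBox_swap fun x : Fin 4 → ℝ =>
      F (chart R⁻¹ x) * ((Real.sin (x 3) : ℂ) * (Real.cos (x 3) : ℂ))
  have hs : Continuous fun x : Fin 4 → ℝ => ![x 0, x 2, x 1, x 3] := by
    refine continuous_pi fun i => ?_
    fin_cases i <;> simp <;> fun_prop
  have hp := chart_periodic R⁻¹
  have h2 := integral_paramBox_reflect (hG.comp hs)
    (fun a b c d => by simp [(hp _ _ _ _).1]) (fun a b c d => by simp [(hp _ _ _ _).2.2])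
    (fun a b c d => by simp [(hp _ _ _ _).2.1])
  rw [mean, mean]
  congr 1
  refine (h1.trans h2).trans (integral_congr_ae (Filter.Eventually.of_forall fun y => ?_))
  simp [vec4, ← chart_reflect hR, density]

theorem N_inv_sub (Z W : HCx) :
    N ((Z⁻¹ : HCx) - (W⁻¹ : HCx) : HC) = N (Z - W : HC) / (N (Z : HC) * N (W : HC)) := by
  have h : ((Z⁻¹ : HCx) : HC) * (W - Z : HC) * ((W⁻¹ : HCx) : HC) = (Z⁻¹ : HCx) - (W⁻¹ : HCx) := by
    rw [mul_sub, sub_mul, Units.inv_mul, one_mul, mul_assoc, Units.mul_inv, mul_one]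
  rw [← h, N_eq_det, Matrix.det_mul, Matrix.det_mul, ← N_eq_det, ← N_eq_det, ← N_eq_det, N_inv, N_inv,
    N_sub_comm]
  field_simp

theorem inv_mem_DPlus {R : ℝ} (hR : 0 < R) {W : HCx} (hW : (W : HC) ∈ DMinus R) :
    ((W⁻¹ : HCx) : HC) ∈ DPlus R⁻¹ := by
  have hR' : (R : ℂ) ≠ 0 := by exact_mod_cast hR.ne'
  have h1 : ((W⁻¹ : HCx) : HC) * (W : HC) = 1 := W.inv_mul
  have h3 : (W : HC)ᴴ * ((W⁻¹ : HCx) : HC)ᴴ = 1 := by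
    rw [← Matrix.conjTranspose_mul, h1, Matrix.conjTranspose_one]
  have h2 : Matrix.PosDef (((W⁻¹ : HCx) : HC) * ((W : HC) * (W : HC)ᴴ - ((R : ℂ) ^ 2) • (1 : HC))
      * ((W⁻¹ : HCx) : HC)ᴴ) := by
    refine Matrix.PosDef.mul_mul_conjTranspose_same hW ?_
    exact Matrix.vecMul_injective_of_isUnit (W⁻¹).isUnit
  have hpos : (0 : ℂ) < ((R⁻¹ : ℝ) : ℂ) ^ 2 := by
    exact_mod_cast pow_pos (inv_pos.2 hR) 2
  have h4 := h2.smul hpos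
  have e : ((R⁻¹ : ℝ) : ℂ) ^ 2 • (((W⁻¹ : HCx) : HC) * ((W : HC) * (W : HC)ᴴ - ((R : ℂ) ^ 2) • (1 : HC))
      * ((W⁻¹ : HCx) : HC)ᴴ) = ((R⁻¹ : ℝ) : ℂ) ^ 2 • (1 : HC)
        - ((W⁻¹ : HCx) : HC) * ((W⁻¹ : HCx) : HC)ᴴ := by
    have e5 : ((W⁻¹ : HCx) : HC) * ((W : HC) * (W : HC)ᴴ) * ((W⁻¹ : HCx) : HC)ᴴ = 1 := by
      rw [← mul_assoc, h1, one_mul, h3]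
    rw [mul_sub, sub_mul, e5, Matrix.mul_smul, mul_one, Matrix.smul_mul, smul_sub, smul_smul,
      Complex.ofReal_inv, inv_pow, inv_mul_cancel₀ (pow_ne_zero 2 hR'), one_smul]
  rwa [e] at h4

/-- Points of `D⁻_R` are not on the light cone of a point of `U(2)_R`. -/
theorem N_chart_sub_ne_zero_of_mem_DMinus {R : ℝ} (hR : 0 < R) {W : HCx} (hW : (W : HC) ∈ DMinus R)
    (x : Fin 4 → ℝ) : N (chart R x - W) ≠ 0 := by
  have h1 := N_chart_sub_ne_zero (inv_pos.2 hR) (inv_mem_DPlus hR hW)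
    ![0 - x 0, Real.pi - x 2, Real.pi - x 1, x 3]
  have hx : ![x 0, x 1, x 2, x 3] = x := by
    ext i
    fin_cases i <;> rfl
  rw [chart_reflect hR, hx, ← chartU_coe hR, ← Matrix.coe_units_inv, N_inv_sub] at h1
  intro h
  rw [← chartU_coe hR] at h
  rw [h] at h1
  simp at h1

/-- The pairings with the kernel `1 / N(Z - W)` at `W` and at `W⁻¹`. -/
theorem pairKernel_invJ {R : ℝ} (hR : 0 < R) {W : HCx} (hW : (W : HC) ∈ DMinus R) (f g : Zh)
    (hfg : ∀ Z : HCx, (g : Fn) Z = (f : Fn) Z⁻¹ / N (Z : HC) ^ 3) :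
    pairKernel R⁻¹ g ((W⁻¹ : HCx) : HC) = N (W : HC) * pairKernel R f W := by
  have hR' := inv_pos.2 hR
  have hW' := N_chart_sub_ne_zero hR' (inv_mem_DPlus hR hW)
  rw [pairKernel_eq_mean hR' hW',
    pairKernel_eq_mean hR (N_chart_sub_ne_zero_of_mem_DMinus hR hW), mean_inv hR, ← mean_const_mul]
  · rw [mean, mean]
    congr 2
    funext y
    congr 1
    have hn := N_chart_sub_ne_zero_of_mem_DMinus hR hW (vec4 y)
    rw [← chartU_coe hR] at hn ⊢
    generalize chartU hR (vec4 y) = Y at hn ⊢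
    rw [← Matrix.coe_units_inv, ext_coe, ext_coe, hfg, inv_inv, N_inv, N_inv_sub]
    have h1 := N_ne_zero Y
    have h2 := N_ne_zero W
    field_simp
  · exact (continuous_kernel hR' hW' ⟨g, g.2⟩).mul
      ((by simpa using continuous_N_chart_sub R⁻¹ 0 : Continuous fun x => N (chart R⁻¹ x)).pow 2)

end

/-! ### The subspaces of `Zh` -/

/-- The ring `ZhAlg` and its underlying vector space `Zh`. -/
def algEquiv : ZhAlg ≃ₗ[ℂ] Zh := LinearEquiv.refl ℂ Zh

theorem algEquiv_coe (f : ZhAlg) : (algEquiv f : Fn) = f := rfl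

theorem mem_ZhPlus {f : ZhAlg} : algEquiv f ∈ ZhPlus ↔ f ∈ polyA := coe_mem_polyFn

theorem map_tauSpanP (P : ℕ → ℤ → Prop) :
    (tauSpanP P).map (algEquiv : ZhAlg →ₗ[ℂ] Zh) = tSpan P := by
  rw [tauSpanP, Submodule.map_span, tSpan, ← Set.image_comp]
  congr 1
  ext f
  constructor
  · rintro ⟨⟨⟨p, q, r, k⟩, hr⟩, h, rfl⟩
    refine ⟨p, q, r, k, hr, h, fun Z => ?_⟩
    rw [Function.comp_apply, tauBasis_apply, ← tau_apply, ← nu_zpow_apply]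
    rfl
  · rintro ⟨p, q, r, k, hr, h, hf⟩
    refine ⟨⟨(p, q, r, k), hr⟩, h, Subtype.ext (funext fun Z => ?_)⟩
    rw [Function.comp_apply, tauBasis_apply]
    refine Eq.trans ?_ (hf Z).symm
    rw [← tau_apply, ← nu_zpow_apply]
    rfl

theorem mem_tSpan {P : ℕ → ℤ → Prop} {f : ZhAlg} : algEquiv f ∈ tSpan P ↔ f ∈ tauSpanP P := by
  rw [← map_tauSpanP]
  exact ⟨fun ⟨g, hg, e⟩ => algEquiv.injective e ▸ hg, Submodule.mem_map_of_mem⟩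

theorem invJ_coe (n : ℕ) (f : ZhAlg) : (invJ n f : Fn) = inversion n f := by
  funext Z
  rw [invJ_apply, mul_apply, nu_zpow_apply, invA_apply, zpow_neg, zpow_natCast, ← div_eq_mul_inv]
  rfl

theorem mem_ZhMinus {f : ZhAlg} : algEquiv f ∈ ZhMinus 2 ↔ invJ 3 f ∈ polyA := by
  rw [← coe_mem_polyFn, show (invJ 3 f : Fn) = inversion 3 f from invJ_coe 3 f]
  rfl

theorem mem_sup_plus {f : ZhAlg} : algEquiv f ∈ IMinus ⊔ ZhPlus ↔ f ∈ sumPlus := by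
  have h : ∀ {g h : ZhAlg}, algEquiv (g + h) = algEquiv g + algEquiv h := fun {g h} => map_add _ g h
  rw [sumPlus, Submodule.mem_sup, Submodule.mem_sup]
  constructor
  · rintro ⟨g, hg, h, hh, e⟩
    exact ⟨algEquiv.symm g, mem_tSpan.1 hg, algEquiv.symm h, mem_ZhPlus.1 hh, e⟩
  · rintro ⟨g, hg, h, hh, e⟩
    exact ⟨algEquiv g, mem_tSpan.2 hg, algEquiv h, mem_ZhPlus.2 hh, e⟩

theorem invJ_mem_tauSpanP_iff {f : ZhAlg} : invJ 3 f ∈ (tauSpanP fun _ k => k ≤ -2) ↔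
    f ∈ tauSpanP fun l2 k => -((l2 : ℤ) + 1) ≤ k := by
  constructor
  · intro h
    rw [← invJ_invJ 3 f]
    exact invJ_mem_tauSpanP 3 (fun d k hk => by omega) h
  · exact invJ_mem_tauSpanP 3 fun d k hk => by omega

/-- Inversion carries the second sum to the first one, so the second quotient reduces to the first. -/
theorem mem_sup_minus {f : ZhAlg} : algEquiv f ∈ ZhMinus 2 ⊔ IPlus ↔ invJ 3 f ∈ sumPlus := by
  rw [sumPlus, Submodule.mem_sup, Submodule.mem_sup]
  constructor
  · rintro ⟨g, hg, h, hh, e⟩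
    refine ⟨invJ 3 (algEquiv.symm h), invJ_mem_tauSpanP_iff.2 (mem_tSpan.1 hh),
      invJ 3 (algEquiv.symm g), mem_ZhMinus.1 hg, ?_⟩
    rw [add_comm, ← map_add, ← map_add, e, LinearEquiv.symm_apply_apply]
  · rintro ⟨g, hg, h, hh, e⟩
    refine ⟨algEquiv (invJ 3 h), mem_ZhMinus.2 (by rwa [invJ_invJ]), algEquiv (invJ 3 g),
      mem_tSpan.2 (invJ_mem_tauSpanP_iff.1 (by rwa [invJ_invJ])), ?_⟩
    rw [add_comm, ← map_add, ← map_add, e, invJ_invJ]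

theorem disjoint_IMinus_ZhPlus : Disjoint IMinus ZhPlus := by
  rw [Submodule.disjoint_def]
  intro f h1 h2
  have h3 : algEquiv.symm f ∈ Subalgebra.toSubmodule polyA := mem_ZhPlus.1 h2
  rw [polyA_eq_tauSpanP] at h3
  exact (LinearEquiv.map_eq_zero_iff algEquiv.symm).1 (Submodule.disjoint_def.1
    (disjoint_tauSpanP fun _ k (h : k ≤ -2) (h' : 0 ≤ k) => by omega) _ (mem_tSpan.1 h1) h3)

theorem disjoint_ZhMinus_IPlus : Disjoint (ZhMinus 2) IPlus := by
  rw [Submodule.disjoint_def]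
  intro f h1 h2
  have h3 : invJ 3 (algEquiv.symm f) ∈ Subalgebra.toSubmodule polyA := mem_ZhMinus.1 h1
  have h4 := invJ_mem_tauSpanP_iff.2 ((mem_tSpan (f := algEquiv.symm f)).1 h2)
  rw [polyA_eq_tauSpanP] at h3
  have h5 := Submodule.disjoint_def.1
    (disjoint_tauSpanP fun _ k (h : k ≤ -2) (h' : 0 ≤ k) => by omega) _ h4 h3
  refine (LinearEquiv.map_eq_zero_iff algEquiv.symm).1 ?_
  rw [← invJ_invJ 3 (algEquiv.symm f), h5, map_zero]

/-! ### The representations -/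

/-- A representation on a vector space restricts to the subspaces that it preserves. -/
def subRep {V : Type} [AddCommGroup V] [Module ℂ V] (ρ : gl2HC →ₗ⁅ℂ⁆ Module.End ℂ V)
    (S : Submodule ℂ V) (h : ∀ X, ∀ v ∈ S, ρ X v ∈ S) : gl2HC →ₗ⁅ℂ⁆ Module.End ℂ S where
  toFun X := (ρ X).restrict (h X)
  map_add' X Y := LinearMap.ext fun v => Subtype.ext (by simp)
  map_smul' c X := LinearMap.ext fun v => Subtype.ext (by simp)
  map_lie' {X Y} := LinearMap.ext fun v => Subtype.ext (by
    change ρ ⁅X, Y⁆ (v : V) = _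
    rw [LieHom.map_lie]
    rfl)

/-- A representation on a vector space induces one on the quotient by an invariant subspace. -/
def quotRep {V : Type} [AddCommGroup V] [Module ℂ V] (ρ : gl2HC →ₗ⁅ℂ⁆ Module.End ℂ V)
    (S : Submodule ℂ V) (h : ∀ X, ∀ v ∈ S, ρ X v ∈ S) : gl2HC →ₗ⁅ℂ⁆ Module.End ℂ (V ⧸ S) where
  toFun X := S.mapQ S (ρ X) (h X)
  map_add' X Y := Submodule.linearMap_qext _ (LinearMap.ext fun v => by simp)
  map_smul' c X := Submodule.linearMap_qext _ (LinearMap.ext fun v => by simp)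
  map_lie' {X Y} := Submodule.linearMap_qext _ (LinearMap.ext fun v => by
    simp only [LieHom.map_lie]
    simp [Ring.lie_def])

theorem isQuotientRep_quotRep {V : Type} [AddCommGroup V] [Module ℂ V]
    (ρ : gl2HC →ₗ⁅ℂ⁆ Module.End ℂ V) (S : Submodule ℂ V) (h : ∀ X, ∀ v ∈ S, ρ X v ∈ S) :
    IsQuotientRep S ρ (quotRep ρ S h) := fun _ _ => rfl

/-- The transport of a representation along an isomorphism of vector spaces. -/
def conjRep {V W : Type} [AddCommGroup V] [Module ℂ V] [AddCommGroup W] [Module ℂ W]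
    (e : V ≃ₗ[ℂ] W) (ρ : gl2HC →ₗ⁅ℂ⁆ Module.End ℂ V) : gl2HC →ₗ⁅ℂ⁆ Module.End ℂ W :=
  (e.lieConj : Module.End ℂ V →ₗ⁅ℂ⁆ Module.End ℂ W).comp ρ

/-- The representation `ϖ₂` on `Zh`. -/
def repZh : gl2HC →ₗ⁅ℂ⁆ Module.End ℂ Zh := conjRep algEquiv (rep 3 (-1))

theorem repZh_algEquiv (X : gl2HC) (f : ZhAlg) : repZh X (algEquiv f) = algEquiv (rep 3 (-1) X f) := rfl

theorem isDifferentiated_repZh : IsDifferentiated (varpi 2) incl repZh := fun X f Z =>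
  hasDerivAt_varpi X (algEquiv.symm f) Z

theorem repZh_mem_plus (X : gl2HC) (f : Zh) (hf : f ∈ IMinus ⊔ ZhPlus) :
    repZh X f ∈ IMinus ⊔ ZhPlus := by
  obtain ⟨f, rfl⟩ := algEquiv.surjective f
  rw [repZh_algEquiv, mem_sup_plus]
  exact rep_mem_sumPlus X (mem_sup_plus.1 hf)

theorem repZh_mem_minus (X : gl2HC) (f : Zh) (hf : f ∈ ZhMinus 2 ⊔ IPlus) :
    repZh X f ∈ ZhMinus 2 ⊔ IPlus := by
  obtain ⟨f, rfl⟩ := algEquiv.surjective f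
  have h := rep_invJ 3 (-1) (swapBlocks X) f
  rw [swapBlocks_swapBlocks, Int.cast_ofNat] at h
  rw [repZh_algEquiv, mem_sup_minus, ← h]
  exact rep_mem_sumPlus _ (mem_sup_minus.1 hf)

theorem coe_mem_HPlus {f : ZhAlg} : (f : Fn) ∈ HPlus ↔ f ∈ harmA := by
  have h : box f = 0 ↔ boxA f = 0 := by
    rw [← boxA_coe]
    exact ⟨fun h => Subtype.ext h, fun h => by rw [h]; rfl⟩
  constructor
  · rintro ⟨h1, h2⟩
    exact ⟨coe_mem_polyFn.1 h1, h.1 h2.2⟩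
  · rintro ⟨h1, h2⟩
    exact ⟨coe_mem_polyFn.2 h1, f.2, h.2 h2⟩

/-- The functions whose inversion is a harmonic polynomial. -/
def harmMinus : Submodule ℂ ZhAlg := harmA.comap (invJ 1)

theorem mem_harmMinus {f : ZhAlg} : f ∈ harmMinus ↔ invJ 1 f ∈ harmA := Iff.rfl

theorem coe_mem_HMinus {f : ZhAlg} : (f : Fn) ∈ HMinus ↔ f ∈ harmMinus := by
  rw [mem_harmMinus]
  have e : inversion 1 (f : Fn) = invJ 1 f := (invJ_coe 1 f).symm
  constructor
  · rintro ⟨-, h2⟩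
    rw [← coe_mem_HPlus, ← e]
    exact h2
  · intro h
    have h1 : boxA f = 0 := by
      rw [← invJ_invJ 1 f]
      exact boxA_invJ h
    refine ⟨⟨f.2, ?_⟩, ?_⟩
    · rw [← boxA_coe, h1]
      rfl
    · have h2 := coe_mem_HPlus.2 h
      rw [← e] at h2
      exact h2

theorem rep_one_mem_harmMinus (X : gl2HC) {f : ZhAlg} (hf : f ∈ harmMinus) :
    rep 1 0 X f ∈ harmMinus := by
  have h := rep_invJ 1 0 (swapBlocks X) f
  rw [swapBlocks_swapBlocks, Int.cast_one] at h
  rw [mem_harmMinus, ← h]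
  exact rep_one_mem_harmA _ hf

/-- A subspace `T` of functions that is contained in `Zh` is isomorphic to the corresponding
subspace `S` of `ZhAlg`. -/
def coeEquiv (S : Submodule ℂ ZhAlg) (T : Submodule ℂ Fn) (hT : T ≤ Zh)
    (h : ∀ f : ZhAlg, (f : Fn) ∈ T ↔ f ∈ S) : S ≃ₗ[ℂ] T where
  toFun f := ⟨(f : ZhAlg), (h f).2 f.2⟩
  map_add' _ _ := rfl
  map_smul' _ _ := rfl
  invFun f := ⟨⟨f, hT f.2⟩, (h _).1 f.2⟩
  left_inv _ := rfl
  right_inv _ := rfl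

/-- The representation `π⁰_l` on an invariant subspace of `Zh`. -/
def repSub (S : Submodule ℂ ZhAlg) (T : Submodule ℂ Fn) (hT : T ≤ Zh)
    (h : ∀ f : ZhAlg, (f : Fn) ∈ T ↔ f ∈ S) (hS : ∀ X, ∀ f ∈ S, rep 1 0 X f ∈ S) :
    gl2HC →ₗ⁅ℂ⁆ Module.End ℂ T :=
  conjRep (V := S) (W := T) (coeEquiv S T hT h) (subRep (rep 1 0) S hS)

section Classes

variable {S : Submodule ℂ ZhAlg} {T : Submodule ℂ Fn} (hT : T ≤ Zh)
  (h : ∀ f : ZhAlg, (f : Fn) ∈ T ↔ f ∈ S)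

theorem repSub_coeEquiv (hS : ∀ X, ∀ f ∈ S, rep 1 0 X f ∈ S) (X : gl2HC) (f : S) :
    repSub S T hT h hS X (coeEquiv S T hT h f) = coeEquiv S T hT h ⟨rep 1 0 X f, hS X f f.2⟩ := rfl

theorem isDifferentiated_repSub (hS : ∀ X, ∀ f ∈ S, rep 1 0 X f ∈ S) :
    IsDifferentiated piL T.subtype (repSub S T hT h hS) := fun X f Z =>
  hasDerivAt_piL X ⟨f, hT f.2⟩ Z

variable (Q : Submodule ℂ Zh) (hinj : ∀ f ∈ S, algEquiv (degN f) ∈ Q → f = 0)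
  (hsurj : ∀ g : ZhAlg, ∃ f ∈ S, algEquiv (g - degN f) ∈ Q)

/-- The isomorphism that sends `φ` to the class of `N⁻¹ (φ + E φ)`, for a subspace of functions
on which this map is bijective. -/
def classEquiv : T ≃ₗ[ℂ] Zh ⧸ Q :=
  (coeEquiv S T hT h).symm.trans (LinearEquiv.ofBijective
    (Q.mkQ ∘ₗ (algEquiv : ZhAlg →ₗ[ℂ] Zh) ∘ₗ degN ∘ₗ S.subtype) (by
      constructor
      · intro f g hfg
        have h1 : algEquiv (degN (f - g)) ∈ Q := by
          rw [map_sub, map_sub]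
          exact (Submodule.Quotient.eq Q).1 hfg
        exact Subtype.ext (sub_eq_zero.1 (hinj _ (S.sub_mem f.2 g.2) h1))
      · intro g
        obtain ⟨g, rfl⟩ := Q.mkQ_surjective g
        obtain ⟨f, hf, hfg⟩ := hsurj (algEquiv.symm g)
        exact ⟨⟨f, hf⟩, ((Submodule.Quotient.eq Q).2 hfg).symm⟩))

theorem classEquiv_coeEquiv (f : S) : classEquiv hT h Q hinj hsurj (coeEquiv S T hT h f) =
    Q.mkQ (algEquiv (degN f)) := rfl

theorem classEquiv_symm {f g : ZhAlg} (hf : f ∈ S) (hfg : algEquiv (g - degN f) ∈ Q) :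
    (classEquiv hT h Q hinj hsurj).symm (Q.mkQ (algEquiv g)) = coeEquiv S T hT h ⟨f, hf⟩ := by
  rw [LinearEquiv.symm_apply_eq, classEquiv_coeEquiv]
  exact (Submodule.Quotient.eq Q).2 hfg

theorem classEquiv_repSub (hS : ∀ X, ∀ f ∈ S, rep 1 0 X f ∈ S)
    (hQ : ∀ X, ∀ f ∈ Q, repZh X f ∈ Q)
    (hr : ∀ X, ∀ f ∈ S, algEquiv (rep 3 (-1) X (degN f) - degN (rep 1 0 X f)) ∈ Q)
    (X : gl2HC) (φ : T) : classEquiv hT h Q hinj hsurj (repSub S T hT h hS X φ) =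
      quotRep repZh Q hQ X (classEquiv hT h Q hinj hsurj φ) := by
  obtain ⟨f, rfl⟩ := (coeEquiv S T hT h).surjective φ
  rw [repSub_coeEquiv, classEquiv_coeEquiv, classEquiv_coeEquiv, isQuotientRep_quotRep,
    repZh_algEquiv]
  exact ((Submodule.Quotient.eq Q).2 (hr X f f.2)).symm

theorem exists_classEquiv_eq (φ : T) : ∃ g : Zh,
    (∀ Z : HCx, (g : Fn) Z = degt (φ : Fn) Z / N (Z : HC)) ∧
      classEquiv hT h Q hinj hsurj φ = Q.mkQ g := by
  obtain ⟨f, rfl⟩ := (coeEquiv S T hT h).surjective φ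
  refine ⟨algEquiv (degN f), fun Z => ?_, classEquiv_coeEquiv hT h Q hinj hsurj f⟩
  rw [algEquiv_coe, degN_apply, mul_apply, coe_nu_inv, degt_coe, div_eq_mul_inv]
  rfl

end Classes

theorem HPlus_le : HPlus ≤ Zh := fun _ hf => hf.2.1

theorem HMinus_le : HMinus ≤ Zh := fun _ hf => hf.1.1

theorem eq_zero_of_degN_mem_minus {f : ZhAlg} (hf : f ∈ harmMinus)
    (h : algEquiv (degN f) ∈ ZhMinus 2 ⊔ IPlus) : f = 0 := by
  rw [mem_sup_minus] at h
  have h1 := degN_invJ f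
  have h2 : invJ 1 f = 0 := eq_zero_of_degN_mem hf (by rw [h1]; exact neg_mem h)
  rw [← invJ_invJ 1 f, h2, map_zero]

/-- If `f` represents the class of `invJ 3 g` modulo `sumPlus`, then `-invJ 1 f` represents that
of `g` modulo the inverted subspace. -/
theorem sub_degN_mem_minus {f g : ZhAlg} (h : invJ 3 g - degN f ∈ sumPlus) :
    algEquiv (g - degN (-invJ 1 f)) ∈ ZhMinus 2 ⊔ IPlus := by
  rw [mem_sup_minus, map_neg, degN_invJ, neg_neg, map_sub, invJ_invJ]
  exact h

theorem neg_invJ_mem_harmMinus {f : ZhAlg} (hf : f ∈ harmA) : -invJ 1 f ∈ harmMinus := by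
  rw [mem_harmMinus, map_neg, invJ_invJ]
  exact neg_mem hf

theorem rep_degN_sub_mem_minus (X : gl2HC) {f : ZhAlg} (hf : f ∈ harmMinus) :
    algEquiv (rep 3 (-1) X (degN f) - degN (rep 1 0 X f)) ∈ ZhMinus 2 ⊔ IPlus := by
  have h := rep_degN_sub_mem (swapBlocks X) hf
  have h1 := rep_invJ 1 0 (swapBlocks X) f
  have h3 := rep_invJ 3 (-1) (swapBlocks X) (degN f)
  rw [swapBlocks_swapBlocks] at h1 h3
  rw [Int.cast_one] at h1
  rw [Int.cast_ofNat] at h3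
  rw [degN_invJ, map_neg, h3, h1, degN_invJ, ← neg_sub', ← map_sub] at h
  rw [mem_sup_minus]
  exact neg_mem_iff.1 h

/-- The isomorphism of `H⁺` with the quotient of `Zh` by `I₂⁻ ⊕ Zh⁺`. -/
def equivPlus : HPlus ≃ₗ[ℂ] Zh ⧸ (IMinus ⊔ ZhPlus) :=
  classEquiv HPlus_le (fun _ => coe_mem_HPlus) (IMinus ⊔ ZhPlus)
    (fun _ hf h => eq_zero_of_degN_mem hf (mem_sup_plus.1 h))
    fun g => by
      obtain ⟨f, hf, -, -, h, -⟩ := exists_harmA g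
      exact ⟨f, hf, mem_sup_plus.2 h⟩

/-- The isomorphism of `H⁻` with the quotient of `Zh` by `Zh₂⁻ ⊕ I₂⁺`. -/
def equivMinus : HMinus ≃ₗ[ℂ] Zh ⧸ (ZhMinus 2 ⊔ IPlus) :=
  classEquiv HMinus_le (fun _ => coe_mem_HMinus) (ZhMinus 2 ⊔ IPlus)
    (fun _ => eq_zero_of_degN_mem_minus)
    fun g => by
      obtain ⟨f, hf, -, -, h, -⟩ := exists_harmA (invJ 3 g)
      exact ⟨-invJ 1 f, neg_invJ_mem_harmMinus hf, sub_degN_mem_minus h⟩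

/-- The inverse of `equivPlus` is given by the pairing with the kernel `1 / N(Z - W)`. -/
theorem equivPlus_symm (f : Zh) : ∃ P : MvPolynomial (Fin 2 × Fin 2) ℂ,
    (∀ Z : HCx, (equivPlus.symm ((IMinus ⊔ ZhPlus).mkQ f) : Fn) Z = polyEval P (Z : HC)) ∧
    ∀ R : ℝ, 0 < R → ∀ W ∈ DPlus R, polyEval P W = pairKernel R f W := by
  obtain ⟨φ, hφ, P, hP, h, hk⟩ := exists_harmA (algEquiv.symm f)
  refine ⟨P, fun Z => ?_, fun R hR W hW => (hk R hR W hW).trans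
    (pairKernel_eq_kernelL hR hW f).symm⟩
  rw [← hP, ← algEquiv.apply_symm_apply f, equivPlus,
    classEquiv_symm _ _ _ _ _ hφ (mem_sup_plus.2 h)]
  rfl

/-- The inverse of `equivMinus` is given by the pairing with the kernel `1 / N(Z - W)`. It is
obtained from that of `equivPlus` by the inversion. -/
theorem equivMinus_symm (f : Zh) {R : ℝ} (hR : 0 < R) {W : HCx} (hW : (W : HC) ∈ DMinus R) :
    (equivMinus.symm ((ZhMinus 2 ⊔ IPlus).mkQ f) : Fn) W = -pairKernel R f (W : HC) := by
  obtain ⟨f, rfl⟩ := algEquiv.surjective f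
  obtain ⟨φ, hφ, P, hP, h, hk⟩ := exists_harmA (invJ 3 f)
  have hW' := inv_mem_DPlus hR hW
  have h1 := pairKernel_invJ hR hW (algEquiv f) (algEquiv (invJ 3 f))
    fun Z => congrFun (invJ_coe 3 f) Z
  have h3 : pairKernel R⁻¹ (algEquiv (invJ 3 f)) ((W⁻¹ : HCx) : HC)
      = kernelL (inv_pos.2 hR) hW' (invJ 3 f) := pairKernel_eq_kernelL _ _ _
  rw [h3, ← hk, ← hP] at h1
  rw [equivMinus,
    classEquiv_symm _ _ _ _ _ (neg_invJ_mem_harmMinus hφ) (sub_degN_mem_minus h)]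
  change ((-invJ 1 φ : ZhAlg) : Fn) W = _
  have h2 : (invJ 1 φ : Fn) W = (φ : Fn) W⁻¹ / N (W : HC) ^ 1 := congrFun (invJ_coe 1 φ) W
  rw [neg_apply, h2, h1, pow_one, mul_div_cancel_left₀ _ (N_ne_zero W)]

end TwoLoop

end

open TwoLoop in
theorem proposition4 :
    -- `U(2)_R` carries the orientation for which `∫ dV / N(Z)² = -2π³ i`
    (∀ R : ℝ, 0 < R →
      intU2 R (fun Z => 1 / N Z ^ 2) = -2 * (Real.pi : ℂ) ^ 3 * Complex.I) ∧
    -- the sums `I₂⁻ ⊕ Zh⁺` and `Zh₂⁻ ⊕ I₂⁺` are direct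
    Disjoint IMinus ZhPlus ∧ Disjoint (ZhMinus 2) IPlus ∧
    -- the representations `(ϖ₂, Zh)`, its two quotients, `(π⁰_l, H⁺)` and `(π⁰_l, H⁻)`
    ∃ (ϖ : gl2HC →ₗ⁅ℂ⁆ Module.End ℂ Zh)
      (ϖp : gl2HC →ₗ⁅ℂ⁆ Module.End ℂ (Zh ⧸ (IMinus ⊔ ZhPlus)))
      (ϖm : gl2HC →ₗ⁅ℂ⁆ Module.End ℂ (Zh ⧸ (ZhMinus 2 ⊔ IPlus)))
      (πp : gl2HC →ₗ⁅ℂ⁆ Module.End ℂ HPlus)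
      (πm : gl2HC →ₗ⁅ℂ⁆ Module.End ℂ HMinus),
      IsDifferentiated (varpi 2) incl ϖ ∧
      IsQuotientRep (IMinus ⊔ ZhPlus) ϖ ϖp ∧
      IsQuotientRep (ZhMinus 2 ⊔ IPlus) ϖ ϖm ∧
      IsDifferentiated piL HPlus.subtype πp ∧
      IsDifferentiated piL HMinus.subtype πm ∧
      -- the isomorphism of `(π⁰_l, H⁺)` with the first quotient, and its inverse
      (∃ e : HPlus ≃ₗ[ℂ] (Zh ⧸ (IMinus ⊔ ZhPlus)),
        (∀ (X : gl2HC) (φ : HPlus), e (πp X φ) = ϖp X (e φ)) ∧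
        (∀ φ : HPlus, ∃ g : Zh,
          (∀ Z : HCx, (g : Fn) Z = degt (φ : Fn) Z / N (Z : HC)) ∧
          e φ = (IMinus ⊔ ZhPlus).mkQ g) ∧
        (∀ f : Zh, ∃ P : MvPolynomial (Fin 2 × Fin 2) ℂ,
          (∀ Z : HCx, (e.symm ((IMinus ⊔ ZhPlus).mkQ f) : Fn) Z = polyEval P (Z : HC)) ∧
          ∀ R : ℝ, 0 < R → ∀ W ∈ DPlus R, polyEval P W = pairKernel R f W)) ∧
      -- the isomorphism of `(π⁰_l, H⁻)` with the second quotient, and its inverse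
      (∃ e : HMinus ≃ₗ[ℂ] (Zh ⧸ (ZhMinus 2 ⊔ IPlus)),
        (∀ (X : gl2HC) (φ : HMinus), e (πm X φ) = ϖm X (e φ)) ∧
        (∀ φ : HMinus, ∃ g : Zh,
          (∀ Z : HCx, (g : Fn) Z = degt (φ : Fn) Z / N (Z : HC)) ∧
          e φ = (ZhMinus 2 ⊔ IPlus).mkQ g) ∧
        (∀ (f : Zh) (R : ℝ), 0 < R → ∀ W : HCx, (W : HC) ∈ DMinus R →
          (e.symm ((ZhMinus 2 ⊔ IPlus).mkQ f) : Fn) W = -pairKernel R f (W : HC))) := by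
  refine ⟨fun R hR => intU2_one_div_N_sq hR, disjoint_IMinus_ZhPlus, disjoint_ZhMinus_IPlus, repZh,
    quotRep repZh _ repZh_mem_plus, quotRep repZh _ repZh_mem_minus,
    repSub harmA HPlus HPlus_le (fun _ => coe_mem_HPlus) fun X _ => rep_one_mem_harmA X,
    repSub harmMinus HMinus HMinus_le (fun _ => coe_mem_HMinus) fun X _ => rep_one_mem_harmMinus X,
    isDifferentiated_repZh, isQuotientRep_quotRep _ _ _, isQuotientRep_quotRep _ _ _,
    isDifferentiated_repSub _ _ _, isDifferentiated_repSub _ _ _,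
    ⟨equivPlus, classEquiv_repSub _ _ _ _ _ _ repZh_mem_plus
      fun X _ hf => mem_sup_plus.2 (rep_degN_sub_mem X hf),
      exists_classEquiv_eq _ _ _ _ _, equivPlus_symm⟩,
    ⟨equivMinus, classEquiv_repSub _ _ _ _ _ _ repZh_mem_minus
      fun X _ hf => rep_degN_sub_mem_minus X hf,
      exists_classEquiv_eq _ _ _ _ _, fun f R hR W hW => equivMinus_symm f hR hW⟩⟩
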